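/- **Conventions.** Let $A$, $B$ be C*-algebras (not necessarily unital). An $A$–$B$ C*-correspondence $(X,\pi_X)$ is a (right) Hilbert $B$-module $X$ with a $*$-homomorphism $\pi_X$ from $A$ into the adjointable operators on $X$; if $A=B$ it is called a C*-correspondence over $A$. For a $*$-representation $\varphi$ of $B$ on a Hilbert space $H$, let $X\otimes_\varphi H$ be the interior tensor product, i.e. the Hilbert space obtained from the algebraic tensor product $X\odot H$ by separation and completion for $\langle x\otimes h, y\otimes k\rangle=\langle h,\varphi(\langle x,y\rangle)k\rangle$. * *Identity correspondence.* $(A,\lambda_A)$ is $A$ as a Hilbert module over itself, $\langle a,b\rangle=a^*b$, with $\lambda_A(a)b=ab$. * *Scalar representation.* For a $*$-representation $\pi_H:A\to\mathbb B(H)$, $(H\otimes A,\pi_H\otimes 1_A)$ is the C*-correspondence over $A$ whose Hilbert module is the completion of $H\odot A$ for $\langle h\otimes a,k\otimes b\rangle=\langle h,k\rangle a^*b$, with left action $(\pi_H\otimes 1_A)(c)(h\otimes a)=\pi_H(c)h\otimes a$. * *Weak containment.* A $*$-representation $\sigma$ of a C*-algebra is weakly contained in a $*$-representation $\tau$ if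 $\ker\tau\subseteq\ker\sigma$. For $A$–$B$ C*-correspondences $X$, $Y$ write $X\prec_{\mathrm{univ}}Y$ if the representation $\theta_X:A\otimes_{\max}\pi_u(B)'\to\mathbb B(X\otimes_{\pi_u}H_u)$, $\theta_X(a\otimes y)=\pi_X(a)\otimes y$, is weakly contained in $\theta_Y$, where $(H_u,\pi_u)$ is the universal representation of $B$ (the direct sum of the GNS representations of all states) and $\pi_u(B)'$ is the commutant of $\pi_u(B)$. * *UFP.* A C*-correspondence $(X,\pi_X)$ over $A$ has the universal factorization property (UFP) if for every C*-algebra $B$, every nondegenerate $*$-representation $\sigma$ of $A\otimes_{\max}B$ on a Hilbert space $H$, written $\sigma(a\otimes b)=\sigma_A(a)\sigma_B(b)$ with $*$-representations $\sigma_A$, $\sigma_B$ of $A$, $B$ on $H$ with commuting ranges, is weakly contained in the representation $a\otimes b\mapsto\pi_X(a)\otimes\sigma_B(b)$ of $A\otimes_{\max}B$ on $X\otimes_{\sigma_A}H$. * *Nuclearity.* $A$ is nuclear if for every C*-algebra $B$ the maximal and the minimal (spatial) C*-norms on the algebraic tensor product $A\odot B$ coincide. **Theorem.** Let $A$ be a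 C*-algebra. 1. For every C*-correspondence $(X,\pi_X)$ over $A$: $(X,\pi_X)$ has the UFP if and only if $(A,\lambda_A)\prec_{\mathrm{univ}}(X,\pi_X)$. 2. For every faithful $*$-representation $\pi_H:A\to\mathbb B(H)$ the following are equivalent: (a) $A$ is nuclear; (b) $(H\otimes A,\pi_H\otimes 1_A)$ has the UFP; (c) $(A,\lambda_A)\prec_{\mathrm{univ}}(H\otimes A,\pi_H\otimes 1_A)$. -/

import Mathlib

open scoped TensorProduct InnerProductSpace ComplexOrder

universe u

noncomputable section

namespace CStarCorr

/-- A (right) Hilbert C*-module over `A`: a complex Banach space `X` (completeness is a separate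
type class) with a right action `rsmul` of `A` and an `A`-valued inner product, linear in the second
variable, whose norm is `‖x‖ = ‖⟨x, x⟩‖ ^ (1/2)`. Since `X` is a normed group, `⟨x, x⟩ = 0` forces
`x = 0`, and the bilinearity and associativity of the right action follow from the other laws. -/
class HilbertModule (A X : Type*) [NonUnitalCStarAlgebra A] [PartialOrder A]
    [NormedAddCommGroup X] [NormedSpace ℂ X] where
  inner : X → X → A
  rsmul : X → A → X
  inner_add_right : ∀ x y z, inner x (y + z) = inner x y + inner x z
  inner_smul_right : ∀ x (c : ℂ) y, inner x (c • y) = c • inner x y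
  inner_rsmul_right : ∀ x y a, inner x (rsmul y a) = inner x y * a
  star_inner : ∀ x y, star (inner x y) = inner y x
  inner_self_nonneg : ∀ x, 0 ≤ inner x x
  norm_eq : ∀ x, ‖x‖ = √‖inner x x‖

theorem exists_negPart {M : Type*} [NonUnitalCStarAlgebra M] [PartialOrder M] [StarOrderedRing M]
    (g : M) (hg : IsSelfAdjoint g) :
    ∃ n : M, star n = n ∧ (∃ c, n * n * n = star c * c) ∧ n * g * n = -(n * n * n) ∧
      (n = 0 → ∃ d, g = star d * d) := by
  have hs : star (g⁻) = g⁻ := (CFC.negPart_nonneg g).isSelfAdjoint.star_eq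
  refine ⟨g⁻, hs, ?_, ?_, ?_⟩
  · rw [← CStarAlgebra.nonneg_iff_eq_star_mul_self]
    have h := star_left_conjugate_nonneg (CFC.negPart_nonneg g) (g⁻)
    rwa [hs] at h
  · have h : g⁻ * (g⁺ - g⁻) * g⁻ = -(g⁻ * g⁻ * g⁻) := by
      rw [mul_sub, sub_mul]
      simp
    rwa [CFC.posPart_sub_negPart g hg] at h
  · intro hN
    rw [← CStarAlgebra.nonneg_iff_eq_star_mul_self]
    rw [← CFC.posPart_sub_negPart g hg, hN, sub_zero]
    exact CFC.posPart_nonneg g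

namespace HilbertModule

section basic

variable {A X : Type*} [NonUnitalCStarAlgebra A] [PartialOrder A]
  [NormedAddCommGroup X] [NormedSpace ℂ X] [HilbertModule A X]

variable (A) in
/-- The inner product as a sesquilinear map. -/
def innerₛₗ : X →ₗ⋆[ℂ] X →ₗ[ℂ] A :=
  LinearMap.mk₂'ₛₗ (starRingEnd ℂ) (RingHom.id ℂ) (fun x y => inner (A := A) x y)
    (fun x y z => by rw [← star_inner, inner_add_right, star_add, star_inner, star_inner])
    (fun c x y => by rw [← star_inner, inner_smul_right, star_smul, star_inner]; rfl)
    (fun x y z => inner_add_right x y z)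
    (fun c x y => inner_smul_right x c y)

theorem innerₛₗ_apply (x y : X) : innerₛₗ A x y = inner (A := A) x y := rfl

theorem inner_rsmul_left (x y : X) (a : A) :
    inner (rsmul x a) y = star a * inner x y := by
  rw [← star_inner, inner_rsmul_right, star_mul, star_inner]

/-- The Gram matrix of finitely many vectors is a positive matrix, hence of the form `Dᴴ D`. -/
theorem exists_gram [StarOrderedRing A] {ι : Type*} [Fintype ι] [DecidableEq ι] (x : ι → X) :
    ∃ D : ι → ι → A, ∀ i j, inner (x i) (x j) = ∑ k, star (D k i) * D k j := by
  let G : CStarMatrix ι ι A := CStarMatrix.ofMatrix fun i j => inner (x i) (x j)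
  have hGa : ∀ i j, G i j = inner (x i) (x j) := fun _ _ => rfl
  have hG : IsSelfAdjoint G := by
    ext i j
    rw [CStarMatrix.star_apply, hGa, hGa, star_inner]
  obtain ⟨N, hsa, ⟨C, hC⟩, key, hN0⟩ := exists_negPart G hG
  have hC0 : C = 0 := by
    have hdiag : ∀ k, ∑ j, star (C j k) * C j k = 0 := by
      intro k
      have h1 : (N * N * N) k k = ∑ j, star (C j k) * C j k := by
        rw [hC]; simp [CStarMatrix.mul_apply, CStarMatrix.star_apply]
      have h2 : (N * G * N) k k
          = innerₛₗ A (∑ i, rsmul (x i) (N i k)) (∑ j, rsmul (x j) (N j k)) := by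
        have hs : ∀ i, N k i = star (N i k) := by
          intro i
          conv_lhs => rw [← hsa]
          simp [CStarMatrix.star_apply]
        simp only [map_sum, LinearMap.sum_apply, innerₛₗ_apply, inner_rsmul_left,
          inner_rsmul_right, CStarMatrix.mul_apply, Finset.sum_mul, hs]
        refine Finset.sum_congr rfl fun i _ => Finset.sum_congr rfl fun j _ => ?_
        simp [hGa, mul_assoc]
      have h3 : 0 ≤ (N * G * N) k k := by rw [h2]; exact inner_self_nonneg _
      rw [key] at h3
      have h4 : (-(N * N * N)) k k = - ((N * N * N) k k) := rfl
      rw [h4, h1] at h3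
      exact le_antisymm (neg_nonneg.mp h3) (Finset.sum_nonneg fun j _ => star_mul_self_nonneg _)
    ext j k
    have h := (Finset.sum_eq_zero_iff_of_nonneg
      (fun j _ => star_mul_self_nonneg (C j k))).mp (hdiag k) j (Finset.mem_univ j)
    simpa using h
  have hN : N = 0 := by
    have h0 : N * N * N = 0 := by rw [hC, hC0]; simp
    have h1 : (N * N) = 0 := by
      have : star (N * N) * (N * N) = 0 := by
        rw [star_mul, hsa, ← mul_assoc, h0, zero_mul]
      exact (CStarRing.star_mul_self_eq_zero_iff _).mp this
    have h2 : star N * N = 0 := by rw [hsa, h1]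
    exact (CStarRing.star_mul_self_eq_zero_iff _).mp h2
  obtain ⟨D, hD⟩ := hN0 hN
  refine ⟨fun k i => D k i, fun i j => ?_⟩
  have : G i j = (star D * D) i j := by rw [← hD]
  simpa [hGa, CStarMatrix.mul_apply, CStarMatrix.star_apply] using this

end basic

end HilbertModule

/-- Let `p k` be the norms of `Pᵏ x` for a positive operator `P`: if they satisfy the Cauchy–Schwarz
inequalities and grow at most like `rᵏ`, then `‖P x‖ ≤ r ‖x‖`. -/
theorem le_of_growth (p : ℕ → ℝ) (hp : ∀ k, 0 ≤ p k) (r C : ℝ) (hr : 0 ≤ r)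
    (h2 : ∀ k, p k ^ 2 ≤ p 0 * p (2 * k)) (hC : ∀ k, p k ≤ C * r ^ k) : p 1 ≤ r * p 0 := by
  by_contra hlt
  push Not at hlt
  have hp0 : 0 < p 0 := by
    rcases (hp 0).lt_or_eq with h | h
    · exact h
    · have := h2 1
      rw [← h, zero_mul] at this
      have h1 : p 1 = 0 := by nlinarith [hp 1]
      rw [h1, ← h] at hlt; simp at hlt
  have hr' : 0 < r := by
    rcases hr.lt_or_eq with h | h
    · exact h
    · have := hC 1
      rw [← h] at this hlt
      simp at this hlt
      linarith
  set q := p 1 / (r * p 0) with hq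
  have hq1 : 1 < q := by rw [hq, one_lt_div (by positivity)]; exact hlt
  have key : ∀ m : ℕ, p 0 * (q * r) ^ (2 ^ m) ≤ p (2 ^ m) := by
    intro m
    induction m with
    | zero => simp only [pow_zero, pow_one]; rw [hq]; apply le_of_eq; field_simp
    | succ m ih =>
      have h := h2 (2 ^ m)
      have h3 : (p 0 * (q * r) ^ (2 ^ m)) ^ 2 ≤ p (2 ^ m) ^ 2 := by gcongr
      have h4 : p 0 * (p 0 * (q * r) ^ (2 ^ (m + 1))) ≤ p 0 * p (2 ^ (m + 1)) := by
        calc _ = (p 0 * (q * r) ^ (2 ^ m)) ^ 2 := by rw [pow_succ 2 m, pow_mul]; ring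
          _ ≤ _ := h3.trans (by rw [pow_succ 2 m, mul_comm (2 ^ m) 2]; exact h)
      exact le_of_mul_le_mul_left h4 hp0
  have hb : ∀ m : ℕ, q ^ (2 ^ m) ≤ C / p 0 := by
    intro m
    have h := (key m).trans (hC _)
    rw [mul_pow, ← mul_assoc] at h
    rw [le_div_iff₀ hp0, mul_comm]
    exact le_of_mul_le_mul_right h (by positivity)
  obtain ⟨n, hn⟩ := pow_unbounded_of_one_lt (C / p 0) hq1
  have : q ^ n ≤ q ^ (2 ^ n) := pow_le_pow_right₀ hq1.le Nat.lt_two_pow_self.le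
  linarith [hb n]

section interior

variable {A B X H : Type*} [NonUnitalCStarAlgebra A] [NonUnitalCStarAlgebra B] [PartialOrder B]
  [NormedAddCommGroup X] [NormedSpace ℂ X] [HilbertModule B X]
  [NormedAddCommGroup H] [InnerProductSpace ℂ H] [CompleteSpace H]

/-- The sesquilinear form `⟨x ⊗ h, x' ⊗ h'⟩ = ⟨h, φ(⟨x, x'⟩) h'⟩` on the algebraic tensor
product `X ⊙ H`. -/
def interiorForm (X : Type*) [NormedAddCommGroup X] [NormedSpace ℂ X] [HilbertModule B X]
    (φ : B →⋆ₙₐ[ℂ] (H →L[ℂ] H)) : (X ⊗[ℂ] H) →ₗ⋆[ℂ] (X ⊗[ℂ] H) →ₗ[ℂ] ℂ :=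
  TensorProduct.lift <| LinearMap.mk₂'ₛₗ (starRingEnd ℂ) (starRingEnd ℂ)
    (fun x h => TensorProduct.lift <| LinearMap.mk₂ ℂ
      (fun x' h' => ⟪h, φ (HilbertModule.innerₛₗ B x x') h'⟫_ℂ)
      (fun _ _ _ => by simp) (fun _ _ _ => by simp)
      (fun _ _ _ => by simp) (fun _ _ _ => by simp))
    (fun _ _ _ => by ext; simp)
    (fun _ _ _ => by ext; simp)
    (fun _ _ _ => by ext; simp)
    (fun _ _ _ => by ext; simp [mul_comm])

theorem interiorForm_tmul (φ : B →⋆ₙₐ[ℂ] (H →L[ℂ] H)) (x x' : X) (h h' : H) :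
    interiorForm X φ (x ⊗ₜ h) (x' ⊗ₜ h') = ⟪h, φ (HilbertModule.inner x x') h'⟫_ℂ := rfl

theorem star_interiorForm (φ : B →⋆ₙₐ[ℂ] (H →L[ℂ] H)) (z w : X ⊗[ℂ] H) :
    starRingEnd ℂ (interiorForm X φ z w) = interiorForm X φ w z := by
  induction z using TensorProduct.induction_on with
  | zero => simp
  | add z₁ z₂ h₁ h₂ => simp [h₁, h₂]
  | tmul x h =>
    induction w using TensorProduct.induction_on with
    | zero => simp
    | add z₁ z₂ h₁ h₂ => simp [h₁, h₂]
    | tmul x' h' =>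
      rw [interiorForm_tmul, interiorForm_tmul, inner_conj_symm, ← HilbertModule.star_inner x' x,
        map_star, ContinuousLinearMap.star_eq_adjoint, ContinuousLinearMap.adjoint_inner_left]

theorem exists_fin_sum {E F : Type*} [AddCommGroup E] [Module ℂ E] [AddCommGroup F] [Module ℂ F]
    (z : E ⊗[ℂ] F) : ∃ (n : ℕ) (x : Fin n → E) (h : Fin n → F), z = ∑ i, x i ⊗ₜ[ℂ] h i := by
  induction z using TensorProduct.induction_on with
  | zero => exact ⟨0, Fin.elim0, Fin.elim0, by simp⟩
  | tmul x h => exact ⟨1, fun _ => x, fun _ => h, by simp⟩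
  | add z w hz hw =>
    obtain ⟨n, x, h, rfl⟩ := hz
    obtain ⟨m, x', h', rfl⟩ := hw
    exact ⟨n + m, Fin.append x x', Fin.append h h', by simp [Fin.sum_univ_add]⟩

theorem interiorForm_self [StarOrderedRing B] (φ : B →⋆ₙₐ[ℂ] (H →L[ℂ] H)) (z : X ⊗[ℂ] H) :
    0 ≤ (interiorForm X φ z z).re := by
  obtain ⟨n, x, h, rfl⟩ := exists_fin_sum z
  obtain ⟨D, hD⟩ := HilbertModule.exists_gram (A := B) x
  have : interiorForm X φ (∑ i, x i ⊗ₜ[ℂ] h i) (∑ i, x i ⊗ₜ[ℂ] h i)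
      = ∑ k, ⟪∑ i, φ (D k i) (h i), ∑ i, φ (D k i) (h i)⟫_ℂ := by
    simp only [map_sum, LinearMap.sum_apply, interiorForm_tmul, hD, sum_inner, inner_sum,
      map_mul, map_star, _root_.sum_apply, mul_apply_eq_comp,
      ContinuousLinearMap.star_eq_adjoint, ContinuousLinearMap.adjoint_inner_right]
    rw [Finset.sum_comm]
    conv_rhs => rw [Finset.sum_comm]
    rw [Finset.sum_comm]
    refine Finset.sum_congr rfl fun i _ => ?_
    rw [Finset.sum_comm]
  rw [this, Complex.re_sum]
  exact Finset.sum_nonneg fun k _ => inner_self_nonneg (𝕜 := ℂ)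

/-- The algebraic tensor product `X ⊙ H` with the semi-inner product given by `φ`. -/
def PreInteriorTensor (X : Type*) [NormedAddCommGroup X] [NormedSpace ℂ X] [HilbertModule B X]
    (_φ : B →⋆ₙₐ[ℂ] (H →L[ℂ] H)) : Type _ := X ⊗[ℂ] H

variable (φ : B →⋆ₙₐ[ℂ] (H →L[ℂ] H))

instance : AddCommGroup (PreInteriorTensor X φ) := inferInstanceAs (AddCommGroup (X ⊗[ℂ] H))
instance : Module ℂ (PreInteriorTensor X φ) := inferInstanceAs (Module ℂ (X ⊗[ℂ] H))

/-- `S` is an adjoint of `T` with respect to the `B`-valued inner product of `X`. -/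
def IsAdjointPair (B : Type*) {X : Type*} [NonUnitalCStarAlgebra B] [PartialOrder B]
    [NormedAddCommGroup X] [NormedSpace ℂ X] [HilbertModule B X] (T S : X →L[ℂ] X) : Prop :=
  ∀ x y, HilbertModule.inner (A := B) (T x) y = HilbertModule.inner (A := B) x (S y)

theorem IsAdjointPair.symm {T S : X →L[ℂ] X} (h : IsAdjointPair B T S) : IsAdjointPair B S T := by
  intro x y
  rw [← HilbertModule.star_inner, ← h, HilbertModule.star_inner]

theorem interiorForm_map {T S : X →L[ℂ] X} (hTS : IsAdjointPair B T S) (y : H →L[ℂ] H)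
    (hy : ∀ b, Commute (φ b) y) (z w : X ⊗[ℂ] H) :
    interiorForm X φ (TensorProduct.map T.toLinearMap y.toLinearMap z) w
      = interiorForm X φ z (TensorProduct.map S.toLinearMap (star y).toLinearMap w) := by
  have hy' : ∀ b, φ b * star y = star y * φ b := by
    intro b
    have h := (hy (star b)).star_star
    rw [map_star, star_star] at h
    exact h
  induction z using TensorProduct.induction_on with
  | zero => simp
  | add z₁ z₂ h₁ h₂ => simp [h₁, h₂]
  | tmul x h =>
    induction w using TensorProduct.induction_on with
    | zero => simp
    | add z₁ z₂ h₁ h₂ => rw [map_add, map_add, map_add, h₁, h₂]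
    | tmul x' h' =>
      have h1 := congrArg (fun f : H →L[ℂ] H => f h') (hy' (HilbertModule.inner x (S x')))
      simp only [mul_apply_eq_comp] at h1
      rw [TensorProduct.map_tmul, TensorProduct.map_tmul]
      simp only [ContinuousLinearMap.coe_coe, interiorForm_tmul]
      rw [hTS, h1, ContinuousLinearMap.star_eq_adjoint, ContinuousLinearMap.adjoint_inner_right]

/-- The identification of `X ⊙ H` with its copy that carries the semi-inner product. -/
def PreInteriorTensor.mk : (X ⊗[ℂ] H) ≃ₗ[ℂ] PreInteriorTensor X φ := LinearEquiv.refl ℂ _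

variable [StarOrderedRing B]

/-- The semi-inner product on `X ⊙ H`. -/
abbrev PreInteriorTensor.core : PreInnerProductSpace.Core ℂ (PreInteriorTensor X φ) where
  inner z w := interiorForm X φ ((mk φ).symm z) ((mk φ).symm w)
  conj_inner_symm z w := star_interiorForm φ _ _
  re_inner_nonneg z := interiorForm_self φ _
  add_left z w v := by simp
  smul_left z w c := by simp

instance : SeminormedAddCommGroup (PreInteriorTensor X φ) :=
  InnerProductSpace.Core.toSeminormedAddCommGroup (c := PreInteriorTensor.core φ)
instance : InnerProductSpace ℂ (PreInteriorTensor X φ) :=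
  InnerProductSpace.ofCore (PreInteriorTensor.core φ)

variable (X) in
/-- The interior tensor product `X ⊗_φ H` of a Hilbert `B`-module `X` and a `*`-representation
`φ : B → 𝓑(H)`: the Hilbert space obtained by separation and completion of `X ⊙ H`. -/
abbrev InteriorTensor : Type _ := UniformSpace.Completion (PreInteriorTensor X φ)

/-- The elementary tensor `x ⊗ h`. -/
def InteriorTensor.tmul (x : X) (h : H) : InteriorTensor X φ :=
  (PreInteriorTensor.mk φ (x ⊗ₜ[ℂ] h) : PreInteriorTensor X φ)

theorem PreInteriorTensor.inner_def (z w : X ⊗[ℂ] H) :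
    inner ℂ (mk φ z) (mk φ w) = interiorForm X φ z w := rfl

theorem PreInteriorTensor.norm_tmul_le (x : X) (h : H) :
    ‖mk φ (x ⊗ₜ[ℂ] h)‖ ≤ ‖x‖ * ‖h‖ := by
  have h1 : ‖mk φ (x ⊗ₜ[ℂ] h)‖ ^ 2
      = ‖⟪h, φ (HilbertModule.inner x x) h⟫_ℂ‖ := by
    rw [← interiorForm_tmul, ← PreInteriorTensor.inner_def, inner_self_eq_norm_sq_to_K]
    simp
  have h2 : ‖⟪h, φ (HilbertModule.inner x x) h⟫_ℂ‖ ≤ (‖x‖ * ‖h‖) ^ 2 := by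
    have hx : ‖HilbertModule.inner (A := B) x x‖ = ‖x‖ ^ 2 := by
      rw [HilbertModule.norm_eq (A := B) x, Real.sq_sqrt (norm_nonneg _)]
    calc _ ≤ ‖h‖ * ‖φ (HilbertModule.inner x x) h‖ := norm_inner_le_norm _ _
      _ ≤ ‖h‖ * (‖HilbertModule.inner (A := B) x x‖ * ‖h‖) := by
        gcongr
        exact (ContinuousLinearMap.le_opNorm _ _).trans
          (by gcongr; exact NonUnitalStarAlgHom.norm_apply_le φ _)
      _ = _ := by rw [hx]; ring
  rw [← h1] at h2
  exact (sq_le_sq₀ (norm_nonneg _) (by positivity)).mp h2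

/-- The operator `T ⊗ y` on `X ⊙ H`. -/
def preTensorOp (T : X →L[ℂ] X) (y : H →L[ℂ] H) :
    PreInteriorTensor X φ →ₗ[ℂ] PreInteriorTensor X φ :=
  (PreInteriorTensor.mk φ).toLinearMap ∘ₗ TensorProduct.map T.toLinearMap y.toLinearMap ∘ₗ
    (PreInteriorTensor.mk φ).symm.toLinearMap

theorem preTensorOp_mk (T : X →L[ℂ] X) (y : H →L[ℂ] H) (x : X) (h : H) :
    preTensorOp φ T y (PreInteriorTensor.mk φ (x ⊗ₜ h))
      = PreInteriorTensor.mk φ (T x ⊗ₜ y h) := rfl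

theorem preTensorOp_inner {T S : X →L[ℂ] X} (hTS : IsAdjointPair B T S) (y : H →L[ℂ] H)
    (hy : ∀ b, Commute (φ b) y) (z w : PreInteriorTensor X φ) :
    inner ℂ (preTensorOp φ T y z) w = inner ℂ z (preTensorOp φ S (star y) w) :=
  interiorForm_map φ hTS y hy _ _

theorem commute_star {φ : B →⋆ₙₐ[ℂ] (H →L[ℂ] H)} {y : H →L[ℂ] H} (hy : ∀ b, Commute (φ b) y)
    (b : B) : Commute (φ b) (star y) := by
  have h := (hy (star b)).star_star
  rwa [map_star, star_star] at h

theorem preTensorOp_bound {T S : X →L[ℂ] X} (hTS : IsAdjointPair B T S) (y : H →L[ℂ] H)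
    (hy : ∀ b, Commute (φ b) y) (z : PreInteriorTensor X φ) :
    ‖preTensorOp φ T y z‖ ≤ √((‖S‖ * ‖T‖) * (‖y‖ * ‖y‖)) * ‖z‖ := by
  let M := preTensorOp φ T y
  let M' := preTensorOp φ S (star y)
  let P : PreInteriorTensor X φ →ₗ[ℂ] PreInteriorTensor X φ := M' ∘ₗ M
  let Pk : ℕ → PreInteriorTensor X φ → PreInteriorTensor X φ := fun k z => (P ^ k) z
  have hM : ∀ u v, inner ℂ (M u) v = inner ℂ u (M' v) := preTensorOp_inner φ hTS y hy
  have hM' : ∀ u v, inner ℂ (M' u) v = inner ℂ u (M v) := by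
    intro u v
    have := preTensorOp_inner φ hTS.symm (star y) (commute_star hy) u v
    rwa [star_star] at this
  have hP : ∀ u v : PreInteriorTensor X φ, inner ℂ (P u) v = inner ℂ u (P v) := by
    intro u v
    change inner ℂ (M' (M u)) v = inner ℂ u (M' (M v))
    rw [hM', hM]
  have hadd : ∀ j k u, Pk (j + k) u = Pk j (Pk k u) := by
    intro j k u
    change (P ^ (j + k)) u = (P ^ j) ((P ^ k) u)
    rw [pow_add]; rfl
  have hPk1 : ∀ u, Pk 1 u = P u := fun u => by simp [Pk]
  have hPk : ∀ k, ∀ u v : PreInteriorTensor X φ, inner ℂ (Pk k u) v = inner ℂ u (Pk k v) := by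
    intro k
    induction k with
    | zero => intro u v; rfl
    | succ k ih =>
      intro u v
      rw [hadd k 1, ih, hPk1, hP, ← hPk1, ← hadd, add_comm 1 k]
  have hcs : ∀ k, ‖Pk k z‖ ^ 2 ≤ ‖Pk 0 z‖ * ‖Pk (2 * k) z‖ := by
    intro k
    have h1 : ‖Pk k z‖ ^ 2 = ‖inner ℂ z (Pk (2 * k) z)‖ := by
      rw [two_mul, hadd, ← hPk, inner_self_eq_norm_sq_to_K]; simp
    rw [h1]
    exact norm_inner_le_norm _ _
  obtain ⟨n, x, h, hz⟩ := exists_fin_sum ((PreInteriorTensor.mk φ).symm z)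
  rw [LinearEquiv.symm_apply_eq, map_sum] at hz
  have hgrow : ∀ k, ‖Pk k z‖ ≤ (∑ i, ‖x i‖ * ‖h i‖) * ((‖S‖ * ‖T‖) * (‖y‖ * ‖y‖)) ^ k := by
    intro k
    have hk : ∀ (k : ℕ) (x : X) (h : H), (P ^ k) (PreInteriorTensor.mk φ (x ⊗ₜ h))
        = PreInteriorTensor.mk φ ((((S * T) ^ k) x) ⊗ₜ (((star y * y) ^ k) h)) := by
      intro k
      induction k with
      | zero => intro x h; simp
      | succ k ih =>
        intro x h
        have h1 : P (PreInteriorTensor.mk φ (x ⊗ₜ h))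
          = PreInteriorTensor.mk φ ((S (T x)) ⊗ₜ (star y (y h))) := rfl
        rw [pow_succ, Module.End.mul_apply, h1, ih, pow_succ, pow_succ]
        rfl
    have h1 : Pk k z = ∑ i, PreInteriorTensor.mk φ
        ((((S * T) ^ k) (x i)) ⊗ₜ (((star y * y) ^ k) (h i))) := by
      change (P ^ k) z = _
      rw [hz, map_sum]
      exact Finset.sum_congr rfl fun i _ => hk k _ _
    rw [h1, Finset.sum_mul]
    refine (norm_sum_le _ _).trans (Finset.sum_le_sum fun i _ => ?_)
    refine (PreInteriorTensor.norm_tmul_le φ _ _).trans ?_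
    have hST : ‖((S * T) ^ k) (x i)‖ ≤ (‖S‖ * ‖T‖) ^ k * ‖x i‖ := by
      clear * -
      induction k with
      | zero => simp
      | succ k ih =>
        rw [pow_succ' (S * T), mul_apply_eq_comp, pow_succ', mul_assoc]
        refine (ContinuousLinearMap.le_opNorm _ _).trans ?_
        gcongr
        exact norm_mul_le _ _
    have hyy : ‖((star y * y) ^ k) (h i)‖ ≤ (‖y‖ * ‖y‖) ^ k * ‖h i‖ := by
      clear * -
      induction k with
      | zero => simp
      | succ k ih =>
        rw [pow_succ' (star y * y), mul_apply_eq_comp, pow_succ', mul_assoc]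
        refine (ContinuousLinearMap.le_opNorm _ _).trans ?_
        gcongr
        exact (norm_mul_le _ _).trans (by rw [norm_star])
    calc _ ≤ ((‖S‖ * ‖T‖) ^ k * ‖x i‖) * ((‖y‖ * ‖y‖) ^ k * ‖h i‖) := by gcongr
      _ = _ := by rw [mul_pow (‖S‖ * ‖T‖)]; ring
  have hfin := le_of_growth (fun k => ‖Pk k z‖) (fun k => norm_nonneg _) _ _ (by positivity)
    hcs hgrow
  have hlast : ‖M z‖ ^ 2 ≤ ((‖S‖ * ‖T‖) * (‖y‖ * ‖y‖)) * ‖z‖ ^ 2 := by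
    have h1 : ‖M z‖ ^ 2 = ‖inner ℂ z (Pk 1 z)‖ := by
      rw [hPk1]
      change _ = ‖inner ℂ z (M' (M z))‖
      rw [← hM, inner_self_eq_norm_sq_to_K]; simp
    rw [h1]
    refine (norm_inner_le_norm _ _).trans ?_
    have : ‖Pk 1 z‖ ≤ ((‖S‖ * ‖T‖) * (‖y‖ * ‖y‖)) * ‖z‖ := hfin
    nlinarith [norm_nonneg z]
  have := Real.sqrt_le_sqrt hlast
  rwa [Real.sqrt_sq (norm_nonneg _), Real.sqrt_mul (by positivity), Real.sqrt_sq (norm_nonneg _)]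
    at this

/-- The operator `T ⊗ y` on `X ⊗_φ H`, for an adjointable operator `T` on `X` and an operator `y`
in the commutant of `φ(B)`. -/
def tensorOp {T S : X →L[ℂ] X} (hTS : IsAdjointPair B T S) (y : H →L[ℂ] H)
    (hy : ∀ b, Commute (φ b) y) : InteriorTensor X φ →L[ℂ] InteriorTensor X φ :=
  ((preTensorOp φ T y).mkContinuous _ (preTensorOp_bound φ hTS y hy)).completion

theorem tensorOp_coe {T S : X →L[ℂ] X} (hTS : IsAdjointPair B T S) (y : H →L[ℂ] H)
    (hy : ∀ b, Commute (φ b) y) (z : PreInteriorTensor X φ) :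
    tensorOp φ hTS y hy (z : InteriorTensor X φ)
      = (preTensorOp φ T y z : PreInteriorTensor X φ) := by
  rw [tensorOp, ContinuousLinearMap.completion_apply_coe]
  rfl

theorem tensorOp_tmul {T S : X →L[ℂ] X} (hTS : IsAdjointPair B T S) (y : H →L[ℂ] H)
    (hy : ∀ b, Commute (φ b) y) (x : X) (h : H) :
    tensorOp φ hTS y hy (InteriorTensor.tmul φ x h) = InteriorTensor.tmul φ (T x) (y h) := by
  rw [InteriorTensor.tmul, tensorOp_coe, preTensorOp_mk]
  rfl

theorem InteriorTensor.ext_clm {F : Type*} [NormedAddCommGroup F] [NormedSpace ℂ F]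
    {f g : InteriorTensor X φ →L[ℂ] F}
    (hfg : ∀ x h, f (InteriorTensor.tmul φ x h) = g (InteriorTensor.tmul φ x h)) : f = g := by
  ext z
  induction z using UniformSpace.Completion.induction_on with
  | hp => exact isClosed_eq f.continuous g.continuous
  | ih z =>
    obtain ⟨n, x, h, hz⟩ := exists_fin_sum ((PreInteriorTensor.mk φ).symm z)
    rw [LinearEquiv.symm_apply_eq, map_sum] at hz
    have hz' : (z : InteriorTensor X φ) = ∑ i, InteriorTensor.tmul φ (x i) (h i) := by
      have h1 : (z : InteriorTensor X φ) = UniformSpace.Completion.toComplL (𝕜 := ℂ) z := rfl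
      rw [h1, hz, map_sum]; rfl
    rw [hz', map_sum, map_sum]
    exact Finset.sum_congr rfl fun i _ => hfg _ _

theorem InteriorTensor.inner_tmul (x x' : X) (h h' : H) :
    ⟪InteriorTensor.tmul φ x h, InteriorTensor.tmul φ x' h'⟫_ℂ
      = ⟪h, φ (HilbertModule.inner x x') h'⟫_ℂ := by
  rw [InteriorTensor.tmul, InteriorTensor.tmul, UniformSpace.Completion.inner_coe,
    PreInteriorTensor.inner_def, interiorForm_tmul]

theorem InteriorTensor.tmul_add (x : X) (h h' : H) : InteriorTensor.tmul φ x (h + h')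
    = InteriorTensor.tmul φ x h + InteriorTensor.tmul φ x h' := by
  simp only [InteriorTensor.tmul, TensorProduct.tmul_add, map_add, UniformSpace.Completion.coe_add]

theorem InteriorTensor.add_tmul (x x' : X) (h : H) : InteriorTensor.tmul φ (x + x') h
    = InteriorTensor.tmul φ x h + InteriorTensor.tmul φ x' h := by
  simp only [InteriorTensor.tmul, TensorProduct.add_tmul, map_add, UniformSpace.Completion.coe_add]

theorem InteriorTensor.tmul_smul (c : ℂ) (x : X) (h : H) : InteriorTensor.tmul φ x (c • h)
    = c • InteriorTensor.tmul φ x h := by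
  simp only [InteriorTensor.tmul, TensorProduct.tmul_smul, map_smul,
    UniformSpace.Completion.coe_smul]

theorem InteriorTensor.smul_tmul (c : ℂ) (x : X) (h : H) : InteriorTensor.tmul φ (c • x) h
    = c • InteriorTensor.tmul φ x h := by
  simp only [InteriorTensor.tmul, ← TensorProduct.smul_tmul', map_smul,
    UniformSpace.Completion.coe_smul]

theorem tensorOp_star {T S : X →L[ℂ] X} (hTS : IsAdjointPair B T S) (y : H →L[ℂ] H)
    (hy : ∀ b, Commute (φ b) y) :
    tensorOp φ hTS.symm (star y) (commute_star hy) = star (tensorOp φ hTS y hy) := by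
  refine (ContinuousLinearMap.eq_adjoint_iff _ _).mpr fun z w => ?_
  induction z, w using UniformSpace.Completion.induction_on₂ with
  | hp => apply isClosed_eq <;> fun_prop
  | ih z w =>
    rw [tensorOp_coe, tensorOp_coe, UniformSpace.Completion.inner_coe,
      UniformSpace.Completion.inner_coe, preTensorOp_inner φ hTS.symm (star y) (commute_star hy),
      star_star]

end interior

section maxTensor

variable {A B : Type u} [NonUnitalCStarAlgebra A] [NonUnitalCStarAlgebra B]

/-- The linear map `σ_A × σ_B : A ⊙ B → 𝓑(H)`, `a ⊗ b ↦ σ_A(a) σ_B(b)`. -/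
def pairMap {A B H : Type*} [NonUnitalCStarAlgebra A] [NonUnitalCStarAlgebra B]
    [NormedAddCommGroup H] [InnerProductSpace ℂ H] [CompleteSpace H]
    (σA : A →⋆ₙₐ[ℂ] (H →L[ℂ] H)) (σB : B →⋆ₙₐ[ℂ] (H →L[ℂ] H)) :
    (A ⊗[ℂ] B) →ₗ[ℂ] (H →L[ℂ] H) :=
  TensorProduct.lift <| LinearMap.mk₂ ℂ (fun a b => σA a * σB b)
    (fun _ _ _ => by rw [map_add, add_mul]) (fun _ _ _ => by rw [map_smul, smul_mul_assoc])
    (fun _ _ _ => by rw [map_add, mul_add]) (fun _ _ _ => by rw [map_smul, mul_smul_comm])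

section pairMap

variable {H : Type*} [NormedAddCommGroup H] [InnerProductSpace ℂ H] [CompleteSpace H]
  (σA : A →⋆ₙₐ[ℂ] (H →L[ℂ] H)) (σB : B →⋆ₙₐ[ℂ] (H →L[ℂ] H))

theorem pairMap_tmul (a : A) (b : B) : pairMap σA σB (a ⊗ₜ b) = σA a * σB b := rfl

variable {σA σB}

theorem pairMap_mul (hc : ∀ a b, Commute (σA a) (σB b)) (s t : A ⊗[ℂ] B) :
    pairMap σA σB (s * t) = pairMap σA σB s * pairMap σA σB t := by
  induction s using TensorProduct.induction_on with
  | zero => simp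
  | add s₁ s₂ h₁ h₂ => rw [add_mul, map_add, h₁, h₂, map_add, add_mul]
  | tmul a b =>
    induction t using TensorProduct.induction_on with
    | zero => simp
    | add s₁ s₂ h₁ h₂ => rw [mul_add, map_add, h₁, h₂, map_add, mul_add]
    | tmul a' b' =>
      rw [Algebra.TensorProduct.tmul_mul_tmul, pairMap_tmul, pairMap_tmul, pairMap_tmul, map_mul,
        map_mul, mul_assoc, mul_assoc, ← mul_assoc (σA a'), (hc a' b).eq, mul_assoc]

theorem pairMap_star (hc : ∀ a b, Commute (σA a) (σB b)) (s : A ⊗[ℂ] B) :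
    pairMap σA σB (star s) = star (pairMap σA σB s) := by
  induction s using TensorProduct.induction_on with
  | zero => simp
  | add s₁ s₂ h₁ h₂ => rw [star_add, map_add, h₁, h₂, map_add, star_add]
  | tmul a b =>
    rw [TensorProduct.star_tmul, pairMap_tmul, pairMap_tmul, star_mul, map_star, map_star,
      ← map_star σA, ← map_star σB, (hc _ _).eq]

end pairMap

/-- The values `‖(σ_A × σ_B)(t)‖` over all pairs of `*`-representations of `A` and `B` on the same
Hilbert space with commuting ranges. -/
def maxNormSet (t : A ⊗[ℂ] B) : Set ℝ :=
  {r | ∃ (H : Type u) (_ : NormedAddCommGroup H) (_ : InnerProductSpace ℂ H) (_ : CompleteSpace H)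
    (σA : A →⋆ₙₐ[ℂ] (H →L[ℂ] H)) (σB : B →⋆ₙₐ[ℂ] (H →L[ℂ] H)),
    (∀ a b, Commute (σA a) (σB b)) ∧ r = ‖pairMap σA σB t‖}

/-- The maximal C*-norm on `A ⊙ B`. -/
def maxNorm (t : A ⊗[ℂ] B) : ℝ := sSup (maxNormSet t)

theorem maxNormSet_bddAbove (t : A ⊗[ℂ] B) : BddAbove (maxNormSet t) := by
  obtain ⟨n, a, b, rfl⟩ := exists_fin_sum t
  refine ⟨∑ i, ‖a i‖ * ‖b i‖, ?_⟩
  rintro r ⟨H, _, _, _, σA, σB, hc, rfl⟩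
  rw [map_sum]
  refine (norm_sum_le _ _).trans (Finset.sum_le_sum fun i _ => ?_)
  rw [pairMap_tmul]
  refine (norm_mul_le _ _).trans ?_
  gcongr
  · exact NonUnitalStarAlgHom.norm_apply_le σA _
  · exact NonUnitalStarAlgHom.norm_apply_le σB _

theorem maxNorm_nonneg (t : A ⊗[ℂ] B) : 0 ≤ maxNorm t := by
  refine Real.sSup_nonneg ?_
  rintro r ⟨H, _, _, _, σA, σB, hc, rfl⟩
  exact norm_nonneg _

theorem maxNorm_le {t : A ⊗[ℂ] B} {c : ℝ} (hc0 : 0 ≤ c)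
    (h : ∀ (H : Type u) [NormedAddCommGroup H] [InnerProductSpace ℂ H] [CompleteSpace H]
      (σA : A →⋆ₙₐ[ℂ] (H →L[ℂ] H)) (σB : B →⋆ₙₐ[ℂ] (H →L[ℂ] H)),
      (∀ a b, Commute (σA a) (σB b)) → ‖pairMap σA σB t‖ ≤ c) : maxNorm t ≤ c := by
  refine Real.sSup_le ?_ hc0
  rintro r ⟨H, _, _, _, σA, σB, hc, rfl⟩
  exact h H σA σB hc

theorem le_maxNorm {H : Type u} [NormedAddCommGroup H] [InnerProductSpace ℂ H] [CompleteSpace H]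
    {σA : A →⋆ₙₐ[ℂ] (H →L[ℂ] H)} {σB : B →⋆ₙₐ[ℂ] (H →L[ℂ] H)}
    (hc : ∀ a b, Commute (σA a) (σB b)) (t : A ⊗[ℂ] B) : ‖pairMap σA σB t‖ ≤ maxNorm t :=
  le_csSup (maxNormSet_bddAbove t) ⟨H, _, _, _, σA, σB, hc, rfl⟩

/-- The algebraic tensor product `A ⊙ B` equipped with the maximal C*-norm. -/
def PreMaxTensor (A B : Type u) [NonUnitalCStarAlgebra A] [NonUnitalCStarAlgebra B] : Type u :=
  A ⊗[ℂ] B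

namespace PreMaxTensor

instance : NonUnitalRing (PreMaxTensor A B) := inferInstanceAs (NonUnitalRing (A ⊗[ℂ] B))
instance : Module ℂ (PreMaxTensor A B) := inferInstanceAs (Module ℂ (A ⊗[ℂ] B))
instance : IsScalarTower ℂ (PreMaxTensor A B) (PreMaxTensor A B) :=
  inferInstanceAs (IsScalarTower ℂ (A ⊗[ℂ] B) (A ⊗[ℂ] B))
instance : SMulCommClass ℂ (PreMaxTensor A B) (PreMaxTensor A B) :=
  inferInstanceAs (SMulCommClass ℂ (A ⊗[ℂ] B) (A ⊗[ℂ] B))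
instance : StarAddMonoid (PreMaxTensor A B) := inferInstanceAs (StarAddMonoid (A ⊗[ℂ] B))
instance : StarModule ℂ (PreMaxTensor A B) := inferInstanceAs (StarModule ℂ (A ⊗[ℂ] B))

variable (A B) in
/-- The identification of `A ⊙ B` with its normed copy. -/
def mk : (A ⊗[ℂ] B) ≃ₗ[ℂ] PreMaxTensor A B := LinearEquiv.refl ℂ _

theorem mk_mul (s t : A ⊗[ℂ] B) : mk A B (s * t) = mk A B s * mk A B t := rfl
theorem mk_star (s : A ⊗[ℂ] B) : mk A B (star s) = star (mk A B s) := rfl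

instance : StarRing (PreMaxTensor A B) where
  star_mul := by
    have h : ∀ s t : A ⊗[ℂ] B, star (s * t) = star t * star s := by
      intro s t
      induction s using TensorProduct.induction_on with
      | zero => simp
      | add s₁ s₂ h₁ h₂ => rw [add_mul, star_add, h₁, h₂, star_add, mul_add]
      | tmul a b =>
        induction t using TensorProduct.induction_on with
        | zero => simp
        | add s₁ s₂ h₁ h₂ => rw [mul_add, star_add, h₁, h₂, star_add, add_mul]
        | tmul a' b' => simp
    exact h
  star_add := star_add

instance : Norm (PreMaxTensor A B) := ⟨fun t => maxNorm ((mk A B).symm t)⟩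

theorem norm_mk (t : A ⊗[ℂ] B) : ‖mk A B t‖ = maxNorm t := rfl

theorem core : SeminormedSpace.Core ℂ (PreMaxTensor A B) where
  norm_nonneg _ := maxNorm_nonneg _
  norm_smul c t := by
    obtain ⟨t, rfl⟩ := (mk A B).surjective t
    rw [← map_smul, norm_mk, norm_mk]
    have hle : ∀ (c : ℂ) (t : A ⊗[ℂ] B), maxNorm (c • t) ≤ ‖c‖ * maxNorm t := by
      intro c t
      refine maxNorm_le (mul_nonneg (norm_nonneg _) (maxNorm_nonneg _)) ?_
      intro H _ _ _ σA σB hc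
      rw [map_smul, norm_smul]
      gcongr
      exact le_maxNorm hc t
    refine le_antisymm (hle c t) ?_
    rcases eq_or_ne c 0 with rfl | hc
    · simpa using maxNorm_nonneg _
    · have h := hle c⁻¹ (c • t)
      rw [smul_smul, inv_mul_cancel₀ hc, one_smul, norm_inv] at h
      have hpos : 0 < ‖c‖ := norm_pos_iff.mpr hc
      calc ‖c‖ * maxNorm t ≤ ‖c‖ * (‖c‖⁻¹ * maxNorm (c • t)) := by gcongr
        _ = _ := by field_simp
  norm_triangle s t := by
    obtain ⟨s, rfl⟩ := (mk A B).surjective s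
    obtain ⟨t, rfl⟩ := (mk A B).surjective t
    rw [← map_add, norm_mk, norm_mk, norm_mk]
    refine maxNorm_le (add_nonneg (maxNorm_nonneg _) (maxNorm_nonneg _)) ?_
    intro H _ _ _ σA σB hc
    rw [map_add]
    exact (norm_add_le _ _).trans (add_le_add (le_maxNorm hc s) (le_maxNorm hc t))

instance : SeminormedAddCommGroup (PreMaxTensor A B) := SeminormedAddCommGroup.ofCore core
instance : NormedSpace ℂ (PreMaxTensor A B) where
  norm_smul_le c t := (core.norm_smul c t).le

instance : NonUnitalSeminormedRing (PreMaxTensor A B) where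
  dist_eq := SeminormedAddCommGroup.dist_eq
  norm_mul_le s t := by
    obtain ⟨s, rfl⟩ := (mk A B).surjective s
    obtain ⟨t, rfl⟩ := (mk A B).surjective t
    rw [← mk_mul, norm_mk, norm_mk, norm_mk]
    refine maxNorm_le (mul_nonneg (maxNorm_nonneg _) (maxNorm_nonneg _)) ?_
    intro H _ _ _ σA σB hc
    rw [pairMap_mul hc]
    refine (norm_mul_le _ _).trans ?_
    gcongr
    · exact maxNorm_nonneg _
    · exact le_maxNorm hc s
    · exact le_maxNorm hc t

theorem norm_star_eq (t : PreMaxTensor A B) : ‖star t‖ = ‖t‖ := by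
  have hle : ∀ t : A ⊗[ℂ] B, maxNorm (star t) ≤ maxNorm t := by
    intro t
    refine maxNorm_le (maxNorm_nonneg _) ?_
    intro H _ _ _ σA σB hc
    rw [pairMap_star hc, norm_star]
    exact le_maxNorm hc t
  obtain ⟨t, rfl⟩ := (mk A B).surjective t
  rw [← mk_star, norm_mk, norm_mk]
  refine le_antisymm (hle t) ?_
  have h := hle (star t)
  rwa [star_star] at h

theorem norm_mul_self_le (t : PreMaxTensor A B) : ‖t‖ * ‖t‖ ≤ ‖star t * t‖ := by
  obtain ⟨t, rfl⟩ := (mk A B).surjective t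
  rw [← mk_star, ← mk_mul, norm_mk, norm_mk]
  have h : maxNorm t ≤ √(maxNorm (star t * t)) := by
    refine maxNorm_le (Real.sqrt_nonneg _) ?_
    intro H _ _ _ σA σB hc
    refine Real.le_sqrt_of_sq_le ?_
    have h1 := le_maxNorm hc (star t * t)
    rwa [pairMap_mul hc, pairMap_star hc, CStarRing.norm_star_mul_self, ← sq] at h1
  calc maxNorm t * maxNorm t ≤ √(maxNorm (star t * t)) * √(maxNorm (star t * t)) :=
        mul_le_mul h h (maxNorm_nonneg _) (Real.sqrt_nonneg _)
    _ = _ := Real.mul_self_sqrt (maxNorm_nonneg _)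

end PreMaxTensor

/-- The maximal tensor product `A ⊗_max B`: the completion of `A ⊙ B` in the maximal C*-norm. -/
def MaxTensor (A B : Type u) [NonUnitalCStarAlgebra A] [NonUnitalCStarAlgebra B] : Type u :=
  UniformSpace.Completion (PreMaxTensor A B)

namespace MaxTensor

open UniformSpace UniformSpace.Completion

instance : NormedAddCommGroup (MaxTensor A B) :=
  inferInstanceAs (NormedAddCommGroup (Completion (PreMaxTensor A B)))
instance : NormedSpace ℂ (MaxTensor A B) :=
  inferInstanceAs (NormedSpace ℂ (Completion (PreMaxTensor A B)))
instance : CompleteSpace (MaxTensor A B) :=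
  inferInstanceAs (CompleteSpace (Completion (PreMaxTensor A B)))

variable (A B) in
/-- The canonical map `A ⊙ B → A ⊗_max B`. -/
def ofAlg : PreMaxTensor A B →ₗᵢ[ℂ] MaxTensor A B := Completion.toComplₗᵢ

/-- The elementary tensor `a ⊗ b ∈ A ⊗_max B`. -/
def tmul (a : A) (b : B) : MaxTensor A B := ofAlg A B (PreMaxTensor.mk A B (a ⊗ₜ b))

theorem isDenseInducing_ofAlg : IsDenseInducing (ofAlg A B) := Completion.isDenseInducing_coe

theorem denseRange_ofAlg : DenseRange (ofAlg A B) := isDenseInducing_ofAlg.dense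

theorem induction_on {p : MaxTensor A B → Prop} (z : MaxTensor A B) (hp : IsClosed {z | p z})
    (ih : ∀ t, p (ofAlg A B t)) : p z := denseRange_ofAlg.induction_on z hp ih

theorem induction_on₂ {p : MaxTensor A B → MaxTensor A B → Prop} (z w : MaxTensor A B)
    (hp : IsClosed {x : MaxTensor A B × MaxTensor A B | p x.1 x.2})
    (ih : ∀ s t, p (ofAlg A B s) (ofAlg A B t)) : p z w :=
  denseRange_ofAlg.induction_on₂ hp ih z w

theorem induction_on₃ {p : MaxTensor A B → MaxTensor A B → MaxTensor A B → Prop}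
    (z w v : MaxTensor A B)
    (hp : IsClosed {x : MaxTensor A B × MaxTensor A B × MaxTensor A B | p x.1 x.2.1 x.2.2})
    (ih : ∀ s t r, p (ofAlg A B s) (ofAlg A B t) (ofAlg A B r)) : p z w v :=
  denseRange_ofAlg.induction_on₃ hp ih z w v

instance : Mul (MaxTensor A B) :=
  ⟨Function.curry <| (isDenseInducing_ofAlg.prodMap isDenseInducing_ofAlg).extend
    (fun p => ofAlg A B (p.1 * p.2))⟩

theorem ofAlg_mul (s t : PreMaxTensor A B) : ofAlg A B (s * t) = ofAlg A B s * ofAlg A B t :=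
  ((isDenseInducing_ofAlg.prodMap isDenseInducing_ofAlg).extend_eq
    ((ofAlg A B).continuous.comp continuous_mul) (s, t)).symm

instance : ContinuousMul (MaxTensor A B) where
  continuous_mul := by
    let m := (AddMonoidHom.mul : PreMaxTensor A B →+ PreMaxTensor A B →+ PreMaxTensor A B).compr₂
      (ofAlg A B).toLinearMap.toAddMonoidHom
    have hm : Continuous fun p : PreMaxTensor A B × PreMaxTensor A B => m p.1 p.2 :=
      (ofAlg A B).continuous.comp continuous_mul
    have di : IsDenseInducing ((ofAlg A B).toLinearMap.toAddMonoidHom) := isDenseInducing_ofAlg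
    exact (di.extend_Z_bilin di hm :)

instance : Star (MaxTensor A B) :=
  ⟨isDenseInducing_ofAlg.extend (fun t => ofAlg A B (star t))⟩

theorem isometry_star_aux : Isometry (fun t : PreMaxTensor A B => ofAlg A B (star t)) := by
  refine (ofAlg A B).isometry.comp (Isometry.of_dist_eq fun s t => ?_)
  rw [dist_eq_norm, dist_eq_norm, ← star_sub, PreMaxTensor.norm_star_eq]

theorem ofAlg_star (t : PreMaxTensor A B) : ofAlg A B (star t) = star (ofAlg A B t) :=
  (isDenseInducing_ofAlg.extend_eq isometry_star_aux.continuous t).symm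

theorem continuous_star_max : Continuous (star : MaxTensor A B → MaxTensor A B) :=
  (uniformContinuous_uniformly_extend
    (Completion.isUniformInducing_coe (PreMaxTensor A B)) Completion.denseRange_coe
    isometry_star_aux.uniformContinuous).continuous

instance : ContinuousStar (MaxTensor A B) := ⟨continuous_star_max⟩

instance : NonUnitalRing (MaxTensor A B) where
  zero_mul z := by
    induction z using induction_on with
    | hp => apply isClosed_eq <;> fun_prop
    | ih t =>
      rw [← map_zero (ofAlg A B), ← ofAlg_mul, zero_mul]
  mul_zero z := by
    induction z using induction_on with
    | hp => apply isClosed_eq <;> fun_prop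
    | ih t =>
      rw [← map_zero (ofAlg A B), ← ofAlg_mul, mul_zero]
  left_distrib z w v := by
    induction z, w, v using induction_on₃ with
    | hp => apply isClosed_eq <;> fun_prop
    | ih s t r =>
      rw [← map_add, ← ofAlg_mul, ← ofAlg_mul, ← ofAlg_mul, ← map_add, mul_add]
  right_distrib z w v := by
    induction z, w, v using induction_on₃ with
    | hp => apply isClosed_eq <;> fun_prop
    | ih s t r =>
      rw [← map_add, ← ofAlg_mul, ← ofAlg_mul, ← ofAlg_mul, ← map_add, add_mul]
  mul_assoc z w v := by
    induction z, w, v using induction_on₃ with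
    | hp => apply isClosed_eq <;> fun_prop
    | ih s t r =>
      rw [← ofAlg_mul, ← ofAlg_mul, ← ofAlg_mul, ← ofAlg_mul, mul_assoc]

instance : StarRing (MaxTensor A B) where
  star_involutive z := by
    induction z using induction_on with
    | hp => apply isClosed_eq <;> fun_prop
    | ih t =>
      rw [← ofAlg_star, ← ofAlg_star, star_star]
  star_mul z w := by
    induction z, w using induction_on₂ with
    | hp => apply isClosed_eq <;> fun_prop
    | ih s t =>
      rw [← ofAlg_mul, ← ofAlg_star, ← ofAlg_star, ← ofAlg_star, ← ofAlg_mul, star_mul]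
  star_add z w := by
    induction z, w using induction_on₂ with
    | hp => apply isClosed_eq <;> fun_prop
    | ih s t =>
      rw [← map_add, ← ofAlg_star, ← ofAlg_star, ← ofAlg_star, ← map_add, star_add]

instance : NonUnitalNormedRing (MaxTensor A B) where
  dist_eq := NormedAddCommGroup.dist_eq
  norm_mul_le z w := by
    induction z, w using induction_on₂ with
    | hp => apply isClosed_le <;> fun_prop
    | ih s t =>
      rw [← ofAlg_mul, LinearIsometry.norm_map, LinearIsometry.norm_map, LinearIsometry.norm_map]
      exact norm_mul_le s t

instance : CStarRing (MaxTensor A B) where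
  norm_mul_self_le z := by
    induction z using induction_on with
    | hp => apply isClosed_le <;> fun_prop
    | ih t =>
      rw [← ofAlg_star, ← ofAlg_mul, LinearIsometry.norm_map, LinearIsometry.norm_map]
      exact PreMaxTensor.norm_mul_self_le t

instance : StarModule ℂ (MaxTensor A B) where
  star_smul c z := by
    induction z using induction_on with
    | hp =>
      exact isClosed_eq (continuous_star_max.comp (continuous_id.const_smul c))
        (continuous_star_max.const_smul (star c))
    | ih t =>
      rw [← map_smul, ← ofAlg_star, ← ofAlg_star, ← map_smul, star_smul]

theorem smul_mul_max (c : ℂ) (z w : MaxTensor A B) : (c • z) * w = c • (z * w) := by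
  induction z, w using induction_on₂ with
  | hp =>
    exact isClosed_eq ((continuous_fst.const_smul c).mul continuous_snd)
      ((continuous_fst.mul continuous_snd).const_smul c)
  | ih s t => rw [← map_smul, ← ofAlg_mul, ← ofAlg_mul, ← map_smul, smul_mul_assoc]

theorem mul_smul_max (c : ℂ) (z w : MaxTensor A B) : z * (c • w) = c • (z * w) := by
  induction z, w using induction_on₂ with
  | hp =>
    exact isClosed_eq (continuous_fst.mul (continuous_snd.const_smul c))
      ((continuous_fst.mul continuous_snd).const_smul c)
  | ih s t => rw [← map_smul, ← ofAlg_mul, ← ofAlg_mul, ← map_smul, mul_smul_comm]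

instance : IsScalarTower ℂ (MaxTensor A B) (MaxTensor A B) := ⟨smul_mul_max⟩
instance : SMulCommClass ℂ (MaxTensor A B) (MaxTensor A B) :=
  ⟨fun c z w => (mul_smul_max c z w).symm⟩

instance : NonUnitalCStarAlgebra (MaxTensor A B) where

section lift

variable {H : Type u} [NormedAddCommGroup H] [InnerProductSpace ℂ H] [CompleteSpace H]

/-- The `*`-representation `σ_A × σ_B` of `A ⊗_max B`, `a ⊗ b ↦ σ_A(a) σ_B(b)`, given by a pair of
`*`-representations with commuting ranges. -/
def lift (σA : A →⋆ₙₐ[ℂ] (H →L[ℂ] H)) (σB : B →⋆ₙₐ[ℂ] (H →L[ℂ] H))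
    (hc : ∀ a b, Commute (σA a) (σB b)) : MaxTensor A B →⋆ₙₐ[ℂ] (H →L[ℂ] H) :=
  let L : PreMaxTensor A B →L[ℂ] (H →L[ℂ] H) :=
    (pairMap σA σB ∘ₗ (PreMaxTensor.mk A B).symm.toLinearMap).mkContinuous 1
      (fun t => by rw [one_mul]; exact le_maxNorm hc _)
  let F : MaxTensor A B →L[ℂ] (H →L[ℂ] H) :=
    ContinuousLinearMap.fromCompletion (α := PreMaxTensor A B) L
  have hF : ∀ t, F (ofAlg A B t) = pairMap σA σB ((PreMaxTensor.mk A B).symm t) :=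
    fun t => ContinuousLinearMap.fromCompletion_apply_coe L t
  { toFun := F
    map_smul' := fun c z => map_smul F c z
    map_zero' := map_zero F
    map_add' := map_add F
    map_mul' := fun z w => by
      induction z, w using induction_on₂ with
      | hp => apply isClosed_eq <;> fun_prop
      | ih s t =>
        rw [← ofAlg_mul, hF, hF, hF, ← pairMap_mul hc]
        rfl
    map_star' := fun z => by
      induction z using induction_on with
      | hp => apply isClosed_eq <;> fun_prop
      | ih t =>
        rw [← ofAlg_star, hF, hF, ← pairMap_star hc]
        rfl }

theorem lift_tmul (σA : A →⋆ₙₐ[ℂ] (H →L[ℂ] H)) (σB : B →⋆ₙₐ[ℂ] (H →L[ℂ] H))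
    (hc : ∀ a b, Commute (σA a) (σB b)) (a : A) (b : B) :
    lift σA σB hc (tmul a b) = σA a * σB b :=
  ContinuousLinearMap.fromCompletion_apply_coe (α := PreMaxTensor A B) _ _

end lift

end MaxTensor

end maxTensor

/-- A left action of `A` on a Hilbert `B`-module `X`, i.e. a `*`-homomorphism from `A` into the
adjointable operators on `X`: `X` with such an action is an `A`-`B` C*-correspondence. -/
structure LeftAction (A B X : Type*) [NonUnitalCStarAlgebra A] [NonUnitalCStarAlgebra B]
    [PartialOrder B] [NormedAddCommGroup X] [NormedSpace ℂ X] [HilbertModule B X] where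
  toHom : A →ₙₐ[ℂ] (X →L[ℂ] X)
  adjoint : ∀ a, IsAdjointPair B (toHom a) (toHom (star a))

section reps

variable {A B C X H : Type*} [NonUnitalCStarAlgebra A] [NonUnitalCStarAlgebra B] [PartialOrder B]
  [StarOrderedRing B] [NonUnitalCStarAlgebra C]
  [NormedAddCommGroup X] [NormedSpace ℂ X] [HilbertModule B X]
  [NormedAddCommGroup H] [InnerProductSpace ℂ H] [CompleteSpace H]

theorem isAdjointPair_one : IsAdjointPair B (1 : X →L[ℂ] X) 1 := fun _ _ => rfl

/-- The `*`-representation `a ↦ π_X(a) ⊗ 1` of `A` on `X ⊗_φ H`. -/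
def leftRep (π : LeftAction A B X) (φ : B →⋆ₙₐ[ℂ] (H →L[ℂ] H)) :
    A →⋆ₙₐ[ℂ] (InteriorTensor X φ →L[ℂ] InteriorTensor X φ) where
  toFun a := tensorOp φ (π.adjoint a) 1 (fun _ => Commute.one_right _)
  map_smul' c a := InteriorTensor.ext_clm φ fun x h => by
    simp [tensorOp_tmul, InteriorTensor.smul_tmul]
  map_zero' := InteriorTensor.ext_clm φ fun x h => by
    rw [tensorOp_tmul]
    have h0 := InteriorTensor.smul_tmul φ 0 (0 : X) h
    simpa using h0
  map_add' a b := InteriorTensor.ext_clm φ fun x h => by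
    simp [tensorOp_tmul, InteriorTensor.add_tmul]
  map_mul' a b := InteriorTensor.ext_clm φ fun x h => by
    simp [tensorOp_tmul]
  map_star' a := by
    rw [← tensorOp_star]
    exact InteriorTensor.ext_clm φ fun x h => by simp [tensorOp_tmul]

/-- The `*`-representation `c ↦ 1 ⊗ ρ(c)` on `X ⊗_φ H`, for a `*`-representation `ρ` of `C` on `H`
whose range commutes with that of `φ`. -/
def rightRep (X : Type*) [NormedAddCommGroup X] [NormedSpace ℂ X] [HilbertModule B X]
    (φ : B →⋆ₙₐ[ℂ] (H →L[ℂ] H)) (ρ : C →⋆ₙₐ[ℂ] (H →L[ℂ] H))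
    (hc : ∀ b c, Commute (φ b) (ρ c)) :
    C →⋆ₙₐ[ℂ] (InteriorTensor X φ →L[ℂ] InteriorTensor X φ) where
  toFun c := tensorOp φ isAdjointPair_one (ρ c) (fun b => hc b c)
  map_smul' c a := InteriorTensor.ext_clm φ fun x h => by
    simp [tensorOp_tmul, InteriorTensor.tmul_smul]
  map_zero' := InteriorTensor.ext_clm φ fun x h => by
    rw [tensorOp_tmul]
    have h0 := InteriorTensor.tmul_smul φ 0 x (0 : H)
    simpa using h0
  map_add' a b := InteriorTensor.ext_clm φ fun x h => by
    simp [tensorOp_tmul, InteriorTensor.tmul_add]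
  map_mul' a b := InteriorTensor.ext_clm φ fun x h => by
    simp [tensorOp_tmul]
  map_star' a := by
    rw [← tensorOp_star]
    exact InteriorTensor.ext_clm φ fun x h => by rw [tensorOp_tmul, tensorOp_tmul, map_star]

theorem leftRep_tmul (π : LeftAction A B X) (φ : B →⋆ₙₐ[ℂ] (H →L[ℂ] H)) (a : A) (x : X) (h : H) :
    leftRep π φ a (InteriorTensor.tmul φ x h) = InteriorTensor.tmul φ (π.toHom a x) h :=
  tensorOp_tmul φ (π.adjoint a) 1 (fun _ => Commute.one_right _) x h

theorem rightRep_tmul (φ : B →⋆ₙₐ[ℂ] (H →L[ℂ] H)) (ρ : C →⋆ₙₐ[ℂ] (H →L[ℂ] H))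
    (hc : ∀ b c, Commute (φ b) (ρ c)) (c : C) (x : X) (h : H) :
    rightRep X φ ρ hc c (InteriorTensor.tmul φ x h) = InteriorTensor.tmul φ x (ρ c h) :=
  tensorOp_tmul φ isAdjointPair_one (ρ c) (fun b => hc b c) x h

theorem leftRep_commute_rightRep (π : LeftAction A B X) (φ : B →⋆ₙₐ[ℂ] (H →L[ℂ] H))
    (ρ : C →⋆ₙₐ[ℂ] (H →L[ℂ] H)) (hc : ∀ b c, Commute (φ b) (ρ c)) (a : A) (c : C) :
    Commute (leftRep π φ a) (rightRep X φ ρ hc c) :=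
  InteriorTensor.ext_clm φ fun x h => by
    simp [leftRep_tmul, rightRep_tmul]

end reps

/-- The `*`-representation `a ⊗ c ↦ π_X(a) ⊗ ρ(c)` of `A ⊗_max C` on `X ⊗_φ H`, for an `A`-`B`
C*-correspondence `X`, a `*`-representation `φ` of `B` on `H` and a `*`-representation `ρ` of `C` on
`H` with range in the commutant of `φ(B)`. -/
def corrRep {A B C X H : Type u} [NonUnitalCStarAlgebra A] [NonUnitalCStarAlgebra B]
    [PartialOrder B] [StarOrderedRing B] [NonUnitalCStarAlgebra C]
    [NormedAddCommGroup X] [NormedSpace ℂ X] [HilbertModule B X]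
    [NormedAddCommGroup H] [InnerProductSpace ℂ H] [CompleteSpace H]
    (π : LeftAction A B X) (φ : B →⋆ₙₐ[ℂ] (H →L[ℂ] H)) (ρ : C →⋆ₙₐ[ℂ] (H →L[ℂ] H))
    (hc : ∀ b c, Commute (φ b) (ρ c)) :
    MaxTensor A C →⋆ₙₐ[ℂ] (InteriorTensor X φ →L[ℂ] InteriorTensor X φ) :=
  MaxTensor.lift (leftRep π φ) (rightRep X φ ρ hc) (leftRep_commute_rightRep π φ ρ hc)

section commutant

variable {B H : Type u} [NonUnitalCStarAlgebra B]
  [NormedAddCommGroup H] [InnerProductSpace ℂ H] [CompleteSpace H]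

/-- The commutant `φ(B)'` of a `*`-representation. -/
def commutant (φ : B →⋆ₙₐ[ℂ] (H →L[ℂ] H)) : StarSubalgebra ℂ (H →L[ℂ] H) :=
  StarSubalgebra.centralizer ℂ (Set.range φ)

instance (φ : B →⋆ₙₐ[ℂ] (H →L[ℂ] H)) : IsClosed (commutant φ : Set (H →L[ℂ] H)) :=
  Set.isClosed_centralizer _

/-- The inclusion `φ(B)' ⊆ 𝓑(H)`. -/
def commutantIncl (φ : B →⋆ₙₐ[ℂ] (H →L[ℂ] H)) : commutant φ →⋆ₙₐ[ℂ] (H →L[ℂ] H) where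
  toFun y := y
  map_smul' _ _ := rfl
  map_zero' := rfl
  map_add' _ _ := rfl
  map_mul' _ _ := rfl
  map_star' _ := rfl

theorem commute_commutantIncl (φ : B →⋆ₙₐ[ℂ] (H →L[ℂ] H)) (b : B) (y : commutant φ) :
    Commute (φ b) (commutantIncl φ y) :=
  ((StarSubalgebra.mem_centralizer_iff ℂ).mp y.2 (φ b) ⟨b, rfl⟩).1

end commutant

/-- `X` is weakly contained in `Y` with respect to the `*`-representation `(H, φ)` of `B`: the
representation `θ_X : A ⊗_max φ(B)' → 𝓑(X ⊗_φ H)`, `θ_X(a ⊗ y) = π_X(a) ⊗ y`, is weakly contained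
in `θ_Y`, i.e. `ker θ_Y ⊆ ker θ_X`. -/
def WeaklyContained {A B X Y H : Type u} [NonUnitalCStarAlgebra A] [NonUnitalCStarAlgebra B]
    [PartialOrder B] [StarOrderedRing B]
    [NormedAddCommGroup X] [NormedSpace ℂ X] [HilbertModule B X]
    [NormedAddCommGroup Y] [NormedSpace ℂ Y] [HilbertModule B Y]
    [NormedAddCommGroup H] [InnerProductSpace ℂ H] [CompleteSpace H]
    (πX : LeftAction A B X) (πY : LeftAction A B Y) (φ : B →⋆ₙₐ[ℂ] (H →L[ℂ] H)) : Prop :=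
  ∀ z : MaxTensor A (commutant φ),
    corrRep πY φ (commutantIncl φ) (commute_commutantIncl φ) z = 0 →
      corrRep πX φ (commutantIncl φ) (commute_commutantIncl φ) z = 0

section universal

variable (B : Type u) [NonUnitalCStarAlgebra B] [PartialOrder B] [StarOrderedRing B]

/-- The states of `B`: the positive linear functionals of norm one. -/
def State : Type u := {f : B →ₚ[ℂ] ℂ // IsLUB {r : ℝ | ∃ b : B, ‖b‖ ≤ 1 ∧ r = ‖f b‖} 1}

/-- The Hilbert space of the universal representation: the direct sum of the GNS spaces of all
states of `B`. -/
abbrev UniversalSpace : Type u := lp (fun f : State B => f.1.GNS) 2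

/-- The universal representation of `B`: the direct sum of the GNS representations of all states
of `B`. -/
def universalRep : B →⋆ₙₐ[ℂ] (UniversalSpace B →L[ℂ] UniversalSpace B) where
  toFun b := lp.mapCLM 2 (fun f : State B => f.1.gnsNonUnitalStarAlgHom b) (norm_nonneg b)
    (fun f => NonUnitalStarAlgHom.norm_apply_le f.1.gnsNonUnitalStarAlgHom b)
  map_smul' c b := by ext; simp
  map_zero' := by ext; simp
  map_add' a b := by ext; simp
  map_mul' a b := by ext; simp
  map_star' b := by
    refine (ContinuousLinearMap.eq_adjoint_iff _ _).mpr fun x y => ?_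
    simp only [lp.inner_eq_tsum]
    refine tsum_congr fun f => ?_
    have h := map_star f.1.gnsNonUnitalStarAlgHom b
    simp only [lp.mapCLM_apply_coe]
    rw [h, ContinuousLinearMap.star_eq_adjoint, ContinuousLinearMap.adjoint_inner_left]

end universal

/-- `X ≺_univ Y`: weak containment with respect to the universal representation of `B`. -/
def WeaklyContainedUniv {A B X Y : Type u} [NonUnitalCStarAlgebra A] [NonUnitalCStarAlgebra B]
    [PartialOrder B] [StarOrderedRing B]
    [NormedAddCommGroup X] [NormedSpace ℂ X] [HilbertModule B X]
    [NormedAddCommGroup Y] [NormedSpace ℂ Y] [HilbertModule B Y]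
    (πX : LeftAction A B X) (πY : LeftAction A B Y) : Prop :=
  WeaklyContained πX πY (universalRep B)

/-- A `*`-representation is nondegenerate if the vectors `σ(a) h` span a dense subspace. -/
def IsNondegenerate {A H : Type*} [NonUnitalCStarAlgebra A]
    [NormedAddCommGroup H] [InnerProductSpace ℂ H] [CompleteSpace H]
    (σ : A →⋆ₙₐ[ℂ] (H →L[ℂ] H)) : Prop :=
  Dense (Submodule.span ℂ {x : H | ∃ a h, x = σ a h} : Set H)

/-- The universal factorization property of a C*-correspondence `X` over `A`: for every C*-algebra
`B`, every nondegenerate `*`-representation `σ` of `A ⊗_max B` on `H`, written as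
`σ(a ⊗ b) = σ_A(a) σ_B(b)` with commuting `*`-representations `σ_A` and `σ_B`, is weakly contained
in the representation `a ⊗ b ↦ π_X(a) ⊗ σ_B(b)` on `X ⊗_{σ_A} H`. -/
def HasUFP {A X : Type u} [NonUnitalCStarAlgebra A] [PartialOrder A] [StarOrderedRing A]
    [NormedAddCommGroup X] [NormedSpace ℂ X] [HilbertModule A X] (π : LeftAction A A X) : Prop :=
  ∀ (B : Type u) [NonUnitalCStarAlgebra B]
    (H : Type u) [NormedAddCommGroup H] [InnerProductSpace ℂ H] [CompleteSpace H]
    (σ : MaxTensor A B →⋆ₙₐ[ℂ] (H →L[ℂ] H)) (σA : A →⋆ₙₐ[ℂ] (H →L[ℂ] H))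
    (σB : B →⋆ₙₐ[ℂ] (H →L[ℂ] H)) (hc : ∀ a b, Commute (σA a) (σB b)),
    IsNondegenerate σ → (∀ a b, σ (MaxTensor.tmul a b) = σA a * σB b) →
      ∀ z, corrRep π σA σB hc z = 0 → σ z = 0

section minNorm

/-- The linear map `π ⊗ σ : A ⊙ B → 𝓑(H ⊗ K)`, where `H ⊗ K` is the Hilbert space tensor product
and `(π ⊗ σ)(a ⊗ b) = π(a) ⊗ σ(b)`. -/
def spatialMap {A B H K : Type*} [NonUnitalCStarAlgebra A] [NonUnitalCStarAlgebra B]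
    [NormedAddCommGroup H] [InnerProductSpace ℂ H] [CompleteSpace H]
    [NormedAddCommGroup K] [InnerProductSpace ℂ K] [CompleteSpace K]
    (π : A →⋆ₙₐ[ℂ] (H →L[ℂ] H)) (σ : B →⋆ₙₐ[ℂ] (K →L[ℂ] K)) :
    (A ⊗[ℂ] B) →ₗ[ℂ] (UniformSpace.Completion (H ⊗[ℂ] K) →L[ℂ]
      UniformSpace.Completion (H ⊗[ℂ] K)) :=
  have key : ∀ f g : UniformSpace.Completion (H ⊗[ℂ] K) →L[ℂ] UniformSpace.Completion (H ⊗[ℂ] K),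
      (∀ z : H ⊗[ℂ] K, f z = g z) → f = g := fun f g hfg => by
    ext z
    induction z using UniformSpace.Completion.induction_on with
    | hp => exact isClosed_eq f.continuous g.continuous
    | ih z => exact hfg z
  TensorProduct.lift <| LinearMap.mk₂ ℂ
    (fun a b => (TensorProduct.mapL (π a) (σ b)).completion)
    (fun a a' b => key _ _ fun z => by
      simp [TensorProduct.map_add_left, ← UniformSpace.Completion.coe_add])
    (fun c a b => key _ _ fun z => by
      simp [TensorProduct.map_smul_left, ← UniformSpace.Completion.coe_smul])
    (fun a b b' => key _ _ fun z => by
      simp [TensorProduct.map_add_right, ← UniformSpace.Completion.coe_add])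
    (fun c a b => key _ _ fun z => by
      simp [TensorProduct.map_smul_right, ← UniformSpace.Completion.coe_smul])

/-- The minimal (spatial) C*-norm on `A ⊙ B`: the supremum of `‖(π ⊗ σ)(t)‖` over all pairs of
`*`-representations, which is attained at any pair of faithful ones. -/
def minNorm {A B : Type u} [NonUnitalCStarAlgebra A] [NonUnitalCStarAlgebra B]
    (t : A ⊗[ℂ] B) : ℝ :=
  sSup {r : ℝ | ∃ (H : Type u) (_ : NormedAddCommGroup H) (_ : InnerProductSpace ℂ H)
    (_ : CompleteSpace H) (K : Type u) (_ : NormedAddCommGroup K) (_ : InnerProductSpace ℂ K)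
    (_ : CompleteSpace K) (π : A →⋆ₙₐ[ℂ] (H →L[ℂ] H)) (σ : B →⋆ₙₐ[ℂ] (K →L[ℂ] K)),
    r = ‖spatialMap π σ t‖}

/-- `A` is nuclear: for every C*-algebra `B` the maximal and the minimal C*-norm on `A ⊙ B`
coincide, i.e. the canonical surjection from `A ⊗_max B` onto `A ⊗ B` is an isomorphism. -/
def IsNuclear (A : Type u) [NonUnitalCStarAlgebra A] : Prop :=
  ∀ (B : Type u) [NonUnitalCStarAlgebra B] (t : A ⊗[ℂ] B), maxNorm t = minNorm t

end minNorm

section identity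

variable (A : Type*) [NonUnitalCStarAlgebra A] [PartialOrder A] [StarOrderedRing A]

/-- A C*-algebra as a Hilbert module over itself, `⟨a, b⟩ = a* b`. -/
instance HilbertModule.self : HilbertModule A A where
  inner a b := star a * b
  rsmul b a := b * a
  inner_add_right _ _ _ := mul_add _ _ _
  inner_smul_right _ _ _ := mul_smul_comm _ _ _
  inner_rsmul_right _ _ _ := (mul_assoc _ _ _).symm
  star_inner _ _ := by simp
  inner_self_nonneg _ := star_mul_self_nonneg _
  norm_eq a := by rw [CStarRing.norm_star_mul_self, Real.sqrt_mul_self (norm_nonneg a)]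

/-- The identity correspondence `(A, λ_A)`: the left action of `A` on itself by
multiplication. -/
def identityCorr : LeftAction A A A where
  toHom :=
    { toFun := fun a => ContinuousLinearMap.mul ℂ A a
      map_smul' := fun _ _ => by simp
      map_zero' := by simp
      map_add' := fun _ _ => by simp
      map_mul' := fun a b => by ext; simp [mul_assoc] }
  adjoint a x y := by
    change star (a * x) * y = star x * (star a * y)
    rw [star_mul, mul_assoc]

end identity

section scalar

variable {A H B : Type*} [NonUnitalCStarAlgebra A] [NonUnitalCStarAlgebra B] [PartialOrder B]
  [NormedAddCommGroup H] [InnerProductSpace ℂ H]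

/-- The `B`-valued sesquilinear form `⟨h ⊗ b, h' ⊗ b'⟩ = ⟨h, h'⟩ b* b'` on `H ⊙ B`. -/
def scalarForm (H B : Type*) [NonUnitalCStarAlgebra B] [NormedAddCommGroup H]
    [InnerProductSpace ℂ H] : (H ⊗[ℂ] B) →ₗ⋆[ℂ] (H ⊗[ℂ] B) →ₗ[ℂ] B :=
  TensorProduct.lift <| LinearMap.mk₂'ₛₗ (starRingEnd ℂ) (starRingEnd ℂ)
    (fun h b => TensorProduct.lift <| LinearMap.mk₂ ℂ
      (fun h' b' => ⟪h, h'⟫_ℂ • (star b * b'))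
      (fun _ _ _ => by rw [inner_add_right, add_smul])
      (fun _ _ _ => by rw [inner_smul_right, mul_smul])
      (fun _ _ _ => by rw [mul_add, smul_add])
      (fun _ _ _ => by rw [mul_smul_comm, smul_comm]))
    (fun _ _ _ => by ext; simp [add_smul])
    (fun _ _ _ => by ext; simp [smul_smul, mul_comm])
    (fun _ _ _ => by ext; simp [add_mul])
    (fun c h b => by ext; simp [smul_mul_assoc, smul_smul, mul_comm])

theorem scalarForm_tmul (h h' : H) (b b' : B) :
    scalarForm H B (h ⊗ₜ b) (h' ⊗ₜ b') = ⟪h, h'⟫_ℂ • (star b * b') := rfl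

theorem star_scalarForm (z w : H ⊗[ℂ] B) :
    star (scalarForm H B z w) = scalarForm H B w z := by
  induction z using TensorProduct.induction_on with
  | zero => simp
  | add z₁ z₂ h₁ h₂ => simp [h₁, h₂]
  | tmul x h =>
    induction w using TensorProduct.induction_on with
    | zero => simp
    | add z₁ z₂ h₁ h₂ => simp [h₁, h₂]
    | tmul x' h' =>
      rw [scalarForm_tmul, scalarForm_tmul, star_smul, star_mul, star_star]
      congr 1
      exact inner_conj_symm _ _

theorem scalarForm_self [StarOrderedRing B] (z : H ⊗[ℂ] B) : 0 ≤ scalarForm H B z z := by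
  obtain ⟨n, h, b, rfl⟩ := exists_fin_sum z
  let V : Submodule ℂ H := Submodule.span ℂ (Set.range h)
  have : FiniteDimensional ℂ V := FiniteDimensional.span_of_finite ℂ (Set.finite_range h)
  let e := stdOrthonormalBasis ℂ V
  let v : Fin n → V := fun i => ⟨h i, Submodule.subset_span ⟨i, rfl⟩⟩
  have hv : ∀ i j, ⟪h i, h j⟫_ℂ = ∑ k, ⟪v i, e k⟫_ℂ * ⟪e k, v j⟫_ℂ := fun i j => by
    rw [OrthonormalBasis.sum_inner_mul_inner]; rfl
  have : scalarForm H B (∑ i, h i ⊗ₜ[ℂ] b i) (∑ i, h i ⊗ₜ[ℂ] b i)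
      = ∑ k, star (∑ i, ⟪e k, v i⟫_ℂ • b i) * (∑ i, ⟪e k, v i⟫_ℂ • b i) := by
    have hconj : ∀ k i, star ⟪e k, v i⟫_ℂ = ⟪v i, e k⟫_ℂ := fun k i => inner_conj_symm _ _
    simp only [map_sum, LinearMap.sum_apply, scalarForm_tmul, hv, star_sum, star_smul,
      Finset.sum_mul, Finset.mul_sum, smul_mul_assoc, mul_smul_comm, Finset.sum_smul, mul_smul,
      Finset.smul_sum, hconj]
    conv_rhs => rw [Finset.sum_comm]
    refine Finset.sum_congr rfl fun i _ => ?_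
    conv_rhs => rw [Finset.sum_comm]
    refine Finset.sum_congr rfl fun j _ => Finset.sum_congr rfl fun k _ => ?_
    rw [smul_comm]
  rw [this]
  exact Finset.sum_nonneg fun k _ => star_mul_self_nonneg _

/-- Right multiplication by `b` on `H ⊙ B`. -/
def scalarRmul (H : Type*) [NormedAddCommGroup H] [InnerProductSpace ℂ H] (b : B) :
    (H ⊗[ℂ] B) →ₗ[ℂ] (H ⊗[ℂ] B) :=
  TensorProduct.map LinearMap.id (LinearMap.mulRight ℂ b)

theorem scalarForm_rmul (z w : H ⊗[ℂ] B) (b : B) :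
    scalarForm H B z (scalarRmul H b w) = scalarForm H B z w * b := by
  induction z using TensorProduct.induction_on with
  | zero => simp
  | add z₁ z₂ h₁ h₂ => simp [h₁, h₂, add_mul]
  | tmul x h =>
    induction w using TensorProduct.induction_on with
    | zero => simp
    | add z₁ z₂ h₁ h₂ => rw [map_add, map_add, map_add, h₁, h₂, add_mul]
    | tmul x' h' =>
      simp only [scalarRmul, TensorProduct.map_tmul, scalarForm_tmul, LinearMap.id_apply,
        LinearMap.mulRight_apply, smul_mul_assoc, mul_assoc]

variable [StarOrderedRing B]

/-- The Cauchy–Schwarz inequality. -/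
theorem norm_scalarForm_le (z w : H ⊗[ℂ] B) :
    ‖scalarForm H B z w‖ ≤ √‖scalarForm H B z z‖ * √‖scalarForm H B w w‖ := by
  set a := scalarForm H B z w with ha
  set c := ‖scalarForm H B z z‖ with hc
  have hc0 : 0 ≤ c := norm_nonneg _
  have hl : ∀ u v, scalarForm H B (scalarRmul H a u) v = star a * scalarForm H B u v := by
    intro u v
    rw [← star_scalarForm v, scalarForm_rmul, star_mul, star_scalarForm v]
  have hstar : scalarForm H B w z = star a := (star_scalarForm z w).symm
  have key : ∀ ε : ℝ, 0 < ε → ‖a‖ * ‖a‖ ≤ (c + ε) * ‖scalarForm H B w w‖ := by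
    intro ε hε
    set t : ℝ := (c + ε)⁻¹ with ht
    have hcε : 0 < c + ε := by positivity
    have htpos : 0 < t := by positivity
    have h0 := scalarForm_self (((t : ℂ) • scalarRmul H a z) - w)
    have hexp : scalarForm H B (((t : ℂ) • scalarRmul H a z) - w)
        (((t : ℂ) • scalarRmul H a z) - w)
        = (t ^ 2) • (star a * scalarForm H B z z * a) - (2 * t) • (star a * a)
          + scalarForm H B w w := by
      have e1 : scalarForm H B ((t : ℂ) • scalarRmul H a z)
          = (t : ℂ) • scalarForm H B (scalarRmul H a z) := by
        rw [LinearMap.map_smulₛₗ, Complex.conj_ofReal]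
      rw [map_sub (scalarForm H B), LinearMap.sub_apply, e1, LinearMap.smul_apply, map_sub, map_sub, map_smul,
        map_smul, hl, hl, scalarForm_rmul, scalarForm_rmul, hstar, ← ha, Complex.coe_smul,
        Complex.coe_smul, Complex.coe_smul, smul_sub, smul_smul, two_mul, add_smul, sq, mul_assoc]
      abel
    rw [hexp] at h0
    have h1 : star a * scalarForm H B z z * a ≤ c • (star a * a) :=
      CStarAlgebra.star_left_conjugate_le_norm_smul
        (hb := (scalarForm_self z).isSelfAdjoint)
    have h2 : (t ^ 2) • (star a * scalarForm H B z z * a) ≤ (t ^ 2) • (c • (star a * a)) :=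
      smul_le_smul_of_nonneg_left h1 (by positivity)
    have h3 : t • (star a * a) ≤ scalarForm H B w w := by
      have h4 : (t ^ 2 * c) ≤ t := by
        have : t * c ≤ 1 := by
          rw [ht, inv_mul_le_iff₀ hcε]; linarith
        nlinarith
      have h5 : (t ^ 2) • (c • (star a * a)) ≤ t • (star a * a) := by
        rw [smul_smul]
        exact smul_le_smul_of_nonneg_right h4 (star_mul_self_nonneg a)
      have h6 := h2.trans h5
      have h7 : 0 ≤ t • (star a * a) - (2 * t) • (star a * a) + scalarForm H B w w := by
        refine h0.trans ?_
        gcongr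
      have h8 : t • (star a * a) - (2 * t) • (star a * a) + scalarForm H B w w
          = scalarForm H B w w - t • (star a * a) := by
        rw [two_mul, add_smul]; abel
      rw [h8] at h7
      exact sub_nonneg.mp h7
    have h9 := CStarAlgebra.norm_le_norm_of_nonneg_of_le
      (smul_nonneg htpos.le (star_mul_self_nonneg a)) h3
    rw [norm_smul, CStarRing.norm_star_mul_self, Real.norm_of_nonneg htpos.le] at h9
    rwa [ht, inv_mul_le_iff₀ hcε] at h9
  have hlim : ‖a‖ * ‖a‖ ≤ c * ‖scalarForm H B w w‖ := by
    refine le_of_forall_pos_le_add fun δ hδ => ?_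
    have h := key (δ / (‖scalarForm H B w w‖ + 1)) (by positivity)
    refine h.trans ?_
    rw [add_mul]
    gcongr
    rw [div_mul_eq_mul_div, div_le_iff₀ (by positivity)]
    nlinarith [norm_nonneg (scalarForm H B w w)]
  rw [← Real.sqrt_mul hc0]
  refine Real.le_sqrt_of_sq_le ?_
  rw [sq]; exact hlim

/-- `H ⊙ B` with the `B`-valued semi-inner product. -/
def PreScalarModule (H B : Type*) [NonUnitalCStarAlgebra B] [NormedAddCommGroup H]
    [InnerProductSpace ℂ H] : Type _ := H ⊗[ℂ] B

namespace PreScalarModule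

instance : AddCommGroup (PreScalarModule H B) := inferInstanceAs (AddCommGroup (H ⊗[ℂ] B))
instance : Module ℂ (PreScalarModule H B) := inferInstanceAs (Module ℂ (H ⊗[ℂ] B))

variable (H B) in
/-- The identification of `H ⊙ B` with its normed copy. -/
def mk : (H ⊗[ℂ] B) ≃ₗ[ℂ] PreScalarModule H B := LinearEquiv.refl ℂ _

instance : Norm (PreScalarModule H B) :=
  ⟨fun z => √‖scalarForm H B ((mk H B).symm z) ((mk H B).symm z)‖⟩

theorem norm_def (z : PreScalarModule H B) :
    ‖z‖ = √‖scalarForm H B ((mk H B).symm z) ((mk H B).symm z)‖ := rfl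

theorem norm_sq (z : PreScalarModule H B) :
    ‖z‖ ^ 2 = ‖scalarForm H B ((mk H B).symm z) ((mk H B).symm z)‖ := by
  rw [norm_def, Real.sq_sqrt (norm_nonneg _)]

theorem norm_form_le (z w : PreScalarModule H B) :
    ‖scalarForm H B ((mk H B).symm z) ((mk H B).symm w)‖ ≤ ‖z‖ * ‖w‖ := norm_scalarForm_le _ _

theorem core : SeminormedSpace.Core ℂ (PreScalarModule H B) where
  norm_nonneg _ := Real.sqrt_nonneg _
  norm_smul c z := by
    rw [norm_def, norm_def, map_smul, LinearMap.map_smulₛₗ (scalarForm H B),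
      LinearMap.smul_apply, map_smul,
      norm_smul, norm_smul, RCLike.norm_conj, ← mul_assoc, Real.sqrt_mul (by positivity),
      Real.sqrt_mul_self (norm_nonneg _)]
  norm_triangle z w := by
    have h0 : 0 ≤ ‖z‖ + ‖w‖ := add_nonneg (Real.sqrt_nonneg _) (Real.sqrt_nonneg _)
    rw [norm_def (z + w)]
    refine Real.sqrt_le_iff.mpr ⟨h0, ?_⟩
    rw [map_add, map_add, map_add, LinearMap.add_apply, LinearMap.add_apply]
    refine (norm_add_le _ _).trans ?_
    have h1 := norm_add_le (scalarForm H B ((mk H B).symm z) ((mk H B).symm z))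
      (scalarForm H B ((mk H B).symm w) ((mk H B).symm z))
    have h2 := norm_add_le (scalarForm H B ((mk H B).symm z) ((mk H B).symm w))
      (scalarForm H B ((mk H B).symm w) ((mk H B).symm w))
    have h3 := norm_form_le z w
    have h4 := norm_form_le w z
    have h5 := norm_sq z
    have h6 := norm_sq w
    nlinarith

instance : SeminormedAddCommGroup (PreScalarModule H B) := SeminormedAddCommGroup.ofCore core
instance : NormedSpace ℂ (PreScalarModule H B) where
  norm_smul_le c t := (core.norm_smul c t).le

end PreScalarModule

/-- The Hilbert `B`-module `H ⊗ B` (exterior tensor product): the completion of `H ⊙ B` with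
respect to `⟨h ⊗ b, h' ⊗ b'⟩ = ⟨h, h'⟩ b* b'`. -/
def ScalarModule (H B : Type*) [NonUnitalCStarAlgebra B] [PartialOrder B] [StarOrderedRing B]
    [NormedAddCommGroup H] [InnerProductSpace ℂ H] : Type _ :=
  UniformSpace.Completion (PreScalarModule H B)

namespace ScalarModule

open UniformSpace

instance : NormedAddCommGroup (ScalarModule H B) :=
  inferInstanceAs (NormedAddCommGroup (Completion (PreScalarModule H B)))
instance : NormedSpace ℂ (ScalarModule H B) :=
  inferInstanceAs (NormedSpace ℂ (Completion (PreScalarModule H B)))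
instance : CompleteSpace (ScalarModule H B) :=
  inferInstanceAs (CompleteSpace (Completion (PreScalarModule H B)))

variable (H B) in
/-- The canonical map `H ⊙ B → H ⊗ B`. -/
def ofAlg : PreScalarModule H B →ₗᵢ[ℂ] ScalarModule H B := Completion.toComplₗᵢ

theorem isDenseInducing_ofAlg : IsDenseInducing (ofAlg H B) := Completion.isDenseInducing_coe

theorem denseRange_ofAlg : DenseRange (ofAlg H B) := isDenseInducing_ofAlg.dense

theorem induction_on {p : ScalarModule H B → Prop} (z : ScalarModule H B) (hp : IsClosed {z | p z})
    (ih : ∀ t, p (ofAlg H B t)) : p z := denseRange_ofAlg.induction_on z hp ih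

theorem induction_on₂ {p : ScalarModule H B → ScalarModule H B → Prop} (z w : ScalarModule H B)
    (hp : IsClosed {x : ScalarModule H B × ScalarModule H B | p x.1 x.2})
    (ih : ∀ s t, p (ofAlg H B s) (ofAlg H B t)) : p z w :=
  denseRange_ofAlg.induction_on₂ hp ih z w

/-- The inner product of `H ⊗ B`, as the continuous extension of that of `H ⊙ B`. -/
def innerFun : ScalarModule H B → ScalarModule H B → B :=
  Function.curry <| (isDenseInducing_ofAlg.prodMap isDenseInducing_ofAlg).extend
    (fun p => scalarForm H B ((PreScalarModule.mk H B).symm p.1) ((PreScalarModule.mk H B).symm p.2))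

/-- The inner product of `H ⊙ B` as an additive map. -/
def preInnerHom : PreScalarModule H B →+ PreScalarModule H B →+ B :=
  AddMonoidHom.mk' (fun z => AddMonoidHom.mk'
    (fun w => scalarForm H B ((PreScalarModule.mk H B).symm z) ((PreScalarModule.mk H B).symm w))
      (fun _ _ => by rw [map_add, map_add]))
    (fun _ _ => AddMonoidHom.ext fun _ => by
      change scalarForm H B _ _ = scalarForm H B _ _ + scalarForm H B _ _
      rw [map_add, map_add, LinearMap.add_apply])

theorem norm_preInner_le (z w : PreScalarModule H B) : ‖preInnerHom z w‖ ≤ ‖z‖ * ‖w‖ :=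
  PreScalarModule.norm_form_le z w

theorem continuous_preInner : Continuous fun p : PreScalarModule H B × PreScalarModule H B =>
    preInnerHom p.1 p.2 := by
  refine continuous_iff_continuousAt.mpr fun p => ?_
  rw [ContinuousAt, tendsto_iff_norm_sub_tendsto_zero]
  have hb : ∀ q : PreScalarModule H B × PreScalarModule H B,
      ‖preInnerHom q.1 q.2 - preInnerHom p.1 p.2‖
        ≤ ‖q.1 - p.1‖ * ‖q.2‖ + ‖p.1‖ * ‖q.2 - p.2‖ := by
    intro q
    have h : preInnerHom q.1 q.2 - preInnerHom p.1 p.2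
        = preInnerHom (q.1 - p.1) q.2 + preInnerHom p.1 (q.2 - p.2) := by
      rw [map_sub, map_sub, AddMonoidHom.sub_apply]; abel
    rw [h]
    exact (norm_add_le _ _).trans (add_le_add (norm_preInner_le _ _) (norm_preInner_le _ _))
  refine squeeze_zero (fun _ => norm_nonneg _) hb ?_
  have hc : Continuous fun q : PreScalarModule H B × PreScalarModule H B =>
      ‖q.1 - p.1‖ * ‖q.2‖ + ‖p.1‖ * ‖q.2 - p.2‖ :=
    ((continuous_fst.sub continuous_const).norm.mul continuous_snd.norm).add
      (continuous_const.mul (continuous_snd.sub continuous_const).norm)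
  have h0 := hc.tendsto p
  simpa using h0

theorem innerFun_ofAlg (z w : PreScalarModule H B) : innerFun (ofAlg H B z) (ofAlg H B w)
    = scalarForm H B ((PreScalarModule.mk H B).symm z) ((PreScalarModule.mk H B).symm w) :=
  (isDenseInducing_ofAlg.prodMap isDenseInducing_ofAlg).extend_eq continuous_preInner (z, w)

theorem continuous_innerFun :
    Continuous fun p : ScalarModule H B × ScalarModule H B => innerFun p.1 p.2 := by
  have di : IsDenseInducing ((ofAlg H B).toLinearMap.toAddMonoidHom) := isDenseInducing_ofAlg
  exact (di.extend_Z_bilin di continuous_preInner :)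

/-- A bounded linear map on `H ⊙ B` extends to `H ⊗ B`. -/
def extend (T : (H ⊗[ℂ] B) →ₗ[ℂ] (H ⊗[ℂ] B)) (C : ℝ)
    (hT : ∀ z, ‖PreScalarModule.mk H B (T z)‖ ≤ C * ‖PreScalarModule.mk H B z‖) :
    ScalarModule H B →L[ℂ] ScalarModule H B :=
  ContinuousLinearMap.completion (α := PreScalarModule H B) (β := PreScalarModule H B)
    (((PreScalarModule.mk H B).toLinearMap ∘ₗ T ∘ₗ
      (PreScalarModule.mk H B).symm.toLinearMap).mkContinuous C (fun _ => hT _))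

theorem extend_ofAlg (T : (H ⊗[ℂ] B) →ₗ[ℂ] (H ⊗[ℂ] B)) (C : ℝ)
    (hT : ∀ z, ‖PreScalarModule.mk H B (T z)‖ ≤ C * ‖PreScalarModule.mk H B z‖) (z : H ⊗[ℂ] B) :
    extend T C hT (ofAlg H B (PreScalarModule.mk H B z))
      = ofAlg H B (PreScalarModule.mk H B (T z)) :=
  ContinuousLinearMap.completion_apply_coe _ _

theorem rmul_bound (b : B) (z : H ⊗[ℂ] B) :
    ‖PreScalarModule.mk H B (scalarRmul H b z)‖ ≤ ‖b‖ * ‖PreScalarModule.mk H B z‖ := by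
  refine (sq_le_sq₀ (norm_nonneg _) (by positivity)).mp ?_
  rw [mul_pow, PreScalarModule.norm_sq, PreScalarModule.norm_sq]
  simp only [LinearEquiv.symm_apply_apply]
  rw [scalarForm_rmul, ← star_scalarForm, scalarForm_rmul, star_mul, star_scalarForm]
  refine (norm_mul_le _ _).trans ?_
  grw [norm_mul_le]
  rw [norm_star]
  apply le_of_eq; ring

theorem continuous_innerFun_right (x : ScalarModule H B) : Continuous fun w => innerFun x w :=
  continuous_innerFun.comp (continuous_const.prodMk continuous_id)

theorem continuous_innerFun_left (w : ScalarModule H B) : Continuous fun x => innerFun x w :=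
  continuous_innerFun.comp (continuous_id.prodMk continuous_const)

theorem continuous_innerFun_self : Continuous fun x : ScalarModule H B => innerFun x x :=
  continuous_innerFun.comp (continuous_id.prodMk continuous_id)

theorem innerFun_add (x y z : ScalarModule H B) :
    innerFun x (y + z) = innerFun x y + innerFun x z := by
  refine induction_on x (p := fun x => innerFun x (y + z) = innerFun x y + innerFun x z)
    (isClosed_eq (continuous_innerFun_left _)
      ((continuous_innerFun_left _).add (continuous_innerFun_left _))) fun x => ?_
  refine induction_on₂ y z (p := fun y z => innerFun (ofAlg H B x) (y + z)
    = innerFun (ofAlg H B x) y + innerFun (ofAlg H B x) z)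
    (isClosed_eq ((continuous_innerFun_right _).comp (continuous_fst.add continuous_snd))
      (((continuous_innerFun_right _).comp continuous_fst).add
        ((continuous_innerFun_right _).comp continuous_snd))) fun y z => ?_
  rw [← map_add, innerFun_ofAlg, innerFun_ofAlg, innerFun_ofAlg, map_add, map_add]

theorem innerFun_smul (x : ScalarModule H B) (c : ℂ) (y : ScalarModule H B) :
    innerFun x (c • y) = c • innerFun x y := by
  refine induction_on₂ x y (p := fun x y => innerFun x (c • y) = c • innerFun x y)
    (isClosed_eq (continuous_innerFun.comp (continuous_fst.prodMk (continuous_snd.const_smul c)))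
      (continuous_innerFun.const_smul c)) fun x y => ?_
  rw [← map_smul, innerFun_ofAlg, innerFun_ofAlg, map_smul, map_smul]

theorem innerFun_rmul (x y : ScalarModule H B) (b : B) :
    innerFun x (extend (scalarRmul H b) ‖b‖ (rmul_bound b) y) = innerFun x y * b := by
  have hT := (extend (scalarRmul H b) ‖b‖ (rmul_bound b)).continuous
  refine induction_on₂ x y (p := fun x y =>
    innerFun x (extend (scalarRmul H b) ‖b‖ (rmul_bound b) y) = innerFun x y * b)
    (isClosed_eq (continuous_innerFun.comp (continuous_fst.prodMk (hT.comp continuous_snd)))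
      (continuous_innerFun.mul continuous_const)) fun x y => ?_
  obtain ⟨y, rfl⟩ := (PreScalarModule.mk H B).surjective y
  rw [extend_ofAlg, innerFun_ofAlg, innerFun_ofAlg, LinearEquiv.symm_apply_apply,
    LinearEquiv.symm_apply_apply, scalarForm_rmul]

theorem star_innerFun (x y : ScalarModule H B) : star (innerFun x y) = innerFun y x := by
  refine induction_on₂ x y (p := fun x y => star (innerFun x y) = innerFun y x)
    (isClosed_eq continuous_innerFun.star
      (continuous_innerFun.comp (continuous_snd.prodMk continuous_fst))) fun x y => ?_
  rw [innerFun_ofAlg, innerFun_ofAlg, star_scalarForm]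

theorem innerFun_self_nonneg (x : ScalarModule H B) : 0 ≤ innerFun x x := by
  refine induction_on x (p := fun x => 0 ≤ innerFun x x)
    (CStarAlgebra.isClosed_nonneg.preimage continuous_innerFun_self) fun x => ?_
  rw [innerFun_ofAlg]
  exact scalarForm_self _

theorem norm_eq_innerFun (x : ScalarModule H B) : ‖x‖ = √‖innerFun x x‖ := by
  refine induction_on x (p := fun x => ‖x‖ = √‖innerFun x x‖)
    (isClosed_eq continuous_norm continuous_innerFun_self.norm.sqrt) fun x => ?_
  rw [innerFun_ofAlg, LinearIsometry.norm_map, PreScalarModule.norm_def]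

instance : HilbertModule B (ScalarModule H B) where
  inner := innerFun
  rsmul z b := extend (scalarRmul H b) ‖b‖ (rmul_bound b) z
  inner_add_right := innerFun_add
  inner_smul_right := innerFun_smul
  inner_rsmul_right := innerFun_rmul
  star_inner := star_innerFun
  inner_self_nonneg := innerFun_self_nonneg
  norm_eq := norm_eq_innerFun

section action

variable [CompleteSpace H]

/-- The operator `T ⊗ 1` on `H ⊙ B`. -/
def preOp (B : Type*) [NonUnitalCStarAlgebra B] (T : H →L[ℂ] H) :
    (H ⊗[ℂ] B) →ₗ[ℂ] (H ⊗[ℂ] B) :=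
  TensorProduct.map T.toLinearMap LinearMap.id

theorem scalarForm_preOp (T : H →L[ℂ] H) (z w : H ⊗[ℂ] B) :
    scalarForm H B (preOp B T z) w = scalarForm H B z (preOp B (star T) w) := by
  induction z using TensorProduct.induction_on with
  | zero => simp
  | add z₁ z₂ h₁ h₂ => simp [h₁, h₂]
  | tmul x h =>
    induction w using TensorProduct.induction_on with
    | zero => simp
    | add z₁ z₂ h₁ h₂ => rw [map_add, map_add, map_add, h₁, h₂]
    | tmul x' h' =>
      simp only [preOp, TensorProduct.map_tmul, scalarForm_tmul, LinearMap.id_apply,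
        ContinuousLinearMap.coe_coe]
      rw [ContinuousLinearMap.star_eq_adjoint, ContinuousLinearMap.adjoint_inner_right]

theorem preOp_mul (S T : H →L[ℂ] H) (z : H ⊗[ℂ] B) :
    preOp B (S * T) z = preOp B S (preOp B T z) := by
  induction z using TensorProduct.induction_on with
  | zero => simp
  | add z₁ z₂ h₁ h₂ => simp [h₁, h₂]
  | tmul x h => rfl

theorem preOp_add (S T : H →L[ℂ] H) (z : H ⊗[ℂ] B) :
    preOp B (S + T) z = preOp B S z + preOp B T z := by
  simp [preOp, TensorProduct.map_add_left]

theorem preOp_smul (c : ℂ) (T : H →L[ℂ] H) (z : H ⊗[ℂ] B) :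
    preOp B (c • T) z = c • preOp B T z := by
  simp [preOp, TensorProduct.map_smul_left]

theorem preOp_bound (T : H →L[ℂ] H) (z : H ⊗[ℂ] B) :
    ‖PreScalarModule.mk H B (preOp B T z)‖ ≤ ‖T‖ * ‖PreScalarModule.mk H B z‖ := by
  have hpos : star T * T ≤ ‖star T * T‖ • (1 : H →L[ℂ] H) := by
    have h := CStarAlgebra.star_mul_le_algebraMap_norm_sq (a := T)
    rw [Algebra.algebraMap_eq_smul_one] at h
    rwa [CStarRing.norm_star_mul_self, ← sq]
  rw [CStarRing.norm_star_mul_self, ← sub_nonneg,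
    CStarAlgebra.nonneg_iff_eq_star_mul_self] at hpos
  obtain ⟨S, hS⟩ := hpos
  have h1 : (((‖T‖ * ‖T‖ : ℝ) : ℂ) • (1 : H →L[ℂ] H)) = star T * T + star S * S := by
    rw [← hS, Complex.coe_smul]; abel
  have h2 : scalarForm H B z (preOp B (((‖T‖ * ‖T‖ : ℝ) : ℂ) • (1 : H →L[ℂ] H)) z)
      = scalarForm H B (preOp B T z) (preOp B T z)
        + scalarForm H B (preOp B S z) (preOp B S z) := by
    rw [h1, preOp_add, map_add, preOp_mul, preOp_mul, ← scalarForm_preOp, ← scalarForm_preOp]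
  have h3 : preOp B (1 : H →L[ℂ] H) z = z := by
    change TensorProduct.map LinearMap.id LinearMap.id z = z
    simp
  rw [preOp_smul, h3, map_smul] at h2
  have h4 : scalarForm H B (preOp B T z) (preOp B T z)
      ≤ ((‖T‖ * ‖T‖ : ℝ) : ℂ) • scalarForm H B z z := by
    rw [h2]; exact le_add_of_nonneg_right (scalarForm_self _)
  have h5 := CStarAlgebra.norm_le_norm_of_nonneg_of_le (scalarForm_self _) h4
  refine (sq_le_sq₀ (norm_nonneg _) (by positivity)).mp ?_
  rw [mul_pow, PreScalarModule.norm_sq, PreScalarModule.norm_sq]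
  simp only [LinearEquiv.symm_apply_apply]
  refine h5.trans ?_
  rw [norm_smul, Complex.norm_real, Real.norm_of_nonneg (by positivity), sq]

/-- The operator `T ⊗ 1` on `H ⊗ B`. -/
def op (B : Type*) [NonUnitalCStarAlgebra B] [PartialOrder B] [StarOrderedRing B]
    (T : H →L[ℂ] H) : ScalarModule H B →L[ℂ] ScalarModule H B :=
  extend (preOp B T) ‖T‖ (preOp_bound T)

theorem op_ofAlg (T : H →L[ℂ] H) (z : H ⊗[ℂ] B) :
    op B T (ofAlg H B (PreScalarModule.mk H B z))
      = ofAlg H B (PreScalarModule.mk H B (preOp B T z)) := extend_ofAlg _ _ _ _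

theorem innerFun_op (T : H →L[ℂ] H) (x y : ScalarModule H B) :
    innerFun (op B T x) y = innerFun x (op B (star T) y) := by
  have hT := (op B T).continuous
  have hS := (op B (star T)).continuous
  refine induction_on₂ x y (p := fun x y => innerFun (op B T x) y = innerFun x (op B (star T) y))
    (isClosed_eq (continuous_innerFun.comp ((hT.comp continuous_fst).prodMk continuous_snd))
      (continuous_innerFun.comp (continuous_fst.prodMk (hS.comp continuous_snd)))) fun x y => ?_
  obtain ⟨x, rfl⟩ := (PreScalarModule.mk H B).surjective x
  obtain ⟨y, rfl⟩ := (PreScalarModule.mk H B).surjective y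
  rw [op_ofAlg, op_ofAlg, innerFun_ofAlg, innerFun_ofAlg, LinearEquiv.symm_apply_apply,
    LinearEquiv.symm_apply_apply, LinearEquiv.symm_apply_apply, LinearEquiv.symm_apply_apply,
    scalarForm_preOp]

theorem ext_clm {f g : ScalarModule H B →L[ℂ] ScalarModule H B}
    (h : ∀ z : H ⊗[ℂ] B, f (ofAlg H B (PreScalarModule.mk H B z))
      = g (ofAlg H B (PreScalarModule.mk H B z))) : f = g := by
  ext z
  induction z using induction_on with
  | hp => exact isClosed_eq f.continuous g.continuous
  | ih z =>
    obtain ⟨z, rfl⟩ := (PreScalarModule.mk H B).surjective z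
    exact h z

end action

end ScalarModule

/-- The scalar representation `(H ⊗ B, π_H ⊗ 1_B)` of a `*`-representation `π_H : A → 𝓑(H)`. -/
def scalarCorr (B : Type*) [NonUnitalCStarAlgebra B] [PartialOrder B] [StarOrderedRing B]
    [CompleteSpace H] (πH : A →⋆ₙₐ[ℂ] (H →L[ℂ] H)) : LeftAction A B (ScalarModule H B) where
  toHom :=
    { toFun := fun a => ScalarModule.op B (πH a)
      map_smul' := fun c a => ScalarModule.ext_clm fun z => by
        simp [ScalarModule.op_ofAlg, ScalarModule.preOp_smul]
      map_zero' := ScalarModule.ext_clm fun z => by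
        have h := ScalarModule.preOp_smul (B := B) 0 (0 : H →L[ℂ] H) z
        rw [zero_smul, zero_smul] at h
        simp [ScalarModule.op_ofAlg, h]
      map_add' := fun a b => ScalarModule.ext_clm fun z => by
        simp [ScalarModule.op_ofAlg, ScalarModule.preOp_add]
      map_mul' := fun a b => ScalarModule.ext_clm fun z => by
        simp [ScalarModule.op_ofAlg, ScalarModule.preOp_mul] }
  adjoint a x y := by
    change ScalarModule.innerFun (ScalarModule.op B (πH a) x) y
      = ScalarModule.innerFun x (ScalarModule.op B (πH (star a)) y)
    rw [map_star]
    exact ScalarModule.innerFun_op _ _ _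

end scalar

end CStarCorr

end

/-!
Let `φ` be a nondegenerate representation of `A` on `H`. Then `a ⊗ h ↦ φ(a) h` identifies
`A ⊗_φ H` with `H`, and the representation of `A ⊗_max φ(A)'` attached to the identity
correspondence becomes the one with commuting factors `φ` and the inclusion of `φ(A)'`. For
`φ = π_u` the UFP with `B = π_u(A)'` is therefore weak containment. Conversely, let `σ_A`, `σ_B` be
a commuting pair. Each unit vector `ξ` is `W η` for a unit vector `η` and a contraction `W` which
intertwines `π_u` and `σ_A`: project onto the summand of the state `a ↦ ⟨ξ, σ_A(a) ξ⟩` and embed it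
by `[a] ↦ σ_A(a) ξ`. Since `b ↦ W* σ_B(b) W` takes values in `π_u(A)'`, compression by `W` on `H`
and by `1 ⊗ W` on `X ⊗ H` reduces the estimate of `⟨ξ, σ(z) ξ⟩` to weak containment over `π_u`.

For the scalar correspondence, `(H ⊗ A) ⊗_φ K` is `H ⊗ K` via `(h ⊗ a) ⊗ k ↦ h ⊗ φ(a) k`, so the
UFP says that every commuting pair `σ_A`, `σ_B` is dominated by the spatial representation
`π_H ⊗ σ_B`. This bounds the maximal norm by the minimal one. Conversely, nuclearity is applied to
`A ⊙ σ_A(A)'` rather than `A ⊙ B`, because the inclusion of the commutant is faithful and the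
minimal norm can be computed from any pair of faithful representations. The last fact follows by
compressing to finite-dimensional subspaces of one factor: the compressions are representations of
matrix algebras over `A`, and faithful ones are isometric.
-/

noncomputable section

namespace CStarCorr

section StarHom

open scoped CStarAlgebra

variable {C D E : Type*} [NonUnitalCStarAlgebra C] [NonUnitalCStarAlgebra D]
  [NonUnitalCStarAlgebra E]

theorem inner_map_left {H : Type*} [NormedAddCommGroup H] [InnerProductSpace ℂ H]
    [CompleteSpace H] (σ : C →⋆ₙₐ[ℂ] (H →L[ℂ] H)) (a : C) (h k : H) :
    ⟪σ a h, k⟫_ℂ = ⟪h, σ (star a) k⟫_ℂ := by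
  rw [map_star, ContinuousLinearMap.star_eq_adjoint, ContinuousLinearMap.adjoint_inner_right]

theorem inner_map_star_mul {H : Type*} [NormedAddCommGroup H] [InnerProductSpace ℂ H]
    [CompleteSpace H] (σ : C →⋆ₙₐ[ℂ] (H →L[ℂ] H)) (a b : C) (h k : H) :
    ⟪h, σ (star a * b) k⟫_ℂ = ⟪σ a h, σ b k⟫_ℂ := by
  rw [map_mul, mul_apply_eq_comp, inner_map_left]

-- `f(τ a) = 0` for `f(x) = max (|x| - ‖τ a‖) 0`, hence `f(σ a) = 0`, i.e. `‖σ a‖ ≤ ‖τ a‖`.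
theorem norm_map_le_of_ker_le_of_isSelfAdjoint {a : C} (ha : IsSelfAdjoint a)
    {σ : C →⋆ₙₐ[ℂ] D} {τ : C →⋆ₙₐ[ℂ] E} (h : ∀ z, τ z = 0 → σ z = 0) : ‖σ a‖ ≤ ‖τ a‖ := by
  let f : ℝ → ℝ := fun x => max (|x| - ‖τ a‖) 0
  have hf : Continuous f := by fun_prop
  have hf0 : f 0 = 0 := by simp [f]
  have hτf : τ (cfcₙ f a) = 0 := by
    rw [NonUnitalStarAlgHom.map_cfcₙ τ f a hf.continuousOn hf0 (map_continuous τ) ha (ha.map τ),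
      ← cfcₙ_zero ℝ (τ a)]
    refine cfcₙ_congr fun x hx => ?_
    have hx_le := norm_apply_le_norm_cfcₙ (fun x : ℝ => x) (τ a) hx (ha := ha.map τ)
    rw [cfcₙ_id' ℝ (τ a) (ha.map τ)] at hx_le
    simpa [f] using hx_le
  have hσf : cfcₙ f (σ a) = 0 := by
    rw [← NonUnitalStarAlgHom.map_cfcₙ σ f a hf.continuousOn hf0 (map_continuous σ) ha (ha.map σ)]
    exact h _ hτf
  rw [← cfcₙ_id' ℝ (σ a) (ha.map σ)]
  refine norm_cfcₙ_le fun x hx => ?_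
  have hfx := norm_apply_le_norm_cfcₙ f (σ a) hx hf.continuousOn hf0 (ha.map σ)
  rw [hσf, norm_zero, norm_le_zero_iff] at hfx
  simpa [f] using hfx

theorem norm_map_le_of_ker_le {σ : C →⋆ₙₐ[ℂ] D} {τ : C →⋆ₙₐ[ℂ] E}
    (h : ∀ z, τ z = 0 → σ z = 0) (z : C) : ‖σ z‖ ≤ ‖τ z‖ := by
  have hle := norm_map_le_of_ker_le_of_isSelfAdjoint (.star_mul_self z) h
  simp only [map_mul, map_star, CStarRing.norm_star_mul_self] at hle
  exact (mul_self_le_mul_self_iff (norm_nonneg _) (norm_nonneg _)).mpr hle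

theorem norm_map_le_of_forall_norm_inner_le {H : Type*} [NormedAddCommGroup H]
    [InnerProductSpace ℂ H] [CompleteSpace H] {σ : C →⋆ₙₐ[ℂ] (H →L[ℂ] H)} {τ : C →⋆ₙₐ[ℂ] D}
    (h : ∀ z ξ, ‖ξ‖ = 1 → ‖⟪ξ, σ z ξ⟫_ℂ‖ ≤ ‖τ z‖) (z : C) : ‖σ z‖ ≤ ‖τ z‖ := by
  refine ContinuousLinearMap.opNorm_le_of_unit_norm (norm_nonneg _) fun ξ hξ => ?_
  have hle := h (star z * z) ξ hξ
  rw [inner_map_star_mul, map_mul, map_star, CStarRing.norm_star_mul_self,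
    inner_self_eq_norm_sq_to_K, norm_pow, RCLike.norm_ofReal, abs_norm, sq] at hle
  exact (mul_self_le_mul_self_iff (norm_nonneg _) (norm_nonneg _)).mpr hle

end StarHom

section IsometryOfGram

variable {ι E F : Type*} [NormedAddCommGroup E] [InnerProductSpace ℂ E]
  [NormedAddCommGroup F] [InnerProductSpace ℂ F]

theorem norm_linearCombination_eq_of_gram {e : ι → E} {f : ι → F}
    (hef : ∀ i j, ⟪e i, e j⟫_ℂ = ⟪f i, f j⟫_ℂ) (c : ι →₀ ℂ) :
    ‖Finsupp.linearCombination ℂ f c‖ = ‖Finsupp.linearCombination ℂ e c‖ := by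
  rw [@norm_eq_sqrt_re_inner ℂ, @norm_eq_sqrt_re_inner ℂ]
  simp only [Finsupp.linearCombination_apply, Finsupp.sum, sum_inner, inner_sum,
    inner_smul_left, inner_smul_right, hef]

variable [CompleteSpace F]

/-- The isometry `e i ↦ f i` determined by two families of vectors with the same Gram matrix, the
first of which is total. -/
def isometryOfGram (e : ι → E) (f : ι → F) (he : Dense (Submodule.span ℂ (Set.range e) : Set E))
    (hef : ∀ i j, ⟪e i, e j⟫_ℂ = ⟪f i, f j⟫_ℂ) : E →ₗᵢ[ℂ] F where
  toLinearMap := (Finsupp.linearCombination ℂ f).extendOfNorm (Finsupp.linearCombination ℂ e)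
  norm_map' x := by
    have hd : DenseRange (Finsupp.linearCombination ℂ e) := by
      rwa [DenseRange, ← LinearMap.coe_range, Finsupp.range_linearCombination]
    refine hd.induction_on x (isClosed_eq (ContinuousLinearMap.continuous _).norm continuous_norm)
      fun c => ?_
    rw [ContinuousLinearMap.coe_coe, LinearMap.extendOfNorm_eq hd
      ⟨1, fun c => by rw [norm_linearCombination_eq_of_gram hef, one_mul]⟩,
      norm_linearCombination_eq_of_gram hef]

@[simp]
theorem isometryOfGram_apply {e : ι → E} {f : ι → F}
    (he : Dense (Submodule.span ℂ (Set.range e) : Set E))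
    (hef : ∀ i j, ⟪e i, e j⟫_ℂ = ⟪f i, f j⟫_ℂ) (i : ι) : isometryOfGram e f he hef (e i) = f i := by
  have hd : DenseRange (Finsupp.linearCombination ℂ e) := by
    rwa [DenseRange, ← LinearMap.coe_range, Finsupp.range_linearCombination]
  have h := LinearMap.extendOfNorm_eq (f := Finsupp.linearCombination ℂ f) hd
    ⟨1, fun c => by rw [norm_linearCombination_eq_of_gram hef, one_mul]⟩ (Finsupp.single i 1)
  simp only [Finsupp.linearCombination_single, one_smul] at h
  exact h

end IsometryOfGram

section Intertwining

variable {A H K : Type*} [NonUnitalCStarAlgebra A]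
  [NormedAddCommGroup H] [InnerProductSpace ℂ H] [NormedAddCommGroup K] [InnerProductSpace ℂ K]

theorem opNorm_le_of_isometry_intertwining (U : H →ₗᵢ[ℂ] K) {S : H →L[ℂ] H} {T : K →L[ℂ] K}
    (h : ∀ x, U (S x) = T (U x)) : ‖S‖ ≤ ‖T‖ :=
  S.opNorm_le_bound (norm_nonneg _) fun x => by
    rw [← U.norm_map, h, ← U.norm_map x]
    exact T.le_opNorm _

theorem opNorm_le_of_denseRange_isometry_intertwining {U : H →ₗᵢ[ℂ] K} (hU : DenseRange U)
    {S : H →L[ℂ] H} {T : K →L[ℂ] K} (h : ∀ x, U (S x) = T (U x)) : ‖T‖ ≤ ‖S‖ :=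
  T.opNorm_le_bound (norm_nonneg _) fun y => by
    refine hU.induction_on y (isClosed_le (by fun_prop) (by fun_prop)) fun x => ?_
    rw [← h, U.norm_map, U.norm_map]
    exact S.le_opNorm _

variable [CompleteSpace H] [CompleteSpace K]
  {φ : A →⋆ₙₐ[ℂ] (H →L[ℂ] H)} {ψ : A →⋆ₙₐ[ℂ] (K →L[ℂ] K)} {W : H →L[ℂ] K}

/-- `W` intertwines the representations `φ` and `ψ` of `A`: `W φ(a) = ψ(a) W` for all `a`. -/
def Intertwines (W : H →L[ℂ] K) (φ : A →⋆ₙₐ[ℂ] (H →L[ℂ] H)) (ψ : A →⋆ₙₐ[ℂ] (K →L[ℂ] K)) : Prop :=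
  ∀ a h, W (φ a h) = ψ a (W h)

theorem Intertwines.adjoint (hW : Intertwines W φ ψ) : Intertwines W.adjoint ψ φ := by
  intro a k
  refine ext_inner_right ℂ fun h => ?_
  rw [ContinuousLinearMap.adjoint_inner_left, ← star_star a, map_star ψ, map_star φ,
    ContinuousLinearMap.star_eq_adjoint, ContinuousLinearMap.star_eq_adjoint,
    ContinuousLinearMap.adjoint_inner_left, ContinuousLinearMap.adjoint_inner_left,
    ContinuousLinearMap.adjoint_inner_left, hW]

end Intertwining

section Nondegenerate

variable {A H : Type*} [NonUnitalCStarAlgebra A]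
  [NormedAddCommGroup H] [InnerProductSpace ℂ H] [CompleteSpace H] {σ : A →⋆ₙₐ[ℂ] (H →L[ℂ] H)}

theorem isNondegenerate_iff : IsNondegenerate σ ↔ ∀ h, (∀ a, σ a h = 0) → h = 0 := by
  rw [IsNondegenerate, Submodule.dense_iff_topologicalClosure_eq_top,
    Submodule.topologicalClosure_eq_top_iff, Submodule.eq_bot_iff]
  refine forall_congr' fun h => imp_congr_left ?_
  rw [← Submodule.span_singleton_le_iff_mem, ← Submodule.isOrtho_iff_le, Submodule.isOrtho_comm,
    Submodule.isOrtho_span]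
  refine ⟨fun hh a => inner_self_eq_zero (𝕜 := ℂ).mp ?_, ?_⟩
  · rw [← star_star a, ← inner_map_left]
    exact hh ⟨_, _, rfl⟩ rfl
  · rintro hh _ ⟨a, k, rfl⟩ _ rfl
    rw [inner_map_left, hh, inner_zero_right]

open Filter Topology in
theorem IsNondegenerate.tendsto_apply [PartialOrder A] [StarOrderedRing A]
    (hσ : IsNondegenerate σ) {l : Filter A} (hl : l.IsIncreasingApproximateUnit) (ξ : H) :
    Tendsto (fun e => σ e ξ) l (𝓝 ξ) := by
  have hspan : ∀ η ∈ Submodule.span ℂ {x : H | ∃ a h, x = σ a h},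
      Tendsto (fun e => σ e η) l (𝓝 η) := by
    intro η hη
    induction hη using Submodule.span_induction with
    | mem x hx =>
      obtain ⟨a, h, rfl⟩ := hx
      have hlim := ((map_continuous σ).tendsto a).comp (hl.tendsto_mul_right a)
      simpa [Function.comp_def] using
        ((ContinuousLinearMap.apply ℂ H h).continuous.tendsto (σ a)).comp hlim
    | zero => simpa using tendsto_const_nhds
    | add x y _ _ hx hy => simpa using hx.add hy
    | smul c x _ hx => simpa using hx.const_smul c
  refine Metric.tendsto_nhds.mpr fun ε hε => ?_
  obtain ⟨η, hη, hξη⟩ := Metric.mem_closure_iff.mp (hσ ξ) (ε / 3) (by positivity)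
  filter_upwards [hl.eventually_norm, Metric.tendsto_nhds.mp (hspan η hη) (ε / 3) (by positivity)]
    with e he heη
  have hcontr : dist (σ e ξ) (σ e η) ≤ dist ξ η := by
    rw [dist_eq_norm, dist_eq_norm, ← map_sub]
    exact (σ e).le_of_opNorm_le_of_le ((NonUnitalStarAlgHom.norm_apply_le σ e).trans he) le_rfl
      |>.trans_eq (one_mul _)
  linarith [dist_triangle4 (σ e ξ) (σ e η) η ξ, dist_comm ξ η]

end Nondegenerate

section InteriorMap

variable {B X H K : Type*} [NonUnitalCStarAlgebra B] [PartialOrder B] [StarOrderedRing B]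
  [NormedAddCommGroup X] [NormedSpace ℂ X] [HilbertModule B X]
  [NormedAddCommGroup H] [InnerProductSpace ℂ H] [CompleteSpace H]
  [NormedAddCommGroup K] [InnerProductSpace ℂ K] [CompleteSpace K]
  {φ : B →⋆ₙₐ[ℂ] (H →L[ℂ] H)} {ψ : B →⋆ₙₐ[ℂ] (K →L[ℂ] K)} {W : H →L[ℂ] K}

/-- The canonical map of the algebraic tensor product `X ⊙ H` into `X ⊗_φ H`. -/
def InteriorTensor.ofAlg (φ : B →⋆ₙₐ[ℂ] (H →L[ℂ] H)) : X ⊗[ℂ] H →ₗ[ℂ] InteriorTensor X φ :=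
  UniformSpace.Completion.toComplₗᵢ.toLinearMap ∘ₗ (PreInteriorTensor.mk φ).toLinearMap

@[simp]
theorem InteriorTensor.ofAlg_tmul (x : X) (h : H) :
    InteriorTensor.ofAlg φ (x ⊗ₜ h) = InteriorTensor.tmul φ x h := rfl

theorem InteriorTensor.denseRange_ofAlg :
    DenseRange (InteriorTensor.ofAlg φ : X ⊗[ℂ] H → InteriorTensor X φ) :=
  UniformSpace.Completion.denseRange_coe (α := PreInteriorTensor X φ)

theorem InteriorTensor.dense_span_tmul :
    Dense (Submodule.span ℂ (Set.range fun p : X × H => InteriorTensor.tmul φ p.1 p.2) :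
      Set (InteriorTensor X φ)) := by
  refine (InteriorTensor.denseRange_ofAlg (φ := φ)).mono ?_
  rw [← LinearMap.coe_range, ← Submodule.map_top, ← TensorProduct.span_tmul_eq_top,
    Submodule.map_span]
  refine Submodule.span_mono ?_
  rintro _ ⟨_, ⟨x, h, rfl⟩, rfl⟩
  exact ⟨(x, h), rfl⟩

theorem InteriorTensor.ext_inner {u v : InteriorTensor X φ}
    (huv : ∀ x h, ⟪u, InteriorTensor.tmul φ x h⟫_ℂ = ⟪v, InteriorTensor.tmul φ x h⟫_ℂ) : u = v :=
  ext_inner_right ℂ (DFunLike.congr_fun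
    (InteriorTensor.ext_clm φ (f := innerSL ℂ u) (g := innerSL ℂ v) huv))

theorem InteriorTensor.norm_sq_sum_tmul {n : ℕ} {x : Fin n → X}
    {D : Fin n → Fin n → B} (hD : ∀ i j, HilbertModule.inner (x i) (x j)
      = ∑ k, star (D k i) * D k j) (h : Fin n → H) :
    ‖∑ i, InteriorTensor.tmul φ (x i) (h i)‖ ^ 2 = ∑ k, ‖∑ i, φ (D k i) (h i)‖ ^ 2 := by
  have hinner : ⟪∑ i, InteriorTensor.tmul φ (x i) (h i),
      ∑ i, InteriorTensor.tmul φ (x i) (h i)⟫_ℂ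
      = ∑ k, ⟪∑ i, φ (D k i) (h i), ∑ i, φ (D k i) (h i)⟫_ℂ := by
    simp only [InteriorTensor.inner_tmul, hD, sum_inner, inner_sum, map_sum, sum_apply,
      inner_map_star_mul]
    rw [Finset.sum_comm_cycle]
  simp only [inner_self_eq_norm_sq_to_K] at hinner
  exact_mod_cast hinner

theorem norm_ofAlg_lTensor_le (hW : Intertwines W φ ψ) (z : X ⊗[ℂ] H) :
    ‖InteriorTensor.ofAlg ψ (W.toLinearMap.lTensor X z)‖ ≤ ‖W‖ * ‖InteriorTensor.ofAlg φ z‖ := by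
  obtain ⟨n, x, h, rfl⟩ := exists_fin_sum z
  obtain ⟨D, hD⟩ := HilbertModule.exists_gram (A := B) x
  simp only [map_sum, LinearMap.lTensor_tmul, InteriorTensor.ofAlg_tmul,
    ContinuousLinearMap.coe_coe]
  refine (sq_le_sq₀ (norm_nonneg _) (by positivity)).mp ?_
  rw [mul_pow, InteriorTensor.norm_sq_sum_tmul hD, InteriorTensor.norm_sq_sum_tmul hD,
    Finset.mul_sum]
  refine Finset.sum_le_sum fun k _ => ?_
  simp only [← hW _ _, ← map_sum, ← mul_pow]
  gcongr
  exact W.le_opNorm _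

/-- The operator `1 ⊗ W : X ⊗_φ H → X ⊗_ψ K`. It is defined for every bounded `W`, but is
meaningful only if `W` intertwines `φ` and `ψ`. -/
def interiorMap (X : Type*) [NormedAddCommGroup X] [NormedSpace ℂ X] [HilbertModule B X]
    (W : H →L[ℂ] K) (φ : B →⋆ₙₐ[ℂ] (H →L[ℂ] H)) (ψ : B →⋆ₙₐ[ℂ] (K →L[ℂ] K)) :
    InteriorTensor X φ →L[ℂ] InteriorTensor X ψ :=
  (InteriorTensor.ofAlg ψ ∘ₗ W.toLinearMap.lTensor X).extendOfNorm (InteriorTensor.ofAlg φ)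

theorem interiorMap_tmul (hW : Intertwines W φ ψ) (x : X) (h : H) :
    interiorMap X W φ ψ (InteriorTensor.tmul φ x h) = InteriorTensor.tmul ψ x (W h) :=
  LinearMap.extendOfNorm_eq InteriorTensor.denseRange_ofAlg ⟨_, norm_ofAlg_lTensor_le hW⟩ (x ⊗ₜ h)

theorem norm_interiorMap_le (hW : Intertwines W φ ψ) : ‖interiorMap X W φ ψ‖ ≤ ‖W‖ :=
  LinearMap.opNorm_extendOfNorm_le InteriorTensor.denseRange_ofAlg (norm_nonneg _)
    (norm_ofAlg_lTensor_le hW)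

theorem adjoint_interiorMap (hW : Intertwines W φ ψ) :
    (interiorMap X W φ ψ).adjoint = interiorMap X W.adjoint ψ φ := by
  refine InteriorTensor.ext_clm ψ fun x k => ?_
  refine InteriorTensor.ext_inner fun y h => ?_
  rw [ContinuousLinearMap.adjoint_inner_left, interiorMap_tmul hW, interiorMap_tmul hW.adjoint,
    InteriorTensor.inner_tmul, InteriorTensor.inner_tmul, ContinuousLinearMap.adjoint_inner_left,
    hW]

end InteriorMap

section VectorState

open Filter Topology

variable {A H : Type*} [NonUnitalCStarAlgebra A] [PartialOrder A] [StarOrderedRing A]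
  [NormedAddCommGroup H] [InnerProductSpace ℂ H] [CompleteSpace H]
  {σ : A →⋆ₙₐ[ℂ] (H →L[ℂ] H)} {ξ : H}

/-- The positive functional `a ↦ ⟨ξ, σ(a) ξ⟩`. -/
def vectorFunctional (σ : A →⋆ₙₐ[ℂ] (H →L[ℂ] H)) (ξ : H) : A →ₚ[ℂ] ℂ :=
  PositiveLinearMap.mk₀
    { toFun a := ⟪ξ, σ a ξ⟫_ℂ
      map_add' a b := by simp
      map_smul' c a := by simp }
    fun a ha => by
      obtain ⟨b, rfl⟩ := CStarAlgebra.nonneg_iff_eq_star_mul_self.mp ha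
      change 0 ≤ ⟪ξ, σ (star b * b) ξ⟫_ℂ
      rw [inner_map_star_mul, inner_self_eq_norm_sq_to_K]
      exact pow_nonneg (Complex.zero_le_real.mpr (norm_nonneg (σ b ξ))) 2

theorem IsNondegenerate.mem_closure_range (hσ : IsNondegenerate σ) (ξ : H) :
    ξ ∈ closure (Set.range fun a => σ a ξ) :=
  have hl := CStarAlgebra.increasingApproximateUnit A
  have := hl.neBot
  mem_closure_of_tendsto (hσ.tendsto_apply hl ξ) (.of_forall Set.mem_range_self)

theorem isLUB_norm_vectorFunctional (hσ : IsNondegenerate σ) (hξ : ‖ξ‖ = 1) :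
    IsLUB {r : ℝ | ∃ b : A, ‖b‖ ≤ 1 ∧ r = ‖vectorFunctional σ ξ b‖} 1 := by
  have hl := CStarAlgebra.increasingApproximateUnit A
  have := hl.neBot
  refine ⟨?_, fun c hc => ?_⟩
  · rintro _ ⟨b, hb, rfl⟩
    calc ‖⟪ξ, σ b ξ⟫_ℂ‖ ≤ ‖ξ‖ * ‖σ b ξ‖ := norm_inner_le_norm _ _
      _ ≤ 1 * (‖b‖ * 1) := by
        grw [(σ b).le_of_opNorm_le (NonUnitalStarAlgHom.norm_apply_le σ b) ξ, hξ]
      _ ≤ 1 := by rwa [one_mul, mul_one]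
  · have hlim : Tendsto (fun e => ‖vectorFunctional σ ξ e‖) (CStarAlgebra.approximateUnit A)
        (𝓝 1) := by
      have hinner := ((tendsto_const_nhds (x := ξ)).inner (𝕜 := ℂ) (hσ.tendsto_apply hl ξ)).norm
      rwa [inner_self_eq_norm_sq_to_K, hξ, RCLike.ofReal_one, one_pow, norm_one] at hinner
    exact le_of_tendsto hlim (hl.eventually_norm.mono fun e he => hc ⟨e, he, rfl⟩)

/-- The state `a ↦ ⟨ξ, σ(a) ξ⟩` defined by a unit vector of a nondegenerate representation. -/
def vectorState (hσ : IsNondegenerate σ) (hξ : ‖ξ‖ = 1) : State A :=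
  ⟨vectorFunctional σ ξ, isLUB_norm_vectorFunctional hσ hξ⟩

end VectorState

section GNS

variable {A H : Type*} [NonUnitalCStarAlgebra A] [PartialOrder A] [StarOrderedRing A]
  [NormedAddCommGroup H] [InnerProductSpace ℂ H] [CompleteSpace H]
  {σ : A →⋆ₙₐ[ℂ] (H →L[ℂ] H)} {ξ : H}

theorem dense_span_toPreGNS (f : A →ₚ[ℂ] ℂ) :
    Dense (Submodule.span ℂ (Set.range fun a => (f.toPreGNS a : f.GNS)) : Set f.GNS) :=
  (UniformSpace.Completion.denseRange_coe (α := f.PreGNS)).mono <| by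
    rintro _ ⟨z, rfl⟩
    exact Submodule.subset_span ⟨f.ofPreGNS z, rfl⟩

theorem gnsNonUnitalStarAlgHom_toPreGNS (f : A →ₚ[ℂ] ℂ) (a b : A) :
    f.gnsNonUnitalStarAlgHom a (f.toPreGNS b : f.GNS) = (f.toPreGNS (a * b) : f.GNS) := by
  rw [PositiveLinearMap.gnsNonUnitalStarAlgHom_apply_coe]
  rfl

theorem gns_isNondegenerate (f : A →ₚ[ℂ] ℂ) : IsNondegenerate f.gnsNonUnitalStarAlgHom := by
  refine isNondegenerate_iff.mpr fun h hh => ?_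
  let ℓ : A →ₗ[ℂ] ℂ := (innerSL ℂ h).toLinearMap ∘ₗ
    (UniformSpace.Completion.toComplₗᵢ (𝕜 := ℂ) (E := f.PreGNS)).toLinearMap ∘ₗ
    f.toPreGNS.toLinearMap
  have hℓ : ℓ = 0 := by
    refine LinearMap.ext_on CStarAlgebra.span_nonneg fun a ha => ?_
    obtain ⟨b, rfl⟩ := CStarAlgebra.nonneg_iff_eq_star_mul_self.mp ha
    change ⟪h, (f.toPreGNS (star b * b) : f.GNS)⟫_ℂ = 0
    rw [← gnsNonUnitalStarAlgHom_toPreGNS, ← inner_map_left, hh, inner_zero_left]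
  have hinner : innerSL ℂ h = 0 := by
    refine ContinuousLinearMap.ext_on (dense_span_toPreGNS f) ?_
    rintro _ ⟨a, rfl⟩
    exact LinearMap.congr_fun hℓ a
  exact inner_self_eq_zero (𝕜 := ℂ).mp (DFunLike.congr_fun hinner h)

/-- The isometry `[a] ↦ σ(a) ξ` of the GNS space of `a ↦ ⟨ξ, σ(a) ξ⟩` into the space of `σ`. -/
def gnsIsometry (σ : A →⋆ₙₐ[ℂ] (H →L[ℂ] H)) (ξ : H) : (vectorFunctional σ ξ).GNS →ₗᵢ[ℂ] H :=
  isometryOfGram (fun a => ((vectorFunctional σ ξ).toPreGNS a : (vectorFunctional σ ξ).GNS))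
    (fun a => σ a ξ) (dense_span_toPreGNS _) fun a b => by
      rw [UniformSpace.Completion.inner_coe, PositiveLinearMap.preGNS_inner_def]
      exact inner_map_star_mul σ a b ξ ξ

theorem gnsIsometry_toPreGNS (a : A) :
    gnsIsometry σ ξ ((vectorFunctional σ ξ).toPreGNS a : (vectorFunctional σ ξ).GNS) = σ a ξ :=
  isometryOfGram_apply _ _ a

theorem intertwines_gnsIsometry : Intertwines (gnsIsometry σ ξ).toContinuousLinearMap
    (vectorFunctional σ ξ).gnsNonUnitalStarAlgHom σ := by
  intro a
  refine DFunLike.congr_fun (ContinuousLinearMap.ext_on (dense_span_toPreGNS _)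
    (f := _ ∘L (vectorFunctional σ ξ).gnsNonUnitalStarAlgHom a) (g := σ a ∘L _) ?_)
  rintro _ ⟨b, rfl⟩
  simp only [ContinuousLinearMap.comp_apply, LinearIsometry.coe_toContinuousLinearMap,
    gnsNonUnitalStarAlgHom_toPreGNS, gnsIsometry_toPreGNS, map_mul, mul_apply_eq_comp]

theorem IsNondegenerate.mem_range_gnsIsometry (hσ : IsNondegenerate σ) (ξ : H) :
    ξ ∈ Set.range (gnsIsometry σ ξ) := by
  refine closure_minimal ?_ (gnsIsometry σ ξ).isometry.isClosedEmbedding.isClosed_range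
    (hσ.mem_closure_range ξ)
  rintro _ ⟨a, rfl⟩
  exact ⟨_, gnsIsometry_toPreGNS a⟩

end GNS

section Universal

variable {A H : Type u} [NonUnitalCStarAlgebra A] [PartialOrder A] [StarOrderedRing A]
  [NormedAddCommGroup H] [InnerProductSpace ℂ H] [CompleteSpace H]

theorem universalRep_apply (a : A) (h : UniversalSpace A) (f : State A) :
    universalRep A a h f = f.1.gnsNonUnitalStarAlgHom a (h f) := rfl

theorem universalRep_isNondegenerate : IsNondegenerate (universalRep A) := by
  refine isNondegenerate_iff.mpr fun h hh => ?_
  ext f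
  refine isNondegenerate_iff.mp (gns_isNondegenerate f.1) (h f) fun a => ?_
  rw [← universalRep_apply, hh]
  rfl

theorem exists_universalRep_intertwines {σ : A →⋆ₙₐ[ℂ] (H →L[ℂ] H)} (hσ : IsNondegenerate σ)
    {ξ : H} (hξ : ‖ξ‖ = 1) :
    ∃ (W : UniversalSpace A →L[ℂ] H) (η : UniversalSpace A),
      ‖W‖ ≤ 1 ∧ Intertwines W (universalRep A) σ ∧ W η = ξ ∧ ‖η‖ = 1 := by
  classical
  let f : State A := vectorState hσ hξ
  let V : f.1.GNS →ₗᵢ[ℂ] H := gnsIsometry σ ξ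
  obtain ⟨η, hη⟩ : ξ ∈ Set.range V := hσ.mem_range_gnsIsometry ξ
  refine ⟨V.toContinuousLinearMap ∘L lp.evalCLM ℂ (fun f : State A => f.1.GNS) 2 f,
    lp.single 2 f η, ?_, fun a h => intertwines_gnsIsometry a (h f), ?_, ?_⟩
  · refine ContinuousLinearMap.opNorm_le_bound _ zero_le_one fun h => ?_
    rw [ContinuousLinearMap.comp_apply, LinearIsometry.coe_toContinuousLinearMap, V.norm_map,
      one_mul]
    exact lp.norm_apply_le_norm two_ne_zero h f
  · rw [← hη]
    exact congrArg V (lp.single_apply_self (E := fun f : State A => f.1.GNS) 2 f η)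
  · rw [lp.norm_single two_pos, ← V.norm_map, hη, hξ]

end Universal

section MaxTensorReps

variable {A B H : Type u} [NonUnitalCStarAlgebra A] [NonUnitalCStarAlgebra B]
  [NormedAddCommGroup H] [InnerProductSpace ℂ H] [CompleteSpace H]
  {σA : A →⋆ₙₐ[ℂ] (H →L[ℂ] H)} {σB : B →⋆ₙₐ[ℂ] (H →L[ℂ] H)}

/-- The canonical map of the algebraic tensor product `A ⊙ B` into `A ⊗_max B`. -/
def MaxTensor.incl (A B : Type u) [NonUnitalCStarAlgebra A] [NonUnitalCStarAlgebra B] :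
    (A ⊗[ℂ] B) →ₗ[ℂ] MaxTensor A B :=
  (MaxTensor.ofAlg A B).toLinearMap ∘ₗ (PreMaxTensor.mk A B).toLinearMap

theorem MaxTensor.denseRange_incl : DenseRange (MaxTensor.incl A B) :=
  MaxTensor.denseRange_ofAlg (A := A) (B := B)

theorem MaxTensor.map_incl_of_tmul {σ : MaxTensor A B →⋆ₙₐ[ℂ] (H →L[ℂ] H)}
    (h : ∀ a b, σ (MaxTensor.tmul a b) = σA a * σB b) (t : A ⊗[ℂ] B) :
    σ (MaxTensor.incl A B t) = pairMap σA σB t :=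
  LinearMap.congr_fun (f := (σ : MaxTensor A B →ₗ[ℂ] (H →L[ℂ] H)) ∘ₗ MaxTensor.incl A B)
    (g := pairMap σA σB) (TensorProduct.ext' h) t

theorem MaxTensor.lift_incl (hc : ∀ a b, Commute (σA a) (σB b)) (t : A ⊗[ℂ] B) :
    MaxTensor.lift σA σB hc (MaxTensor.incl A B t) = pairMap σA σB t :=
  MaxTensor.map_incl_of_tmul (MaxTensor.lift_tmul σA σB hc) t

open scoped CStarAlgebra in
theorem MaxTensor.norm_map_le_of_incl {D E : Type*} [NonUnitalCStarAlgebra D]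
    [NonUnitalCStarAlgebra E] {σ : MaxTensor A B →⋆ₙₐ[ℂ] D} {τ : MaxTensor A B →⋆ₙₐ[ℂ] E}
    (h : ∀ t, ‖σ (MaxTensor.incl A B t)‖ ≤ ‖τ (MaxTensor.incl A B t)‖) (z : MaxTensor A B) :
    ‖σ z‖ ≤ ‖τ z‖ :=
  MaxTensor.denseRange_incl.induction_on z
    (isClosed_le (map_continuous σ).norm (map_continuous τ).norm) h

open scoped CStarAlgebra in
theorem IsNondegenerate.of_maxTensor {σ : MaxTensor A B →⋆ₙₐ[ℂ] (H →L[ℂ] H)}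
    (hσ : IsNondegenerate σ) (hc : ∀ a b, Commute (σA a) (σB b))
    (h : ∀ a b, σ (MaxTensor.tmul a b) = σA a * σB b) : IsNondegenerate σA := by
  rw [isNondegenerate_iff] at hσ ⊢
  intro x hx
  refine hσ x fun z => MaxTensor.denseRange_incl.induction_on z
    (isClosed_eq ((map_continuous σ).clm_apply continuous_const) continuous_const) fun t => ?_
  rw [MaxTensor.map_incl_of_tmul h]
  induction t using TensorProduct.induction_on with
  | zero => simp
  | add s t hs ht => rw [map_add, add_apply, hs, ht, add_zero]
  | tmul a b => rw [pairMap_tmul, (hc a b).eq, mul_apply_eq_comp, hx, map_zero]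

end MaxTensorReps

section PairMap

variable {A B C H K : Type*} [NonUnitalCStarAlgebra A] [NonUnitalCStarAlgebra B]
  [NonUnitalCStarAlgebra C] [NormedAddCommGroup H] [InnerProductSpace ℂ H] [CompleteSpace H]
  [NormedAddCommGroup K] [InnerProductSpace ℂ K] [CompleteSpace K]
  {σA : A →⋆ₙₐ[ℂ] (H →L[ℂ] H)} {σB : B →⋆ₙₐ[ℂ] (H →L[ℂ] H)}
  {τA : A →⋆ₙₐ[ℂ] (K →L[ℂ] K)} {τB : B →⋆ₙₐ[ℂ] (K →L[ℂ] K)}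

theorem pairMap_intertwine {U : H →L[ℂ] K}
    (hU : ∀ a b, U ∘L (σA a * σB b) = (τA a * τB b) ∘L U) (t : A ⊗[ℂ] B) (x : H) :
    U (pairMap σA σB t x) = pairMap τA τB t (U x) := by
  induction t using TensorProduct.induction_on with
  | zero => simp
  | add s t hs ht => simp only [map_add, add_apply, hs, ht]
  | tmul a b => exact DFunLike.congr_fun (hU a b) x

theorem pairMap_lTensor_eq_comp {σC : C →⋆ₙₐ[ℂ] (H →L[ℂ] H)} {Ψ : B →ₗ[ℂ] C} {V : H →L[ℂ] K}
    {V' : K →L[ℂ] H} (hV : ∀ a b, σA a * σC (Ψ b) = V' ∘L (τA a * τB b) ∘L V) (t : A ⊗[ℂ] B) :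
    pairMap σA σC (Ψ.lTensor A t) = V' ∘L pairMap τA τB t ∘L V := by
  induction t using TensorProduct.induction_on with
  | zero => simp
  | add s t hs ht =>
    simp only [map_add, hs, ht, ContinuousLinearMap.add_comp, ContinuousLinearMap.comp_add]
  | tmul a b => exact hV a b

end PairMap

section Compress

variable {B X : Type*} {A H K : Type u} [NonUnitalCStarAlgebra A] [NonUnitalCStarAlgebra B]
  [NormedAddCommGroup H] [InnerProductSpace ℂ H] [CompleteSpace H]
  [NormedAddCommGroup K] [InnerProductSpace ℂ K] [CompleteSpace K]
  {φ : A →⋆ₙₐ[ℂ] (H →L[ℂ] H)} {σA : A →⋆ₙₐ[ℂ] (K →L[ℂ] K)} {σB : B →⋆ₙₐ[ℂ] (K →L[ℂ] K)}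
  {W : H →L[ℂ] K}

theorem mem_commutant_iff {y : H →L[ℂ] H} : y ∈ commutant φ ↔ ∀ a, Commute (φ a) y := by
  refine (StarSubalgebra.mem_centralizer_iff ℂ).trans ⟨fun h a => (h _ ⟨a, rfl⟩).1, ?_⟩
  rintro h _ ⟨a, rfl⟩
  exact ⟨h a, by rw [← map_star]; exact h (star a)⟩

theorem IsNondegenerate.lift_commutantIncl (hφ : IsNondegenerate φ) :
    IsNondegenerate (MaxTensor.lift φ (commutantIncl φ) (commute_commutantIncl φ)) := by
  rw [isNondegenerate_iff] at hφ ⊢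
  refine fun x hx => hφ x fun a => ?_
  have hxa := hx (MaxTensor.tmul a 1)
  rw [MaxTensor.lift_tmul] at hxa
  exact hxa

theorem map_mul_compression (hW : Intertwines W φ σA) (a : A) (b : B) :
    φ a * (W.adjoint ∘L σB b ∘L W) = W.adjoint ∘L (σA a * σB b) ∘L W := by
  ext h
  exact (hW.adjoint a _).symm

theorem compression_mem_commutant (hc : ∀ a b, Commute (σA a) (σB b)) (hW : Intertwines W φ σA)
    (b : B) : W.adjoint ∘L σB b ∘L W ∈ commutant φ := by
  refine mem_commutant_iff.mpr fun a => ?_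
  rw [Commute, SemiconjBy, map_mul_compression hW, (hc a b).eq]
  ext h
  exact congrArg (fun k => W.adjoint (σB b k)) (hW a h).symm

/-- The compression `b ↦ W* σ_B(b) W` along an intertwiner `W` of `φ` and `σ_A`, as a map into the
commutant of `φ`. -/
def compress (hc : ∀ a b, Commute (σA a) (σB b)) (hW : Intertwines W φ σA) :
    B →ₗ[ℂ] commutant φ where
  toFun b := ⟨W.adjoint ∘L σB b ∘L W, compression_mem_commutant hc hW b⟩
  map_add' b c := Subtype.ext <| by ext h; simp
  map_smul' c b := Subtype.ext <| by ext h; simp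

@[simp]
theorem commutantIncl_compress (hc : ∀ a b, Commute (σA a) (σB b)) (hW : Intertwines W φ σA)
    (b : B) : commutantIncl φ (compress hc hW b) = W.adjoint ∘L σB b ∘L W := rfl

theorem pairMap_compress (hc : ∀ a b, Commute (σA a) (σB b)) (hW : Intertwines W φ σA)
    (t : A ⊗[ℂ] B) :
    pairMap φ (commutantIncl φ) ((compress hc hW).lTensor A t)
      = W.adjoint ∘L pairMap σA σB t ∘L W :=
  pairMap_lTensor_eq_comp (map_mul_compression hW) t

theorem pairMap_leftRep_compress [PartialOrder A] [StarOrderedRing A] [NormedAddCommGroup X]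
    [NormedSpace ℂ X] [HilbertModule A X] (π : LeftAction A A X)
    (hc : ∀ a b, Commute (σA a) (σB b)) (hW : Intertwines W φ σA) (t : A ⊗[ℂ] B) :
    pairMap (leftRep π φ) (rightRep X φ (commutantIncl φ) (commute_commutantIncl φ))
        ((compress hc hW).lTensor A t)
      = (interiorMap X W φ σA).adjoint ∘L pairMap (leftRep π σA) (rightRep X σA σB hc) t ∘L
        interiorMap X W φ σA := by
  refine pairMap_lTensor_eq_comp (fun a b => InteriorTensor.ext_clm φ fun x h => ?_) t
  simp only [adjoint_interiorMap hW, ContinuousLinearMap.comp_apply, mul_apply_eq_comp,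
    rightRep_tmul, leftRep_tmul, interiorMap_tmul hW, interiorMap_tmul hW.adjoint,
    commutantIncl_compress]

end Compress

section Identity

variable {A C H : Type*} [NonUnitalCStarAlgebra A] [PartialOrder A] [StarOrderedRing A]
  [NonUnitalCStarAlgebra C] [NormedAddCommGroup H] [InnerProductSpace ℂ H] [CompleteSpace H]
  {φ : A →⋆ₙₐ[ℂ] (H →L[ℂ] H)} {ρ : C →⋆ₙₐ[ℂ] (H →L[ℂ] H)}

/-- The isometry `A ⊗_φ H → H`, `a ⊗ h ↦ φ(a) h`. -/
def identityIsometry (φ : A →⋆ₙₐ[ℂ] (H →L[ℂ] H)) : InteriorTensor A φ →ₗᵢ[ℂ] H :=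
  isometryOfGram (fun p : A × H => InteriorTensor.tmul φ p.1 p.2) (fun p => φ p.1 p.2)
    InteriorTensor.dense_span_tmul fun _ _ =>
      (InteriorTensor.inner_tmul φ _ _ _ _).trans (inner_map_star_mul φ _ _ _ _)

@[simp]
theorem identityIsometry_tmul (a : A) (h : H) :
    identityIsometry φ (InteriorTensor.tmul φ a h) = φ a h :=
  isometryOfGram_apply (e := fun p : A × H => InteriorTensor.tmul φ p.1 p.2) _ _ (a, h)

theorem IsNondegenerate.denseRange_identityIsometry (hφ : IsNondegenerate φ) :
    DenseRange (identityIsometry φ) := by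
  refine hφ.mono (?_ : _ ≤ LinearMap.range (identityIsometry φ).toLinearMap)
  refine Submodule.span_le.mpr ?_
  rintro _ ⟨a, h, rfl⟩
  exact ⟨_, identityIsometry_tmul a h⟩

theorem identityIsometry_pairMap (hc : ∀ a c, Commute (φ a) (ρ c)) (t : A ⊗[ℂ] C)
    (x : InteriorTensor A φ) :
    identityIsometry φ (pairMap (leftRep (identityCorr A) φ) (rightRep A φ ρ hc) t x)
      = pairMap φ ρ t (identityIsometry φ x) := by
  refine pairMap_intertwine (U := (identityIsometry φ).toContinuousLinearMap) (fun a c => ?_) t x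
  refine InteriorTensor.ext_clm φ fun b h => ?_
  simp only [ContinuousLinearMap.comp_apply, mul_apply_eq_comp, rightRep_tmul, leftRep_tmul,
    LinearIsometry.coe_toContinuousLinearMap, identityIsometry_tmul]
  rw [← mul_apply_eq_comp (ρ c), ← (hc b c).eq]
  exact DFunLike.congr_fun (map_mul φ a b) (ρ c h)

end Identity

section Factorization

variable {A X : Type u} [NonUnitalCStarAlgebra A] [PartialOrder A] [StarOrderedRing A]
  [NormedAddCommGroup X] [NormedSpace ℂ X] [HilbertModule A X] {π : LeftAction A A X}
  {C H : Type u} [NonUnitalCStarAlgebra C] [NormedAddCommGroup H] [InnerProductSpace ℂ H]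
  [CompleteSpace H] {φ : A →⋆ₙₐ[ℂ] (H →L[ℂ] H)} {ρ : C →⋆ₙₐ[ℂ] (H →L[ℂ] H)}

theorem corrRep_incl (hc : ∀ a c, Commute (φ a) (ρ c)) (t : A ⊗[ℂ] C) :
    corrRep π φ ρ hc (MaxTensor.incl A C t) = pairMap (leftRep π φ) (rightRep X φ ρ hc) t :=
  MaxTensor.lift_incl _ t

theorem norm_corrRep_identity_le (hc : ∀ a c, Commute (φ a) (ρ c)) (z : MaxTensor A C) :
    ‖corrRep (identityCorr A) φ ρ hc z‖ ≤ ‖MaxTensor.lift φ ρ hc z‖ := by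
  refine MaxTensor.norm_map_le_of_incl (fun t => ?_) z
  rw [corrRep_incl, MaxTensor.lift_incl]
  exact opNorm_le_of_isometry_intertwining (identityIsometry φ) (identityIsometry_pairMap hc t)

theorem IsNondegenerate.norm_pairMap_le (hφ : IsNondegenerate φ)
    (hc : ∀ a c, Commute (φ a) (ρ c)) (t : A ⊗[ℂ] C) :
    ‖pairMap φ ρ t‖ ≤ ‖corrRep (identityCorr A) φ ρ hc (MaxTensor.incl A C t)‖ := by
  rw [corrRep_incl]
  exact opNorm_le_of_denseRange_isometry_intertwining hφ.denseRange_identityIsometry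
    (identityIsometry_pairMap hc t)

theorem HasUFP.weaklyContained (h : HasUFP π) (hφ : IsNondegenerate φ) :
    WeaklyContained (identityCorr A) π φ := by
  intro z hz
  have hlift : MaxTensor.lift φ (commutantIncl φ) (commute_commutantIncl φ) z = 0 :=
    h (commutant φ) H _ φ (commutantIncl φ) _ hφ.lift_commutantIncl (MaxTensor.lift_tmul _ _ _) z hz
  have hle := norm_corrRep_identity_le (commute_commutantIncl φ) z
  rwa [hlift, norm_zero, norm_le_zero_iff] at hle

section Vector

variable {B K : Type u} [NonUnitalCStarAlgebra B] [NormedAddCommGroup K] [InnerProductSpace ℂ K]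
  [CompleteSpace K] {σA : A →⋆ₙₐ[ℂ] (K →L[ℂ] K)} {σB : B →⋆ₙₐ[ℂ] (K →L[ℂ] K)} {W : H →L[ℂ] K}

theorem norm_corrRep_compress_le (π : LeftAction A A X) (hc : ∀ a b, Commute (σA a) (σB b))
    (hW : Intertwines W φ σA) (hW1 : ‖W‖ ≤ 1) (t : A ⊗[ℂ] B) :
    ‖corrRep π φ (commutantIncl φ) (commute_commutantIncl φ)
        (MaxTensor.incl A _ ((compress hc hW).lTensor A t))‖
      ≤ ‖pairMap (leftRep π σA) (rightRep X σA σB hc) t‖ := by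
  rw [corrRep_incl, pairMap_leftRep_compress]
  set M := interiorMap X W φ σA
  set P := pairMap (leftRep π σA) (rightRep X σA σB hc) t
  have hM : ‖M‖ ≤ 1 := (norm_interiorMap_le hW).trans hW1
  calc ‖M.adjoint ∘L P ∘L M‖ ≤ ‖M.adjoint‖ * (‖P‖ * ‖M‖) :=
        (ContinuousLinearMap.opNorm_comp_le _ _).trans
          (by gcongr; exact ContinuousLinearMap.opNorm_comp_le _ _)
    _ ≤ 1 * (‖P‖ * 1) := by rw [LinearIsometryEquiv.norm_map]; gcongr
    _ = ‖P‖ := by rw [one_mul, mul_one]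

theorem WeaklyContained.norm_inner_le (h : WeaklyContained (identityCorr A) π φ)
    (hφ : IsNondegenerate φ) (hc : ∀ a b, Commute (σA a) (σB b)) (hW : Intertwines W φ σA)
    (hW1 : ‖W‖ ≤ 1) {η : H} (hη : ‖η‖ = 1) (t : A ⊗[ℂ] B) :
    ‖⟪W η, pairMap σA σB t (W η)⟫_ℂ‖ ≤ ‖pairMap (leftRep π σA) (rightRep X σA σB hc) t‖ := by
  set s := (compress hc hW).lTensor A t with hs
  have hinner : ⟪W η, pairMap σA σB t (W η)⟫_ℂ = ⟪η, pairMap φ (commutantIncl φ) s η⟫_ℂ := by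
    rw [hs, pairMap_compress]
    exact (ContinuousLinearMap.adjoint_inner_right W _ _).symm
  calc ‖⟪W η, pairMap σA σB t (W η)⟫_ℂ‖
      = ‖⟪η, pairMap φ (commutantIncl φ) s η⟫_ℂ‖ := by rw [hinner]
    _ ≤ ‖pairMap φ (commutantIncl φ) s‖ := by
        have hle := ContinuousLinearMap.le_opNorm (pairMap φ (commutantIncl φ) s) η
        rw [hη, mul_one] at hle
        simpa only [hη, one_mul] using (norm_inner_le_norm η _).trans
          (mul_le_mul_of_nonneg_left hle (norm_nonneg η))
    _ ≤ ‖corrRep (identityCorr A) φ _ (commute_commutantIncl φ) (MaxTensor.incl A _ s)‖ :=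
        hφ.norm_pairMap_le _ s
    _ ≤ ‖corrRep π φ _ (commute_commutantIncl φ) (MaxTensor.incl A _ s)‖ :=
        norm_map_le_of_ker_le h _
    _ ≤ ‖pairMap (leftRep π σA) (rightRep X σA σB hc) t‖ :=
        norm_corrRep_compress_le π hc hW hW1 t

end Vector

open scoped CStarAlgebra in
theorem WeaklyContainedUniv.norm_map_le (h : WeaklyContainedUniv (identityCorr A) π)
    {σ : MaxTensor A C →⋆ₙₐ[ℂ] (H →L[ℂ] H)} (hc : ∀ a c, Commute (φ a) (ρ c))
    (hnd : IsNondegenerate σ) (hσ : ∀ a c, σ (MaxTensor.tmul a c) = φ a * ρ c)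
    (z : MaxTensor A C) : ‖σ z‖ ≤ ‖corrRep π φ ρ hc z‖ := by
  refine norm_map_le_of_forall_norm_inner_le (fun z ξ hξ => ?_) z
  obtain ⟨W, η, hW1, hW, rfl, hη⟩ := exists_universalRep_intertwines (hnd.of_maxTensor hc hσ) hξ
  refine MaxTensor.denseRange_incl.induction_on z (isClosed_le ?_ ?_) fun t => ?_
  · exact (continuous_const.inner ((map_continuous σ).clm_apply continuous_const)).norm
  · exact (map_continuous (corrRep π φ ρ hc)).norm
  · rw [MaxTensor.map_incl_of_tmul hσ, corrRep_incl]
    exact WeaklyContained.norm_inner_le h universalRep_isNondegenerate hc hW hW1 hη t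

theorem WeaklyContainedUniv.hasUFP (h : WeaklyContainedUniv (identityCorr A) π) : HasUFP π := by
  intro B _ H _ _ _ σ σA σB hc hnd hσ z hz
  have hle := h.norm_map_le hc hnd hσ z
  rwa [hz, norm_zero, norm_le_zero_iff] at hle

theorem hasUFP_iff_weaklyContainedUniv (π : LeftAction A A X) :
    HasUFP π ↔ WeaklyContainedUniv (identityCorr A) π :=
  ⟨fun h => h.weaklyContained universalRep_isNondegenerate, WeaklyContainedUniv.hasUFP⟩

end Factorization

section HilbertTensor

variable {H K : Type*} [NormedAddCommGroup H] [InnerProductSpace ℂ H]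
  [NormedAddCommGroup K] [InnerProductSpace ℂ K]

/-- The Hilbert space tensor product, i.e. the space on which `spatialMap` represents `A ⊙ B`. -/
def HilbertTensor (H K : Type*) [NormedAddCommGroup H] [InnerProductSpace ℂ H]
    [NormedAddCommGroup K] [InnerProductSpace ℂ K] : Type _ :=
  UniformSpace.Completion (H ⊗[ℂ] K)

namespace HilbertTensor

instance : NormedAddCommGroup (HilbertTensor H K) :=
  inferInstanceAs (NormedAddCommGroup (UniformSpace.Completion (H ⊗[ℂ] K)))

instance : InnerProductSpace ℂ (HilbertTensor H K) :=
  inferInstanceAs (InnerProductSpace ℂ (UniformSpace.Completion (H ⊗[ℂ] K)))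

instance : CompleteSpace (HilbertTensor H K) :=
  inferInstanceAs (CompleteSpace (UniformSpace.Completion (H ⊗[ℂ] K)))

/-- The dense inclusion of the algebraic tensor product. -/
def ofAlg : H ⊗[ℂ] K →L[ℂ] HilbertTensor H K :=
  UniformSpace.Completion.toComplL

theorem denseRange_ofAlg : DenseRange (ofAlg : H ⊗[ℂ] K → HilbertTensor H K) :=
  UniformSpace.Completion.denseRange_coe

/-- The elementary tensor `h ⊗ k` in the Hilbert space tensor product, as a bounded linear map in
`k`. -/
def tmul (h : H) : K →L[ℂ] HilbertTensor H K :=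
  ofAlg ∘L TensorProduct.mkL ℂ H K h

theorem ofAlg_tmul (h : H) (k : K) : ofAlg (h ⊗ₜ[ℂ] k) = tmul h k := rfl

theorem inner_tmul (h h' : H) (k k' : K) :
    ⟪tmul h k, tmul h' k'⟫_ℂ = ⟪h, h'⟫_ℂ * ⟪k, k'⟫_ℂ :=
  (UniformSpace.Completion.inner_coe _ _).trans (TensorProduct.inner_tmul ℂ h h' k k')

theorem dense_span_tmul :
    Dense (Submodule.span ℂ (Set.range fun p : H × K => tmul p.1 p.2) :
      Set (HilbertTensor H K)) := by
  refine denseRange_ofAlg.mono ?_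
  rintro _ ⟨z, rfl⟩
  obtain ⟨n, h, k, rfl⟩ := exists_fin_sum z
  rw [map_sum]
  exact Submodule.sum_mem _ fun i _ => Submodule.subset_span ⟨(h i, k i), rfl⟩

theorem ext_clm {F : Type*} [NormedAddCommGroup F] [NormedSpace ℂ F]
    {f g : HilbertTensor H K →L[ℂ] F} (h : ∀ x y, f (tmul x y) = g (tmul x y)) : f = g :=
  ContinuousLinearMap.ext_on dense_span_tmul (by rintro _ ⟨p, rfl⟩; exact h _ _)

theorem add_tmul (h h' : H) (k : K) : tmul (h + h') k = tmul h k + tmul h' k := by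
  simp only [← ofAlg_tmul, TensorProduct.add_tmul, map_add]

theorem smul_tmul (c : ℂ) (h : H) (k : K) : tmul (c • h) k = c • tmul h k := by
  simp only [← ofAlg_tmul, ← TensorProduct.smul_tmul', map_smul]

/-- The operator `S ⊗ R` on the Hilbert space tensor product. -/
def mapL (S : H →L[ℂ] H) (R : K →L[ℂ] K) : HilbertTensor H K →L[ℂ] HilbertTensor H K :=
  ContinuousLinearMap.completion (α := H ⊗[ℂ] K) (β := H ⊗[ℂ] K) (TensorProduct.mapL S R)

theorem mapL_tmul (S : H →L[ℂ] H) (R : K →L[ℂ] K) (h : H) (k : K) :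
    mapL S R (tmul h k) = tmul (S h) (R k) :=
  ContinuousLinearMap.completion_apply_coe _ _

/-- The operator `S ⊗ R`, as a bilinear map. -/
def map : (H →L[ℂ] H) →ₗ[ℂ] (K →L[ℂ] K) →ₗ[ℂ] (HilbertTensor H K →L[ℂ] HilbertTensor H K) :=
  LinearMap.mk₂ ℂ mapL
    (fun _ _ _ => ext_clm fun _ _ => by simp only [mapL_tmul, add_apply, add_tmul])
    (fun _ _ _ => ext_clm fun _ _ => by simp only [mapL_tmul, smul_apply, smul_tmul])
    (fun _ _ _ => ext_clm fun _ _ => by simp only [mapL_tmul, add_apply, map_add])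
    (fun _ _ _ => ext_clm fun _ _ => by simp only [mapL_tmul, smul_apply, map_smul])

theorem map_ofAlg (S : H →L[ℂ] H) (R : K →L[ℂ] K) (x : H ⊗[ℂ] K) :
    map S R (ofAlg x) = ofAlg (TensorProduct.mapL S R x) :=
  ContinuousLinearMap.completion_apply_coe _ _

@[simp]
theorem map_tmul (S : H →L[ℂ] H) (R : K →L[ℂ] K) (h : H) (k : K) :
    map S R (tmul h k) = tmul (S h) (R k) :=
  mapL_tmul S R h k

theorem map_mul_map (S S' : H →L[ℂ] H) (R R' : K →L[ℂ] K) :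
    map S R * map S' R' = map (S * S') (R * R') :=
  ext_clm fun h k => by simp only [mul_apply_eq_comp, map_tmul]

/-- The isometry `h ⊗ k ↦ k ⊗ h` exchanging the factors. -/
def flip : HilbertTensor H K →ₗᵢ[ℂ] HilbertTensor K H :=
  isometryOfGram (fun p : H × K => tmul p.1 p.2) (fun p => tmul p.2 p.1)
    dense_span_tmul fun _ _ => by rw [inner_tmul, inner_tmul, mul_comm]

theorem flip_tmul (h : H) (k : K) : flip (tmul h k) = tmul k h :=
  isometryOfGram_apply (e := fun p : H × K => tmul p.1 p.2) _ _ (h, k)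

variable [CompleteSpace H] [CompleteSpace K]

theorem star_map (S : H →L[ℂ] H) (R : K →L[ℂ] K) : star (map S R) = map (star S) (star R) := by
  refine ((ContinuousLinearMap.eq_adjoint_iff _ _).mpr fun x y => ?_).symm
  induction x, y using denseRange_ofAlg.induction_on₂ with
  | hp => apply isClosed_eq <;> fun_prop
  | h x y =>
    obtain ⟨m, h, k, rfl⟩ := exists_fin_sum x
    obtain ⟨n, h', k', rfl⟩ := exists_fin_sum y
    simp only [map_sum, ofAlg_tmul, map_tmul, sum_inner, inner_sum, inner_tmul,
      ContinuousLinearMap.star_eq_adjoint, ContinuousLinearMap.adjoint_inner_left]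

/-- The amplification `S ↦ S ⊗ 1`. -/
def ampLeft : (H →L[ℂ] H) →⋆ₙₐ[ℂ] (HilbertTensor H K →L[ℂ] HilbertTensor H K) where
  toFun S := map S 1
  map_smul' c S := by rw [map_smul]; rfl
  map_zero' := by rw [map_zero]; rfl
  map_add' S T := by rw [map_add]; rfl
  map_mul' S T := by rw [map_mul_map, one_mul]
  map_star' S := by rw [star_map, star_one]

/-- The amplification `R ↦ 1 ⊗ R`. -/
def ampRight : (K →L[ℂ] K) →⋆ₙₐ[ℂ] (HilbertTensor H K →L[ℂ] HilbertTensor H K) where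
  toFun R := map 1 R
  map_smul' c R := by rw [map_smul]; rfl
  map_zero' := by rw [map_zero]
  map_add' S T := by rw [map_add]
  map_mul' S T := by rw [map_mul_map, one_mul]
  map_star' S := by rw [star_map, star_one]

theorem ampRight_apply (R : K →L[ℂ] K) : ampRight (H := H) R = map 1 R := rfl

theorem ampLeft_mul_ampRight (S : H →L[ℂ] H) (R : K →L[ℂ] K) :
    ampLeft S * ampRight R = map S R := by
  refine (map_mul_map S 1 1 R).trans ?_
  rw [mul_one, one_mul]

theorem commute_ampLeft_ampRight (S : H →L[ℂ] H) (R : K →L[ℂ] K) :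
    Commute (ampLeft (K := K) S) (ampRight R) := by
  refine (ampLeft_mul_ampRight S R).trans ((map_mul_map 1 S R 1).trans ?_).symm
  rw [mul_one, one_mul]

end HilbertTensor

end HilbertTensor

section RankOne

open HilbertTensor InnerProductSpace

variable {H K ι : Type*} [NormedAddCommGroup H] [InnerProductSpace ℂ H]
  [NormedAddCommGroup K] [InnerProductSpace ℂ K] {e : ι → K}

theorem rankOne_mul_rankOne [DecidableEq ι] (he : Orthonormal ℂ e) (i j k l : ι) :
    rankOne ℂ (e i) (e j) * rankOne ℂ (e k) (e l)
      = if j = k then rankOne ℂ (e i) (e l) else 0 := by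
  rw [ContinuousLinearMap.mul_def, rankOne_comp_rankOne, orthonormal_iff_ite.mp he]
  split_ifs <;> simp only [one_smul, zero_smul]

variable [Fintype ι]

theorem sum_rankOne_mul_mul_sum_rankOne (R : K →L[ℂ] K) :
    (∑ i, rankOne ℂ (e i) (e i)) * R * ∑ i, rankOne ℂ (e i) (e i)
      = ∑ i, ∑ j, ⟪e i, R (e j)⟫_ℂ • rankOne ℂ (e i) (e j) := by
  simp only [Finset.sum_mul, Finset.mul_sum]
  rw [Finset.sum_comm]
  refine Finset.sum_congr rfl fun i _ => Finset.sum_congr rfl fun j _ => ?_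
  ext k
  simp only [mul_apply_eq_comp, rankOne_apply, map_smul, smul_apply, smul_smul]
  rw [mul_comm]

theorem sum_map_rankOne_mul (he : Orthonormal ℂ e) (S T : ι → ι → H →L[ℂ] H) :
    (∑ i, ∑ j, map (S i j) (rankOne ℂ (e i) (e j)))
        * ∑ k, ∑ l, map (T k l) (rankOne ℂ (e k) (e l))
      = ∑ i, ∑ l, map (∑ j, S i j * T j l) (rankOne ℂ (e i) (e l)) := by
  classical
  have hmul (i j : ι) : map (S i j) (rankOne ℂ (e i) (e j))
        * ∑ k, ∑ l, map (T k l) (rankOne ℂ (e k) (e l))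
      = ∑ l, map (S i j * T j l) (rankOne ℂ (e i) (e l)) := by
    simp only [Finset.mul_sum, map_mul_map, rankOne_mul_rankOne he]
    refine (Finset.sum_eq_single j (fun k _ hk => ?_) (by simp)).trans (by simp)
    simp only [if_neg hk.symm, map_zero, Finset.sum_const_zero]
  simp only [Finset.sum_mul, hmul, map_sum, LinearMap.sum_apply]
  exact Finset.sum_congr rfl fun i _ => Finset.sum_comm

end RankOne

section Spatial

open HilbertTensor InnerProductSpace

variable {A B H H' K : Type*} [NonUnitalCStarAlgebra A] [NonUnitalCStarAlgebra B]
  [NormedAddCommGroup H] [InnerProductSpace ℂ H] [CompleteSpace H]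
  [NormedAddCommGroup H'] [InnerProductSpace ℂ H'] [CompleteSpace H']
  [NormedAddCommGroup K] [InnerProductSpace ℂ K] [CompleteSpace K]
  {π : A →⋆ₙₐ[ℂ] (H →L[ℂ] H)} {π' : A →⋆ₙₐ[ℂ] (H' →L[ℂ] H')} {σ : B →⋆ₙₐ[ℂ] (K →L[ℂ] K)}

/-- `spatialMap` with values in the operators on `HilbertTensor H K`. -/
def spatialRep (π : A →⋆ₙₐ[ℂ] (H →L[ℂ] H)) (σ : B →⋆ₙₐ[ℂ] (K →L[ℂ] K)) :
    (A ⊗[ℂ] B) →ₗ[ℂ] (HilbertTensor H K →L[ℂ] HilbertTensor H K) :=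
  spatialMap π σ

@[simp]
theorem spatialRep_tmul (a : A) (b : B) : spatialRep π σ (a ⊗ₜ b) = map (π a) (σ b) := rfl

theorem pairMap_amp (t : A ⊗[ℂ] B) :
    pairMap (ampLeft.comp π) (ampRight.comp σ) t = spatialRep π σ t := by
  refine LinearMap.congr_fun (TensorProduct.ext' fun a b => ?_) t
  exact ampLeft_mul_ampRight (π a) (σ b)

theorem exists_spatialRep_ofAlg_eq (t : A ⊗[ℂ] B) (x : H ⊗[ℂ] K) :
    ∃ y, spatialRep π σ t (ofAlg x) = ofAlg y := by
  induction t using TensorProduct.induction_on with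
  | zero => exact ⟨0, by rw [map_zero, map_zero, zero_apply]⟩
  | add s t hs ht =>
    obtain ⟨y, hy⟩ := hs
    obtain ⟨z, hz⟩ := ht
    exact ⟨y + z, by rw [map_add, add_apply, hy, hz, map_add]⟩
  | tmul a b => exact ⟨_, map_ofAlg (π a) (σ b) x⟩

section Matrix

variable {ι : Type*} {e : ι → K}

/-- The matrix over `A` with entries `(1 ⊗ ⟨e_i, σ(·) e_j⟩)(t)`. -/
def matrixCoeff (A : Type*) [NonUnitalCStarAlgebra A] (σ : B →⋆ₙₐ[ℂ] (K →L[ℂ] K)) (e : ι → K) :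
    (A ⊗[ℂ] B) →ₗ[ℂ] CStarMatrix ι ι A :=
  TensorProduct.lift <| LinearMap.mk₂ ℂ
    (fun a b => CStarMatrix.ofMatrix fun i j => ⟪e i, σ b (e j)⟫_ℂ • a)
    (fun _ _ _ => by ext; exact smul_add _ _ _)
    (fun _ _ _ => by ext; exact smul_comm _ _ _)
    (fun a b b' => by
      ext i j
      change ⟪e i, σ (b + b') (e j)⟫_ℂ • a = ⟪e i, σ b (e j)⟫_ℂ • a + ⟪e i, σ b' (e j)⟫_ℂ • a
      rw [map_add, add_apply, inner_add_right, add_smul])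
    (fun c a b => by
      ext i j
      change ⟪e i, σ (c • b) (e j)⟫_ℂ • a = c • ⟪e i, σ b (e j)⟫_ℂ • a
      rw [map_smul, smul_apply, inner_smul_right, mul_smul])

theorem matrixCoeff_tmul (a : A) (b : B) (i j : ι) :
    matrixCoeff A σ e (a ⊗ₜ b) i j = ⟪e i, σ b (e j)⟫_ℂ • a := rfl

variable [Fintype ι]

/-- The representation of `M_ι(A)` on `H ⊗ K` given by a representation of `A` on `H` and an
orthonormal family in `K` indexed by `ι`, whose rank one operators serve as the matrix units. -/
def matrixRep (π : A →⋆ₙₐ[ℂ] (H →L[ℂ] H)) (he : Orthonormal ℂ e) :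
    CStarMatrix ι ι A →⋆ₙₐ[ℂ] (HilbertTensor H K →L[ℂ] HilbertTensor H K) where
  toFun x := ∑ i, ∑ j, map (π (x i j)) (rankOne ℂ (e i) (e j))
  map_smul' c x := by
    simp only [CStarMatrix.smul_apply, map_smul, LinearMap.smul_apply, Finset.smul_sum,
      MonoidHom.id_apply]
  map_zero' := by
    simp only [CStarMatrix.zero_apply, map_zero, LinearMap.zero_apply, Finset.sum_const_zero]
  map_add' x y := by
    simp only [CStarMatrix.add_apply, map_add, LinearMap.add_apply, Finset.sum_add_distrib]
  map_mul' x y := by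
    rw [sum_map_rankOne_mul he]
    simp only [CStarMatrix.mul_apply, map_sum, map_mul]
  map_star' x := by
    have hstar (i j : ι) : star (rankOne ℂ (e i) (e j)) = rankOne ℂ (e j) (e i) :=
      adjoint_rankOne _ _
    simp only [star_sum, star_map, hstar, CStarMatrix.star_apply, map_star]
    exact Finset.sum_comm

theorem matrixRep_apply (he : Orthonormal ℂ e) (x : CStarMatrix ι ι A) :
    matrixRep π he x = ∑ i, ∑ j, map (π (x i j)) (rankOne ℂ (e i) (e j)) := rfl

theorem inner_matrixRep_tmul (he : Orthonormal ℂ e) (x : CStarMatrix ι ι A) (i j : ι) (h h' : H) :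
    ⟪tmul h' (e i), matrixRep π he x (tmul h (e j))⟫_ℂ = ⟪h', π (x i j) h⟫_ℂ := by
  classical
  simp only [matrixRep_apply, sum_apply, inner_sum, map_tmul, HilbertTensor.inner_tmul,
    rankOne_apply, inner_smul_right, orthonormal_iff_ite.mp he, mul_ite, mul_one, mul_zero,
    Finset.sum_ite_irrel, Finset.sum_ite_eq, Finset.sum_ite_eq', Finset.sum_const_zero,
    Finset.mem_univ, if_true]

theorem matrixRep_injective (hπ : Function.Injective π) (he : Orthonormal ℂ e) :
    Function.Injective (matrixRep π he) := by
  refine (injective_iff_map_eq_zero _).mpr fun x hx => ?_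
  ext i j
  refine (injective_iff_map_eq_zero π).mp hπ _ (ContinuousLinearMap.ext fun h => ?_)
  refine ext_inner_left ℂ fun h' => ?_
  rw [← inner_matrixRep_tmul he, hx, zero_apply, zero_apply, inner_zero_right, inner_zero_right]

theorem norm_matrixRep_le (hπ' : Function.Injective π') (he : Orthonormal ℂ e)
    (x : CStarMatrix ι ι A) : ‖matrixRep π he x‖ ≤ ‖matrixRep π' he x‖ := by
  let _ : PartialOrder A := CStarAlgebra.spectralOrder A
  have : StarOrderedRing A := CStarAlgebra.spectralOrderedRing A
  calc ‖matrixRep π he x‖ ≤ ‖x‖ := NonUnitalStarAlgHom.norm_apply_le (matrixRep π he) x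
    _ = ‖matrixRep π' he x‖ :=
        (NonUnitalStarAlgHom.norm_map (matrixRep π' he) (matrixRep_injective hπ' he) x).symm

theorem ampRight_mul_spatialRep_mul_ampRight (he : Orthonormal ℂ e) (t : A ⊗[ℂ] B) :
    ampRight (∑ i, rankOne ℂ (e i) (e i)) * spatialRep π σ t
        * ampRight (∑ i, rankOne ℂ (e i) (e i))
      = matrixRep π he (matrixCoeff A σ e t) := by
  induction t using TensorProduct.induction_on with
  | zero => simp only [map_zero, mul_zero, zero_mul]
  | add s t hs ht => rw [map_add, map_add, map_add, mul_add, add_mul, hs, ht]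
  | tmul a b =>
    rw [spatialRep_tmul, ampRight_apply, map_mul_map, map_mul_map, one_mul, mul_one,
      sum_rankOne_mul_mul_sum_rankOne, matrixRep_apply]
    simp only [matrixCoeff_tmul, map_sum, map_smul, LinearMap.smul_apply]

end Matrix

theorem norm_ampRight_starProjection_le (V : Submodule ℂ K) [V.HasOrthogonalProjection] :
    ‖ampRight (H := H) V.starProjection‖ ≤ 1 :=
  (NonUnitalStarAlgHom.norm_apply_le (ampRight (H := H) (K := K)) _).trans V.starProjection_norm_le

theorem norm_compression_spatialRep_le (hπ' : Function.Injective π') (V : Submodule ℂ K)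
    [FiniteDimensional ℂ V] (t : A ⊗[ℂ] B) :
    ‖ampRight V.starProjection * spatialRep π σ t * ampRight V.starProjection‖
      ≤ ‖spatialRep π' σ t‖ := by
  let b := stdOrthonormalBasis ℂ V
  have he : Orthonormal ℂ fun i => (b i : K) := b.orthonormal.comp_linearIsometry V.subtypeₗᵢ
  have hP := b.starProjection_eq_sum_rankOne
  calc ‖ampRight V.starProjection * spatialRep π σ t * ampRight V.starProjection‖
      = ‖matrixRep π he (matrixCoeff A σ _ t)‖ := by
        rw [hP, ampRight_mul_spatialRep_mul_ampRight he]
    _ ≤ ‖matrixRep π' he (matrixCoeff A σ _ t)‖ := norm_matrixRep_le hπ' he _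
    _ = ‖ampRight V.starProjection * spatialRep π' σ t * ampRight V.starProjection‖ := by
        rw [hP, ampRight_mul_spatialRep_mul_ampRight he]
    _ ≤ 1 * ‖spatialRep π' σ t‖ * 1 := by
        have hV := norm_ampRight_starProjection_le (H := H') V
        refine (ContinuousLinearMap.opNorm_comp_le _ _).trans ?_
        gcongr
        refine (ContinuousLinearMap.opNorm_comp_le _ _).trans ?_
        gcongr
    _ = ‖spatialRep π' σ t‖ := by rw [one_mul, mul_one]

theorem exists_finiteDimensional_ampRight_eq (s : Set (H ⊗[ℂ] K)) (hs : s.Finite) :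
    ∃ (V : Submodule ℂ K) (_ : FiniteDimensional ℂ V),
      ∀ x ∈ s, ampRight V.starProjection (ofAlg x) = ofAlg x := by
  obtain ⟨V, hV, hsV⟩ := TensorProduct.exists_finite_submodule_right_of_setFinite s hs
  have hfix (y : H ⊗[ℂ] V) : TensorProduct.mapL 1 V.starProjection (V.subtype.lTensor H y)
      = V.subtype.lTensor H y := by
    induction y using TensorProduct.induction_on with
    | zero => simp only [map_zero]
    | add y z hy hz => simp only [map_add, hy, hz]
    | tmul h v =>
      rw [LinearMap.lTensor_tmul, TensorProduct.mapL_tmul, V.subtype_apply,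
        Submodule.starProjection_eq_self_iff.mpr v.2, one_apply_eq_self]
  refine ⟨V, hV, fun x hx => ?_⟩
  obtain ⟨y, rfl⟩ := hsV hx
  rw [ampRight_apply, map_ofAlg, hfix]

theorem norm_spatialRep_le_of_injective_left (hπ' : Function.Injective π') (t : A ⊗[ℂ] B) :
    ‖spatialRep π σ t‖ ≤ ‖spatialRep π' σ t‖ := by
  refine ContinuousLinearMap.opNorm_le_bound _ (ContinuousLinearMap.opNorm_nonneg _) fun w => ?_
  induction w using denseRange_ofAlg.induction_on with
  | hp => apply isClosed_le <;> fun_prop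
  | ih x =>
    obtain ⟨y, hy⟩ := exists_spatialRep_ofAlg_eq (π := π) (σ := σ) t x
    obtain ⟨V, _, hV⟩ := exists_finiteDimensional_ampRight_eq {x, y} (Set.toFinite _)
    let P := ampRight (H := H) V.starProjection
    have hcompr : spatialRep π σ t (ofAlg x) = (P * spatialRep π σ t * P) (ofAlg x) := by
      rw [mul_apply_eq_comp, mul_apply_eq_comp, hV x (by simp), hy, hV y (by simp)]
    rw [hcompr]
    exact ContinuousLinearMap.le_of_opNorm_le _ (norm_compression_spatialRep_le hπ' V t) _

theorem norm_spatialRep_le_comm (t : A ⊗[ℂ] B) :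
    ‖spatialRep π σ t‖ ≤ ‖spatialRep σ π (TensorProduct.comm ℂ A B t)‖ := by
  refine opNorm_le_of_isometry_intertwining (flip (H := H) (K := K)) fun x => ?_
  induction t using TensorProduct.induction_on with
  | zero => simp
  | add s t hs ht => simp only [map_add, add_apply, hs, ht]
  | tmul a b =>
    let U := (flip (H := H) (K := K)).toContinuousLinearMap
    have hU : U ∘L map (π a) (σ b) = map (σ b) (π a) ∘L U := ext_clm fun h k => by
      simp only [U, ContinuousLinearMap.comp_apply, map_tmul,
        LinearIsometry.coe_toContinuousLinearMap, flip_tmul]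
    exact DFunLike.congr_fun hU x

theorem norm_spatialRep_le_of_injective {K' : Type*} [NormedAddCommGroup K']
    [InnerProductSpace ℂ K'] [CompleteSpace K'] {σ' : B →⋆ₙₐ[ℂ] (K' →L[ℂ] K')}
    (hπ' : Function.Injective π') (hσ' : Function.Injective σ') (t : A ⊗[ℂ] B) :
    ‖spatialRep π σ t‖ ≤ ‖spatialRep π' σ' t‖ :=
  calc ‖spatialRep π σ t‖ ≤ ‖spatialRep π' σ t‖ := norm_spatialRep_le_of_injective_left hπ' t
    _ ≤ ‖spatialRep σ π' (TensorProduct.comm ℂ A B t)‖ := norm_spatialRep_le_comm t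
    _ ≤ ‖spatialRep σ' π' (TensorProduct.comm ℂ A B t)‖ :=
        norm_spatialRep_le_of_injective_left hσ' _
    _ ≤ ‖spatialRep π' σ' (TensorProduct.comm ℂ B A (TensorProduct.comm ℂ A B t))‖ :=
        norm_spatialRep_le_comm _
    _ = ‖spatialRep π' σ' t‖ := by rw [TensorProduct.comm_comm]

end Spatial

section MinNorm

open HilbertTensor

variable {A B H K : Type u} [NonUnitalCStarAlgebra A] [NonUnitalCStarAlgebra B]
  [NormedAddCommGroup H] [InnerProductSpace ℂ H] [CompleteSpace H]
  [NormedAddCommGroup K] [InnerProductSpace ℂ K] [CompleteSpace K]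
  {π : A →⋆ₙₐ[ℂ] (H →L[ℂ] H)} {σ : B →⋆ₙₐ[ℂ] (K →L[ℂ] K)}

theorem norm_spatialRep_le_maxNorm (t : A ⊗[ℂ] B) : ‖spatialRep π σ t‖ ≤ maxNorm t := by
  rw [← pairMap_amp]
  exact le_maxNorm (fun a b => commute_ampLeft_ampRight (π a) (σ b)) t

theorem norm_spatialRep_le_minNorm (t : A ⊗[ℂ] B) : ‖spatialRep π σ t‖ ≤ minNorm t := by
  refine le_csSup ⟨maxNorm t, ?_⟩ ⟨H, _, _, _, K, _, _, _, π, σ, rfl⟩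
  rintro r ⟨H, _, _, _, K, _, _, _, π, σ, rfl⟩
  exact norm_spatialRep_le_maxNorm t

theorem minNorm_le_maxNorm (t : A ⊗[ℂ] B) : minNorm t ≤ maxNorm t := by
  refine Real.sSup_le ?_ (maxNorm_nonneg t)
  rintro r ⟨H, _, _, _, K, _, _, _, π, σ, rfl⟩
  exact norm_spatialRep_le_maxNorm t

theorem minNorm_eq_of_injective (hπ : Function.Injective π) (hσ : Function.Injective σ)
    (t : A ⊗[ℂ] B) : minNorm t = ‖spatialRep π σ t‖ := by
  refine le_antisymm (Real.sSup_le ?_ (ContinuousLinearMap.opNorm_nonneg _))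
    (norm_spatialRep_le_minNorm t)
  rintro r ⟨H', _, _, _, K', _, _, _, π', σ', rfl⟩
  exact norm_spatialRep_le_of_injective hπ hσ t

end MinNorm

section ScalarModule

variable {A H : Type*} [NonUnitalCStarAlgebra A] [PartialOrder A] [StarOrderedRing A]
  [NormedAddCommGroup H] [InnerProductSpace ℂ H]

namespace ScalarModule

/-- The elementary tensor `h ⊗ a` in the Hilbert module `H ⊗ A`. -/
def tmul (h : H) (a : A) : ScalarModule H A := ofAlg H A (PreScalarModule.mk H A (h ⊗ₜ a))

theorem inner_tmul (h h' : H) (a a' : A) :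
    HilbertModule.inner (A := A) (tmul h a) (tmul h' a') = ⟪h, h'⟫_ℂ • (star a * a') :=
  innerFun_ofAlg _ _

theorem dense_span_tmul :
    Dense (Submodule.span ℂ (Set.range fun p : H × A => tmul p.1 p.2) :
      Set (ScalarModule H A)) := by
  refine denseRange_ofAlg.mono ?_
  rintro _ ⟨z, rfl⟩
  obtain ⟨z, rfl⟩ := (PreScalarModule.mk H A).surjective z
  obtain ⟨n, h, a, rfl⟩ := exists_fin_sum z
  rw [map_sum, map_sum]
  exact Submodule.sum_mem _ fun i _ => Submodule.subset_span ⟨(h i, a i), rfl⟩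

end ScalarModule

theorem scalarCorr_tmul [CompleteSpace H] (πH : A →⋆ₙₐ[ℂ] (H →L[ℂ] H)) (c : A) (h : H) (a : A) :
    (scalarCorr A πH).toHom c (ScalarModule.tmul h a) = ScalarModule.tmul (πH c h) a :=
  ScalarModule.op_ofAlg _ _

end ScalarModule

section ScalarIsometry

open HilbertTensor

variable {A B X H K ι : Type*} [NonUnitalCStarAlgebra A] [PartialOrder A] [StarOrderedRing A]
  [NonUnitalCStarAlgebra B] [NormedAddCommGroup X] [NormedSpace ℂ X] [HilbertModule A X]
  [NormedAddCommGroup K] [InnerProductSpace ℂ K] [CompleteSpace K]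
  [NormedAddCommGroup H] [InnerProductSpace ℂ H]
  {φ : A →⋆ₙₐ[ℂ] (K →L[ℂ] K)} {ρ : B →⋆ₙₐ[ℂ] (K →L[ℂ] K)}

namespace InteriorTensor

/-- The elementary tensor `x ⊗ k` in `X ⊗_φ K`, as a bounded linear map in `x`. -/
def tmulRight (φ : A →⋆ₙₐ[ℂ] (K →L[ℂ] K)) (k : K) : X →L[ℂ] InteriorTensor X φ :=
  LinearMap.mkContinuous
    { toFun x := tmul φ x k
      map_add' x y := add_tmul φ x y k
      map_smul' c x := smul_tmul φ c x k } ‖k‖ fun x => by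
    rw [mul_comm]
    exact (UniformSpace.Completion.norm_coe _).trans_le (PreInteriorTensor.norm_tmul_le φ x k)

theorem dense_span_tmul_of_dense {e : ι → X}
    (he : Dense (Submodule.span ℂ (Set.range e) : Set X)) :
    Dense (Submodule.span ℂ (Set.range fun p : ι × K => tmul φ (e p.1) p.2) :
      Set (InteriorTensor X φ)) := by
  set S := Submodule.span ℂ (Set.range fun p : ι × K => tmul φ (e p.1) p.2)
  have hmem (x : X) (k : K) : tmul φ x k ∈ S.topologicalClosure := by
    have hspan : Submodule.span ℂ (Set.range e) ≤ S.comap (tmulRight φ k).toLinearMap := by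
      refine Submodule.span_le.mpr ?_
      rintro _ ⟨i, rfl⟩
      exact Submodule.subset_span ⟨(i, k), rfl⟩
    exact map_mem_closure (f := fun x => tmul φ x k) (tmulRight φ k).continuous (he x) hspan
  refine dense_closure.mp (dense_span_tmul.mono (?_ : _ ≤ S.topologicalClosure))
  refine Submodule.span_le.mpr ?_
  rintro _ ⟨p, rfl⟩
  exact hmem p.1 p.2

theorem dense_span_tmul_scalarModule :
    Dense (Submodule.span ℂ (Set.range fun p : (H × A) × K =>
      tmul φ (ScalarModule.tmul p.1.1 p.1.2) p.2) : Set (InteriorTensor (ScalarModule H A) φ)) :=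
  dense_span_tmul_of_dense (e := fun p : H × A => ScalarModule.tmul p.1 p.2)
    ScalarModule.dense_span_tmul

end InteriorTensor

/-- The isometry `(H ⊗ A) ⊗_φ K → H ⊗ K`, `(h ⊗ a) ⊗ k ↦ h ⊗ φ(a) k`. -/
def scalarIsometry (H : Type*) [NormedAddCommGroup H] [InnerProductSpace ℂ H]
    (φ : A →⋆ₙₐ[ℂ] (K →L[ℂ] K)) :
    InteriorTensor (ScalarModule H A) φ →ₗᵢ[ℂ] HilbertTensor H K :=
  isometryOfGram
    (fun p : (H × A) × K => InteriorTensor.tmul φ (ScalarModule.tmul p.1.1 p.1.2) p.2)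
    (fun p => tmul p.1.1 (φ p.1.2 p.2))
    InteriorTensor.dense_span_tmul_scalarModule fun _ _ => by
      rw [InteriorTensor.inner_tmul, ScalarModule.inner_tmul, map_smul, smul_apply,
        inner_smul_right, inner_map_star_mul, HilbertTensor.inner_tmul]

theorem scalarIsometry_tmul (h : H) (a : A) (k : K) :
    scalarIsometry H φ (InteriorTensor.tmul φ (ScalarModule.tmul h a) k) = tmul h (φ a k) :=
  isometryOfGram_apply (e := fun p : (H × A) × K =>
    InteriorTensor.tmul φ (ScalarModule.tmul p.1.1 p.1.2) p.2) _ _ ((h, a), k)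

theorem IsNondegenerate.denseRange_scalarIsometry (hφ : IsNondegenerate φ) :
    DenseRange (scalarIsometry H φ) := by
  let R := LinearMap.range (scalarIsometry H φ).toLinearMap
  refine dense_closure.mp (HilbertTensor.dense_span_tmul.mono (?_ : _ ≤ R.topologicalClosure))
  refine Submodule.span_le.mpr ?_
  rintro _ ⟨⟨h, k⟩, rfl⟩
  have hspan : Submodule.span ℂ {x : K | ∃ a k, x = φ a k} ≤ R.comap (tmul h).toLinearMap := by
    refine Submodule.span_le.mpr ?_
    rintro _ ⟨a, k, rfl⟩
    exact ⟨_, scalarIsometry_tmul h a k⟩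
  exact map_mem_closure (tmul h).continuous (hφ k) hspan

variable [CompleteSpace H] {πH : A →⋆ₙₐ[ℂ] (H →L[ℂ] H)}

theorem scalarIsometry_pairMap (hc : ∀ a b, Commute (φ a) (ρ b)) (t : A ⊗[ℂ] B)
    (x : InteriorTensor (ScalarModule H A) φ) :
    scalarIsometry H φ
        (pairMap (leftRep (scalarCorr A πH) φ) (rightRep (ScalarModule H A) φ ρ hc) t x)
      = spatialRep πH ρ t (scalarIsometry H φ x) := by
  rw [← pairMap_amp]
  refine pairMap_intertwine (U := (scalarIsometry H φ).toContinuousLinearMap) (fun c b => ?_) t x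
  refine ContinuousLinearMap.ext_on InteriorTensor.dense_span_tmul_scalarModule ?_
  rintro _ ⟨⟨⟨h, a⟩, k⟩, rfl⟩
  have hcomm : φ a (ρ b k) = ρ b (φ a k) := DFunLike.congr_fun (hc a b).eq k
  rw [NonUnitalStarAlgHom.comp_apply, NonUnitalStarAlgHom.comp_apply, ampLeft_mul_ampRight]
  simp only [ContinuousLinearMap.comp_apply, mul_apply_eq_comp, rightRep_tmul, leftRep_tmul,
    scalarCorr_tmul, LinearIsometry.coe_toContinuousLinearMap, scalarIsometry_tmul, map_tmul, hcomm]

end ScalarIsometry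

section ScalarCorr

variable {A B H K : Type u} [NonUnitalCStarAlgebra A] [PartialOrder A] [StarOrderedRing A]
  [NonUnitalCStarAlgebra B] [NormedAddCommGroup H] [InnerProductSpace ℂ H] [CompleteSpace H]
  [NormedAddCommGroup K] [InnerProductSpace ℂ K] [CompleteSpace K]
  {φ : A →⋆ₙₐ[ℂ] (K →L[ℂ] K)} {ρ : B →⋆ₙₐ[ℂ] (K →L[ℂ] K)} {πH : A →⋆ₙₐ[ℂ] (H →L[ℂ] H)}

theorem norm_corrRep_scalarCorr_le (hc : ∀ a b, Commute (φ a) (ρ b)) (t : A ⊗[ℂ] B) :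
    ‖corrRep (scalarCorr A πH) φ ρ hc (MaxTensor.incl A B t)‖ ≤ ‖spatialRep πH ρ t‖ := by
  rw [corrRep_incl]
  exact opNorm_le_of_isometry_intertwining (scalarIsometry H φ) (scalarIsometry_pairMap hc t)

theorem IsNondegenerate.norm_spatialRep_le (hφ : IsNondegenerate φ)
    (hc : ∀ a b, Commute (φ a) (ρ b)) (t : A ⊗[ℂ] B) :
    ‖spatialRep πH ρ t‖ ≤ ‖corrRep (scalarCorr A πH) φ ρ hc (MaxTensor.incl A B t)‖ := by
  rw [corrRep_incl]
  exact opNorm_le_of_denseRange_isometry_intertwining hφ.denseRange_scalarIsometry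
    (scalarIsometry_pairMap hc t)

end ScalarCorr

section ToCommutant

variable {B H : Type*} {A K : Type u} [NonUnitalCStarAlgebra A] [NonUnitalCStarAlgebra B]
  [NormedAddCommGroup H] [InnerProductSpace ℂ H] [CompleteSpace H]
  [NormedAddCommGroup K] [InnerProductSpace ℂ K] [CompleteSpace K]
  {φ : A →⋆ₙₐ[ℂ] (K →L[ℂ] K)} {ρ : B →⋆ₙₐ[ℂ] (K →L[ℂ] K)}

/-- A representation commuting with `φ`, as a linear map into the commutant of `φ`. -/
def toCommutant (hc : ∀ a b, Commute (φ a) (ρ b)) : B →ₗ[ℂ] commutant φ where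
  toFun b := ⟨ρ b, mem_commutant_iff.mpr fun a => hc a b⟩
  map_add' b c := Subtype.ext (map_add ρ b c)
  map_smul' c b := Subtype.ext (map_smul ρ c b)

theorem pairMap_toCommutant (hc : ∀ a b, Commute (φ a) (ρ b)) (t : A ⊗[ℂ] B) :
    pairMap φ (commutantIncl φ) ((toCommutant hc).lTensor A t) = pairMap φ ρ t :=
  pairMap_lTensor_eq_comp (V := .id ℂ K) (V' := .id ℂ K) (fun _ _ => rfl) t

theorem spatialRep_toCommutant (hc : ∀ a b, Commute (φ a) (ρ b)) (σ : A →⋆ₙₐ[ℂ] (H →L[ℂ] H))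
    (t : A ⊗[ℂ] B) :
    spatialRep σ (commutantIncl φ) ((toCommutant hc).lTensor A t) = spatialRep σ ρ t := by
  induction t using TensorProduct.induction_on with
  | zero => simp only [map_zero]
  | add s t hs ht => simp only [map_add, hs, ht]
  | tmul a b =>
    rw [LinearMap.lTensor_tmul, spatialRep_tmul, spatialRep_tmul]
    rfl

end ToCommutant

section EssentialSubspace

variable {A B K : Type*} [NonUnitalCStarAlgebra A] [NonUnitalCStarAlgebra B]
  [NormedAddCommGroup K] [InnerProductSpace ℂ K] [CompleteSpace K]

/-- The restriction of a representation to a closed invariant subspace. -/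
def subRep (σ : A →⋆ₙₐ[ℂ] (K →L[ℂ] K)) (M : Submodule ℂ K) [CompleteSpace M]
    (hM : ∀ a, ∀ x ∈ M, σ a x ∈ M) : A →⋆ₙₐ[ℂ] (M →L[ℂ] M) where
  toFun a := (σ a).restrict (hM a)
  map_smul' c a := by ext x; exact DFunLike.congr_fun (map_smul σ c a) (x : K)
  map_zero' := by ext x; exact DFunLike.congr_fun (map_zero σ) (x : K)
  map_add' a b := by ext x; exact DFunLike.congr_fun (map_add σ a b) (x : K)
  map_mul' a b := by ext x; exact DFunLike.congr_fun (map_mul σ a b) (x : K)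
  map_star' a := (ContinuousLinearMap.eq_adjoint_iff _ _).mpr fun x y =>
    (inner_map_left σ _ _ _).trans (by rw [star_star]; rfl)

theorem map_mem_orthogonal {σ : A →⋆ₙₐ[ℂ] (K →L[ℂ] K)} {N : Submodule ℂ K}
    (hN : ∀ a, ∀ x ∈ N, σ a x ∈ N) (a : A) : ∀ x ∈ Nᗮ, σ a x ∈ Nᗮ := by
  intro x hx y hy
  rw [← star_star a, ← inner_map_left]
  exact hx _ (hN _ y hy)

variable {σA : A →⋆ₙₐ[ℂ] (K →L[ℂ] K)} {σB : B →⋆ₙₐ[ℂ] (K →L[ℂ] K)}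

/-- The common kernel of the operators `σ_A(a) σ_B(b)`, i.e. the subspace on which the
representation `a ⊗ b ↦ σ_A(a) σ_B(b)` degenerates. -/
def commonKernel (σA : A →⋆ₙₐ[ℂ] (K →L[ℂ] K)) (σB : B →⋆ₙₐ[ℂ] (K →L[ℂ] K)) : Submodule ℂ K :=
  ⨅ p : A × B, (σA p.1 * σB p.2).ker

theorem mem_commonKernel {x : K} : x ∈ commonKernel σA σB ↔ ∀ a b, σA a (σB b x) = 0 := by
  simp only [commonKernel, Submodule.mem_iInf, Prod.forall]
  rfl

theorem pairMap_apply_of_mem_commonKernel {x : K} (hx : x ∈ commonKernel σA σB) (t : A ⊗[ℂ] B) :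
    pairMap σA σB t x = 0 := by
  induction t using TensorProduct.induction_on with
  | zero => simp
  | add s t hs ht => rw [map_add, add_apply, hs, ht, add_zero]
  | tmul a b => exact mem_commonKernel.mp hx a b

instance : CompleteSpace (commonKernel σA σB) := by
  refine IsClosed.completeSpace_coe (hs := ?_)
  rw [commonKernel, Submodule.coe_iInf]
  exact isClosed_iInter fun p => (σA p.1 * σB p.2).isClosed_ker

theorem map_right_mem_commonKernel (b : B) :
    ∀ x ∈ commonKernel σA σB, σB b x ∈ commonKernel σA σB := by
  intro x hx
  rw [mem_commonKernel] at hx ⊢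
  intro a c
  rw [← mul_apply_eq_comp (σB c), ← map_mul, hx]

theorem map_left_mem_commonKernel (hc : ∀ a b, Commute (σA a) (σB b)) (a : A) :
    ∀ x ∈ commonKernel σA σB, σA a x ∈ commonKernel σA σB := by
  intro x hx
  rw [mem_commonKernel] at hx ⊢
  intro c b
  rw [← mul_apply_eq_comp (σB b), ← (hc a b).eq, mul_apply_eq_comp, ← mul_apply_eq_comp (σA c),
    ← map_mul, hx]

/-- The restriction of `σ_A` to the essential subspace of the pair `(σ_A, σ_B)`. -/
def essentialLeft (hc : ∀ a b, Commute (σA a) (σB b)) :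
    A →⋆ₙₐ[ℂ] ((commonKernel σA σB)ᗮ →L[ℂ] (commonKernel σA σB)ᗮ) :=
  subRep σA _ (map_mem_orthogonal (map_left_mem_commonKernel hc))

/-- The restriction of `σ_B` to the essential subspace of the pair `(σ_A, σ_B)`. -/
def essentialRight (σA : A →⋆ₙₐ[ℂ] (K →L[ℂ] K)) (σB : B →⋆ₙₐ[ℂ] (K →L[ℂ] K)) :
    B →⋆ₙₐ[ℂ] ((commonKernel σA σB)ᗮ →L[ℂ] (commonKernel σA σB)ᗮ) :=
  subRep σB _ (map_mem_orthogonal map_right_mem_commonKernel)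

theorem commute_essential (hc : ∀ a b, Commute (σA a) (σB b)) (a : A) (b : B) :
    Commute (essentialLeft hc a) (essentialRight σA σB b) := by
  ext x
  exact DFunLike.congr_fun (hc a b).eq (x : K)

theorem coe_pairMap_essential (hc : ∀ a b, Commute (σA a) (σB b)) (t : A ⊗[ℂ] B)
    (x : (commonKernel σA σB)ᗮ) :
    (pairMap (essentialLeft hc) (essentialRight σA σB) t x : K) = pairMap σA σB t x :=
  pairMap_intertwine (U := (commonKernel σA σB)ᗮ.subtypeL) (fun _ _ => rfl) t x

theorem norm_pairMap_le_essential (hc : ∀ a b, Commute (σA a) (σB b)) (t : A ⊗[ℂ] B) :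
    ‖pairMap σA σB t‖ ≤ ‖pairMap (essentialLeft hc) (essentialRight σA σB) t‖ := by
  refine ContinuousLinearMap.opNorm_le_bound _ (norm_nonneg _) fun x => ?_
  let p := (commonKernel σA σB)ᗮ.orthogonalProjectionOnto x
  have hx : x - p ∈ commonKernel σA σB :=
    (commonKernel σA σB).orthogonal_orthogonal.le (Submodule.sub_starProjection_mem_orthogonal x)
  calc ‖pairMap σA σB t x‖ = ‖pairMap σA σB t (x - p) + pairMap σA σB t p‖ := by
        rw [← map_add, sub_add_cancel]
    _ = ‖pairMap (essentialLeft hc) (essentialRight σA σB) t p‖ := by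
        rw [pairMap_apply_of_mem_commonKernel hx, zero_add, ← coe_pairMap_essential hc,
          Submodule.coe_norm]
    _ ≤ ‖pairMap (essentialLeft hc) (essentialRight σA σB) t‖ * ‖x‖ :=
        ContinuousLinearMap.le_opNorm_of_le _ (Submodule.norm_orthogonalProjectionOnto_apply_le _ x)

end EssentialSubspace

section Nuclear

variable {A B H K : Type u} [NonUnitalCStarAlgebra A] [NonUnitalCStarAlgebra B]
  [NormedAddCommGroup H] [InnerProductSpace ℂ H] [CompleteSpace H]
  [NormedAddCommGroup K] [InnerProductSpace ℂ K] [CompleteSpace K]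
  {σA : A →⋆ₙₐ[ℂ] (K →L[ℂ] K)} {σB : B →⋆ₙₐ[ℂ] (K →L[ℂ] K)} {πH : A →⋆ₙₐ[ℂ] (H →L[ℂ] H)}

theorem isNondegenerate_lift_essential (hc : ∀ a b, Commute (σA a) (σB b)) :
    IsNondegenerate
      (MaxTensor.lift (essentialLeft hc) (essentialRight σA σB) (commute_essential hc)) := by
  refine isNondegenerate_iff.mpr fun x hx => ?_
  have hxN : (x : K) ∈ commonKernel σA σB := mem_commonKernel.mpr fun a b => by
    have h := hx (MaxTensor.tmul a b)
    rw [MaxTensor.lift_tmul] at h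
    exact congrArg Subtype.val h
  exact Subtype.ext (inner_self_eq_zero.mp (x.2 _ hxN))

theorem IsNuclear.norm_pairMap_le (hA : IsNuclear A) (hπ : Function.Injective πH)
    (hc : ∀ a b, Commute (σA a) (σB b)) (t : A ⊗[ℂ] B) :
    ‖pairMap σA σB t‖ ≤ ‖spatialRep πH σB t‖ := by
  set s := (toCommutant hc).lTensor A t
  have hincl : Function.Injective (commutantIncl σA) := Subtype.val_injective
  calc ‖pairMap σA σB t‖ = ‖pairMap σA (commutantIncl σA) s‖ := by rw [pairMap_toCommutant]
    _ ≤ maxNorm s := le_maxNorm (commute_commutantIncl σA) s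
    _ = minNorm s := hA _ s
    _ = ‖spatialRep πH (commutantIncl σA) s‖ := minNorm_eq_of_injective hπ hincl s
    _ = ‖spatialRep πH σB t‖ := by rw [spatialRep_toCommutant]

variable [PartialOrder A] [StarOrderedRing A]

theorem IsNuclear.hasUFP (hA : IsNuclear A) (hπ : Function.Injective πH) :
    HasUFP (scalarCorr A πH) := by
  intro B _ K _ _ _ σ σA σB hc hnd hσ z hz
  have hle : ‖σ z‖ ≤ ‖corrRep (scalarCorr A πH) σA σB hc z‖ := by
    refine MaxTensor.norm_map_le_of_incl (fun t => ?_) z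
    rw [MaxTensor.map_incl_of_tmul hσ]
    exact (hA.norm_pairMap_le hπ hc t).trans ((hnd.of_maxTensor hc hσ).norm_spatialRep_le hc t)
  rwa [hz, norm_zero, norm_le_zero_iff] at hle

theorem HasUFP.norm_pairMap_le (h : HasUFP (scalarCorr A πH)) (hc : ∀ a b, Commute (σA a) (σB b))
    (t : A ⊗[ℂ] B) : ‖pairMap σA σB t‖ ≤ minNorm t := by
  let τA := essentialLeft hc
  let τB := essentialRight σA σB
  have hτ := commute_essential hc
  calc ‖pairMap σA σB t‖ ≤ ‖pairMap τA τB t‖ := norm_pairMap_le_essential hc t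
    _ = ‖MaxTensor.lift τA τB hτ (MaxTensor.incl A B t)‖ := by rw [MaxTensor.lift_incl]
    _ ≤ ‖corrRep (scalarCorr A πH) τA τB hτ (MaxTensor.incl A B t)‖ :=
        norm_map_le_of_ker_le (h B _ _ τA τB hτ (isNondegenerate_lift_essential hc)
          (MaxTensor.lift_tmul _ _ _)) _
    _ ≤ ‖spatialRep πH τB t‖ := norm_corrRep_scalarCorr_le hτ t
    _ ≤ minNorm t := norm_spatialRep_le_minNorm t

theorem HasUFP.isNuclear (h : HasUFP (scalarCorr A πH)) : IsNuclear A := by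
  intro B _ t
  refine le_antisymm (maxNorm_le ?_ fun K _ _ _ σA σB hc => h.norm_pairMap_le hc t)
    (minNorm_le_maxNorm t)
  exact (ContinuousLinearMap.opNorm_nonneg _).trans
    (norm_spatialRep_le_minNorm (π := πH) (σ := (0 : B →⋆ₙₐ[ℂ] (H →L[ℂ] H))) t)

end Nuclear

end CStarCorr

end

theorem mainTheorem3_general {A : Type u} [NonUnitalCStarAlgebra A] [PartialOrder A]
    [StarOrderedRing A] :
    (∀ (X : Type u) [NormedAddCommGroup X] [NormedSpace ℂ X]
      [CStarCorr.HilbertModule A X] (π : CStarCorr.LeftAction A A X),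
      CStarCorr.HasUFP π ↔ CStarCorr.WeaklyContainedUniv (CStarCorr.identityCorr A) π) ∧
    (∀ (H : Type u) [NormedAddCommGroup H] [InnerProductSpace ℂ H] [CompleteSpace H]
      (πH : A →⋆ₙₐ[ℂ] (H →L[ℂ] H)), Function.Injective πH →
      List.TFAE [CStarCorr.IsNuclear A,
        CStarCorr.HasUFP (CStarCorr.scalarCorr A πH),
        CStarCorr.WeaklyContainedUniv (CStarCorr.identityCorr A)
          (CStarCorr.scalarCorr A πH)]) := by
  refine ⟨fun X _ _ _ π => CStarCorr.hasUFP_iff_weaklyContainedUniv π, ?_⟩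
  intro H _ _ _ πH hπ
  tfae_have 1 → 2 := fun hA => hA.hasUFP hπ
  tfae_have 2 → 1 := fun hUFP => hUFP.isNuclear
  tfae_have 2 ↔ 3 := CStarCorr.hasUFP_iff_weaklyContainedUniv _
  tfae_finish

theorem mainTheorem3 {A : Type u} [NonUnitalCStarAlgebra A] [PartialOrder A] [StarOrderedRing A] :
    (∀ (X : Type u) [NormedAddCommGroup X] [NormedSpace ℂ X] [CompleteSpace X]
      [CStarCorr.HilbertModule A X] (π : CStarCorr.LeftAction A A X),
      CStarCorr.HasUFP π ↔ CStarCorr.WeaklyContainedUniv (CStarCorr.identityCorr A) π) ∧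
    (∀ (H : Type u) [NormedAddCommGroup H] [InnerProductSpace ℂ H] [CompleteSpace H]
      (πH : A →⋆ₙₐ[ℂ] (H →L[ℂ] H)), Function.Injective πH →
      List.TFAE [CStarCorr.IsNuclear A,
        CStarCorr.HasUFP (CStarCorr.scalarCorr A πH),
        CStarCorr.WeaklyContainedUniv (CStarCorr.identityCorr A)
          (CStarCorr.scalarCorr A πH)]) :=
  ⟨fun X _ _ _ _ π => mainTheorem3_general.1 X π, mainTheorem3_general.2⟩
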